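/- Let $(\mathcal M,g)$ be a smooth four-dimensional Lorentzian manifold of signature $(+,-,-,-)$ which is a vacuum solution of the Einstein equations, $R_{\mu\nu}=0$, and let $\xi$ be a Killing vector field on it. Let $\nabla$ be the Levi-Civita connection, with curvature $(\nabla_\alpha\nabla_\beta-\nabla_\beta\nabla_\alpha)v^\mu=R^\mu{}_{\nu\alpha\beta}v^\nu$ and $R_{\nu\beta}=R^\mu{}_{\nu\mu\beta}$, and let $W_{\alpha\beta\mu\nu}$ be the Weyl tensor. Let $\mathcal U\subset\mathcal M$ be open, with volume form $\eta_{\mu\nu\alpha\beta}$ (for a chosen orientation of $\mathcal U$). On $\mathcal U$ put $F_{\mu\nu}=\nabla_\mu\xi_\nu$, $$\mathcal F_{\alpha\beta}=F_{\alpha\beta}+\tfrac{i}{2}\eta_{\alpha\beta}{}^{\chi\rho}F_{\chi\rho},\qquad \mathcal W_{\alpha\beta\chi\rho}=W_{\alpha\beta\chi\rho}+\tfrac{i}{2}\eta_{\chi\rho}{}^{\mu\nu}W_{\alpha\beta\mu\nu},$$ $$\mathcal I_{\alpha\rho\beta\chi}=\tfrac14\left(i\,\eta_{\alpha\rho\beta\chi}+g_{\alpha\beta}g_{\rho\chi}-g_{\alpha\chi}g_{\beta\rho}\right),\qquad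 \sigma_\alpha=2\mathcal F_{\alpha\beta}\xi^\beta .$$ An Ernst potential on $\mathcal U$ is a differentiable function $\sigma:\mathcal U\to\mathbb C$ with $\nabla_\alpha\sigma=\sigma_\alpha$. Where $\sigma\neq0$, the Mars–Simon tensor, its superenergy tensor and the associated current are $$\mathcal S_{\alpha\beta\chi\mu}=\mathcal W_{\alpha\beta\chi\mu}+\frac6\sigma\left(\mathcal F_{\alpha\beta}\mathcal F_{\chi\mu}-\tfrac13\mathcal F_{\kappa\rho}\mathcal F^{\kappa\rho}\,\mathcal I_{\alpha\beta\chi\mu}\right),\qquad T_{\alpha\beta\gamma\delta}=\mathcal S_{\alpha}{}^{\mu\nu}{}_{\beta}\,\overline{\mathcal S}_{\gamma\mu\nu\delta},$$ $$P^\alpha=\frac1{|\sigma|^6}\,T^\alpha{}_{\beta\gamma\delta}\,\xi^\beta\xi^\gamma\xi^\delta .$$ **Theorem.** Let $\sigma$ be an Ernst potential on $\mathcal U$ without zeros. Then the current $P^\alpha$ is real, differentiable, and conserved in $\mathcal U$: $\nabla_\alpha P^\alpha=0$. Moreover, for every $k\in\mathbb C$ the function $\sigma+k$ is again an Ernst potential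 on $\mathcal U$, and the current built from it is real, differentiable and conserved on $\{x\in\mathcal U:\sigma(x)+k\neq0\}$; if $\mathcal U$ is connected, every Ernst potential on $\mathcal U$ is of the form $\sigma+k$ with $k\in\mathbb C$. Thus one obtains a family of conserved currents indexed by a complex constant. -/

import Mathlib

open scoped Manifold ContDiff Bundle

noncomputable section

namespace MarsSimon

/-- The model space of a four-dimensional manifold. -/
abbrev E4 : Type := EuclideanSpace ℝ (Fin 4)

/-! ## Tensor calculus for component functions on an open set of coordinate space

A tensor field is represented in a coordinate system by its component functions; the last argument
is the coordinate point. Latin letters `a b c d …` are coordinate indices, running over `Fin 4`. -/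

section Components

/-- The partial derivative `∂ᵢ f` at `y`. -/
def pd {V : Type*} [NormedAddCommGroup V] [NormedSpace ℝ V] (i : Fin 4) (f : E4 → V) (y : E4) : V :=
  fderiv ℝ f y (EuclideanSpace.single i 1)

/-- The components `g^{ab}` of the inverse metric. -/
def ginv (g : Fin 4 → Fin 4 → E4 → ℝ) (a b : Fin 4) (y : E4) : ℝ :=
  (Matrix.of fun i j => g i j y)⁻¹ a b

/-- The Christoffel symbols `Γ^c_{ab}` of the Levi-Civita connection. -/
def christoffel (g : Fin 4 → Fin 4 → E4 → ℝ) (c a b : Fin 4) (y : E4) : ℝ :=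
  1 / 2 * ∑ l, ginv g c l y * (pd a (g b l) y + pd b (g a l) y - pd l (g a b) y)

/-- The Riemann tensor `R^m_{n a b}`, with
`(∇_a ∇_b - ∇_b ∇_a) v^m = R^m_{n a b} v^n`. -/
def riemann (g : Fin 4 → Fin 4 → E4 → ℝ) (m n a b : Fin 4) (y : E4) : ℝ :=
  pd a (christoffel g m b n) y - pd b (christoffel g m a n) y
    + ∑ l, (christoffel g m a l y * christoffel g l b n y
        - christoffel g m b l y * christoffel g l a n y)

/-- The Ricci tensor `R_{n b} = R^m_{n m b}`. -/
def ricci (g : Fin 4 → Fin 4 → E4 → ℝ) (n b : Fin 4) (y : E4) : ℝ :=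
  ∑ m, riemann g m n m b y

/-- The scalar curvature. -/
def scalarCurvature (g : Fin 4 → Fin 4 → E4 → ℝ) (y : E4) : ℝ :=
  ∑ a, ∑ b, ginv g a b y * ricci g a b y

/-- The Riemann tensor `R_{m n a b}` with all indices lowered. -/
def riemannLow (g : Fin 4 → Fin 4 → E4 → ℝ) (m n a b : Fin 4) (y : E4) : ℝ :=
  ∑ l, g m l y * riemann g l n a b y

/-- The Weyl tensor `W_{m n a b}` in dimension four. -/
def weyl (g : Fin 4 → Fin 4 → E4 → ℝ) (m n a b : Fin 4) (y : E4) : ℝ :=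
  riemannLow g m n a b y
    - 1 / 2 * (g m a y * ricci g n b y - g m b y * ricci g n a y
        + g n b y * ricci g m a y - g n a y * ricci g m b y)
    + scalarCurvature g y / 6 * (g m a y * g n b y - g m b y * g n a y)

/-- The 1-form `ξ_a = g_{ab} ξ^b`. -/
def lower (g : Fin 4 → Fin 4 → E4 → ℝ) (ξ : Fin 4 → E4 → ℝ) (a : Fin 4) (y : E4) : ℝ :=
  ∑ b, g a b y * ξ b y

/-- The covariant derivative `F_{ab} = ∇_a ξ_b` (the Killing 2-form when `ξ` is Killing). -/
def killingForm (g : Fin 4 → Fin 4 → E4 → ℝ) (ξ : Fin 4 → E4 → ℝ) (a b : Fin 4) (y : E4) : ℝ :=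
  pd a (lower g ξ b) y - ∑ l, christoffel g l a b y * lower g ξ l y

/-- The volume form with two raised indices, `η_{ab}^{cd}`. -/
def etaMixed (g : Fin 4 → Fin 4 → E4 → ℝ) (η : Fin 4 → Fin 4 → Fin 4 → Fin 4 → E4 → ℝ)
    (a b c d : Fin 4) (y : E4) : ℝ :=
  ∑ m, ∑ n, ginv g c m y * ginv g d n y * η a b m n y

/-- The self-dual Killing form `𝓕_{ab} = F_{ab} + i F*_{ab}`, where
`F*_{ab} = (1/2) η_{ab}^{cd} F_{cd}`. -/
def sdKilling (g : Fin 4 → Fin 4 → E4 → ℝ) (ξ : Fin 4 → E4 → ℝ)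
    (η : Fin 4 → Fin 4 → Fin 4 → Fin 4 → E4 → ℝ) (a b : Fin 4) (y : E4) : ℂ :=
  (killingForm g ξ a b y : ℂ)
    + Complex.I * ((1 / 2 * ∑ c, ∑ d, etaMixed g η a b c d y * killingForm g ξ c d y : ℝ) : ℂ)

/-- The self-dual Weyl tensor `𝓦_{abcd} = W_{abcd} + i W*_{abcd}`, where
`W*_{abcd} = (1/2) η_{cd}^{mn} W_{abmn}`. -/
def sdWeyl (g : Fin 4 → Fin 4 → E4 → ℝ) (η : Fin 4 → Fin 4 → Fin 4 → Fin 4 → E4 → ℝ)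
    (a b c d : Fin 4) (y : E4) : ℂ :=
  (weyl g a b c d y : ℂ)
    + Complex.I * ((1 / 2 * ∑ m, ∑ n, etaMixed g η c d m n y * weyl g a b m n y : ℝ) : ℂ)

/-- The Ernst 1-form `σ_a = 2 𝓕_{ab} ξ^b`. -/
def ernstForm (g : Fin 4 → Fin 4 → E4 → ℝ) (ξ : Fin 4 → E4 → ℝ)
    (η : Fin 4 → Fin 4 → Fin 4 → Fin 4 → E4 → ℝ) (a : Fin 4) (y : E4) : ℂ :=
  2 * ∑ b, sdKilling g ξ η a b y * (ξ b y : ℂ)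

/-- The scalar `𝓕_{kr} 𝓕^{kr}`. -/
def sdKillingSq (g : Fin 4 → Fin 4 → E4 → ℝ) (ξ : Fin 4 → E4 → ℝ)
    (η : Fin 4 → Fin 4 → Fin 4 → Fin 4 → E4 → ℝ) (y : E4) : ℂ :=
  ∑ k, ∑ r, ∑ m, ∑ n,
    (ginv g k m y : ℂ) * (ginv g r n y : ℂ) * sdKilling g ξ η k r y * sdKilling g ξ η m n y

/-- The metric in the space of self-dual 2-forms,
`𝓘_{arbc} = (1/4) (i η_{arbc} + g_{ab} g_{rc} - g_{ac} g_{br})`. -/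
def sdMetric (g : Fin 4 → Fin 4 → E4 → ℝ) (η : Fin 4 → Fin 4 → Fin 4 → Fin 4 → E4 → ℝ)
    (a r b c : Fin 4) (y : E4) : ℂ :=
  1 / 4 * (Complex.I * (η a r b c y : ℂ)
    + ((g a b y * g r c y - g a c y * g b r y : ℝ) : ℂ))

/-- The Mars–Simon tensor
`𝓢_{abcd} = 𝓦_{abcd} + (6/σ) (𝓕_{ab} 𝓕_{cd} - (1/3) 𝓕_{kr} 𝓕^{kr} 𝓘_{abcd})`. -/
def marsSimon (g : Fin 4 → Fin 4 → E4 → ℝ) (ξ : Fin 4 → E4 → ℝ)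
    (η : Fin 4 → Fin 4 → Fin 4 → Fin 4 → E4 → ℝ) (σ : E4 → ℂ) (a b c d : Fin 4) (y : E4) : ℂ :=
  sdWeyl g η a b c d y
    + 6 / σ y * (sdKilling g ξ η a b y * sdKilling g ξ η c d y
        - sdKillingSq g ξ η y / 3 * sdMetric g η a b c d y)

/-- The superenergy tensor of the Mars–Simon tensor,
`T_{abcd} = 𝓢_a^{mn}_b \bar 𝓢_{cmnd}`. -/
def superenergy (g : Fin 4 → Fin 4 → E4 → ℝ) (ξ : Fin 4 → E4 → ℝ)
    (η : Fin 4 → Fin 4 → Fin 4 → Fin 4 → E4 → ℝ) (σ : E4 → ℂ) (a b c d : Fin 4) (y : E4) : ℂ :=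
  ∑ m, ∑ n, ∑ k, ∑ l, (ginv g m k y : ℂ) * (ginv g n l y : ℂ) *
    marsSimon g ξ η σ a k l b y * starRingEnd ℂ (marsSimon g ξ η σ c m n d y)

/-- The current `P^e = |σ|⁻⁶ T^e_{bcd} ξ^b ξ^c ξ^d`. -/
def current (g : Fin 4 → Fin 4 → E4 → ℝ) (ξ : Fin 4 → E4 → ℝ)
    (η : Fin 4 → Fin 4 → Fin 4 → Fin 4 → E4 → ℝ) (σ : E4 → ℂ) (e : Fin 4) (y : E4) : ℂ :=
  1 / (‖σ y‖ ^ 6 : ℝ) * ∑ a, ∑ b, ∑ c, ∑ d,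
    (ginv g e a y : ℂ) * superenergy g ξ η σ a b c d y * (ξ b y : ℂ) * (ξ c y : ℂ) * (ξ d y : ℂ)

/-- The covariant divergence `∇_a P^a = ∂_a P^a + Γ^a_{ab} P^b`. -/
def divergence (g : Fin 4 → Fin 4 → E4 → ℝ) (P : Fin 4 → E4 → ℂ) (y : E4) : ℂ :=
  ∑ a, (pd a (P a) y + ∑ b, (christoffel g a a b y : ℂ) * P b y)

end Components

/-! ## Lorentzian four-manifolds -/

section Manifold

variable {M : Type*} [TopologicalSpace M] [ChartedSpace E4 M]

/-- The (smooth) coordinate systems of `M`: all charts of its maximal atlas. -/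
def IsChart (φ : OpenPartialHomeomorph M E4) : Prop :=
  φ ∈ IsManifold.maximalAtlas 𝓘(ℝ, E4) ∞ M

/-- The coordinate vector `∂/∂yⁱ` of the chart `φ`, at the point with coordinates `y`. -/
def coordVec (φ : OpenPartialHomeomorph M E4) (y : E4) (i : Fin 4) :
    TangentSpace 𝓘(ℝ, E4) (φ.symm y) :=
  mfderiv 𝓘(ℝ, E4) 𝓘(ℝ, E4) φ.symm y (EuclideanSpace.single i (1 : ℝ) : E4)

/-- The components of a vector field in the chart `φ`. -/
def vecComp (φ : OpenPartialHomeomorph M E4) (ξ : ∀ x : M, TangentSpace 𝓘(ℝ, E4) x)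
    (a : Fin 4) (y : E4) : ℝ :=
  let v : E4 := mfderiv 𝓘(ℝ, E4) 𝓘(ℝ, E4) φ (φ.symm y) (ξ (φ.symm y))
  v a

/-- The components of a 4-form in the chart `φ`. -/
def formComp (φ : OpenPartialHomeomorph M E4)
    (η : ∀ x : M, (TangentSpace 𝓘(ℝ, E4) x) [⋀^Fin 4]→ₗ[ℝ] ℝ)
    (a b c d : Fin 4) (y : E4) : ℝ :=
  η (φ.symm y) ![coordVec φ y a, coordVec φ y b, coordVec φ y c, coordVec φ y d]

variable (M) in
/-- A smooth Lorentzian metric of signature `(+,-,-,-)` on a four-dimensional manifold. -/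
structure LorentzMetric [IsManifold 𝓘(ℝ, E4) ∞ M] where
  /-- The scalar product of two tangent vectors. -/
  inner (x : M) : TangentSpace 𝓘(ℝ, E4) x →L[ℝ] TangentSpace 𝓘(ℝ, E4) x →L[ℝ] ℝ
  symm (x : M) (v w : TangentSpace 𝓘(ℝ, E4) x) : inner x v w = inner x w v
  signature (x : M) : ∃ e : Fin 4 → TangentSpace 𝓘(ℝ, E4) x,
    ∀ i j, inner x (e i) (e j) = Matrix.diagonal ![1, -1, -1, -1] i j
  contMDiff : ContMDiff 𝓘(ℝ, E4) (𝓘(ℝ, E4).prod 𝓘(ℝ, E4 →L[ℝ] E4 →L[ℝ] ℝ)) ∞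
    (fun x ↦ Bundle.TotalSpace.mk' (E4 →L[ℝ] E4 →L[ℝ] ℝ)
      (E := fun x : M ↦ TangentSpace 𝓘(ℝ, E4) x →L[ℝ] TangentSpace 𝓘(ℝ, E4) x →L[ℝ] ℝ) x (inner x))

variable [IsManifold 𝓘(ℝ, E4) ∞ M]

namespace LorentzMetric

variable (g : LorentzMetric M)

/-- The components `g_{ab}` of the metric in the chart `φ`. -/
def comp (φ : OpenPartialHomeomorph M E4) (a b : Fin 4) (y : E4) : ℝ :=
  g.inner (φ.symm y) (coordVec φ y a) (coordVec φ y b)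

/-- The vacuum Einstein equations `R_{ab} = 0`. -/
def IsVacuum : Prop :=
  ∀ φ : OpenPartialHomeomorph M E4, IsChart φ → ∀ y ∈ φ.target,
    ∀ a b, ricci (g.comp φ) a b y = 0

/-- `ξ` is a smooth Killing vector field: `∇_a ξ_b + ∇_b ξ_a = 0`. -/
structure IsKilling (ξ : ∀ x : M, TangentSpace 𝓘(ℝ, E4) x) : Prop where
  contMDiff : ContMDiff 𝓘(ℝ, E4) (𝓘(ℝ, E4).prod 𝓘(ℝ, E4)) ∞
    (fun x ↦ (⟨x, ξ x⟩ : TangentBundle 𝓘(ℝ, E4) M))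
  killing : ∀ φ : OpenPartialHomeomorph M E4, IsChart φ → ∀ y ∈ φ.target, ∀ a b,
    killingForm (g.comp φ) (vecComp φ ξ) a b y + killingForm (g.comp φ) (vecComp φ ξ) b a y = 0

/-- `η` is, on the open set `U`, the volume form of the metric for one of the orientations of `U`:
it is a smooth 4-form taking the values `±1` on orthonormal frames. The last condition is
expressed through Gram determinants. -/
structure IsVolumeFormOn (η : ∀ x : M, (TangentSpace 𝓘(ℝ, E4) x) [⋀^Fin 4]→ₗ[ℝ] ℝ)
    (U : Set M) : Prop where
  smooth : ∀ φ : OpenPartialHomeomorph M E4, IsChart φ → ∀ a b c d,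
    ContDiffOn ℝ ∞ (formComp φ η a b c d) (φ.target ∩ φ.symm ⁻¹' U)
  sq_eq : ∀ x ∈ U, ∀ v : Fin 4 → TangentSpace 𝓘(ℝ, E4) x,
    (η x v) ^ 2 = - (Matrix.of fun i j => g.inner x (v i) (v j)).det

/-- `σ` is an Ernst potential on `U`: a complex function, differentiable on `U`, with
`∇_a σ = σ_a`, where `σ_a` is the Ernst 1-form. -/
structure IsErnstPotential (ξ : ∀ x : M, TangentSpace 𝓘(ℝ, E4) x)
    (η : ∀ x : M, (TangentSpace 𝓘(ℝ, E4) x) [⋀^Fin 4]→ₗ[ℝ] ℝ) (U : Set M) (σ : M → ℂ) : Prop where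
  mdifferentiableAt : ∀ x ∈ U, MDifferentiableAt 𝓘(ℝ, E4) 𝓘(ℝ, ℂ) σ x
  deriv_eq : ∀ φ : OpenPartialHomeomorph M E4, IsChart φ → ∀ y ∈ φ.target, φ.symm y ∈ U →
    ∀ a, pd a (σ ∘ φ.symm) y = ernstForm (g.comp φ) (vecComp φ ξ) (formComp φ η) a y

/-- The components in the chart `φ` of the current `P^e = |σ|⁻⁶ T^e_{bcd} ξ^b ξ^c ξ^d`. -/
def currentComp (ξ : ∀ x : M, TangentSpace 𝓘(ℝ, E4) x)
    (η : ∀ x : M, (TangentSpace 𝓘(ℝ, E4) x) [⋀^Fin 4]→ₗ[ℝ] ℝ) (σ : M → ℂ)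
    (φ : OpenPartialHomeomorph M E4) (e : Fin 4) (y : E4) : ℂ :=
  current (g.comp φ) (vecComp φ ξ) (formComp φ η) (σ ∘ φ.symm) e y

/-- On `U` the current `P` is real, differentiable, and conserved: `∇_a P^a = 0`. -/
def IsRealConservedCurrentOn (ξ : ∀ x : M, TangentSpace 𝓘(ℝ, E4) x)
    (η : ∀ x : M, (TangentSpace 𝓘(ℝ, E4) x) [⋀^Fin 4]→ₗ[ℝ] ℝ) (σ : M → ℂ) (U : Set M) : Prop :=
  ∀ φ : OpenPartialHomeomorph M E4, IsChart φ → ∀ y ∈ φ.target, φ.symm y ∈ U →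
    (∀ e, (g.currentComp ξ η σ φ e y).im = 0) ∧
    (∀ e, DifferentiableAt ℝ (g.currentComp ξ η σ φ e) y) ∧
    divergence (g.comp φ) (g.currentComp ξ η σ φ) y = 0

end LorentzMetric

end Manifold

end MarsSimon

end

noncomputable section

/-! ## Calculus of partial derivatives and of the Levi-Civita connection -/

namespace MarsSimon

open Matrix

section PartialDerivatives

variable {V : Type*} [NormedAddCommGroup V] [NormedSpace ℝ V]

/-! The assertion is local, so it is proved at one point `p` of a chart. Over ℂ the spacelike
vectors of an orthonormal frame can be multiplied by i; the metric becomes δ_ij and the position of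
indices ceases to matter. The frame is continued off `p` with vanishing covariant derivative at `p`
(`frame`), so that covariant derivatives at `p` are plain derivatives of frame components, recorded
by `Jet`. The volume form becomes κ times the Levi-Civita symbol with κ² = -1, and the ±i of the
(anti-)self-dual parts turns into an eigenvalue s = ±1 of `hodge`. What remains is an identity
between numbers, `conservation`.

The geometry enters through ∇_a F_bc = ξ^d R_dabc (`covD₂_killingForm`), the second Bianchi identity
and Ricci-flatness, under which the Weyl and Riemann tensors coincide. They give ∇_e 𝓕_ab = ξ^d
𝓦_deab and ∇^a 𝓦_abcd = 0 (`isVacuumJet`, `isErnstData`). The anticommutator of two 2-forms of the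
same duality is a multiple of the identity (`IsSelfDual.anticomm`). Therefore σ^a 𝓕_ab = ½ 𝓕² ξ_b,
and 𝓕_ab ∇^a 𝓕_cd equals ½ σ^a 𝓦_abcd up to a multiple of ξ_b. It follows that ∇^a 𝓢_abcd = (3/σ)
σ^a 𝓢_abcd modulo terms ξ_b C_cd and v^a 𝓘_abcd with v·ξ = 0. Such terms vanish on contraction with
N^bc ξ^d whenever N is symmetric and annihilates ξ; this is `pairing_div`.

The current is |σ|⁻⁶ 𝓢_a^{mn}_b ξ^b N_mn, where N_mn is the conjugate tensor contracted twice with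
ξ, and N has the two properties just required. In the divergence, the derivative of 𝓢 yields 3σ_a/σ
times the current. The superenergy tensor is symmetric in its first and third index because products
of forms of opposite duality are symmetric (`IsSelfDual.mul_symm`). This moves the free index to the
conjugate tensor, whose derivative then yields the conjugate factor. The weight |σ|⁻⁶ is chosen so
that its gradient cancels both. Derivatives of ξ contribute F, which is antisymmetric, contracted
with something symmetric. The same symmetry of the superenergy tensor shows that the current is
real.

The argument uses only ∇σ = σ_a and σ ≠ 0, so it applies to σ + k. Two Ernst potentials have equal
gradients, so their difference is locally constant. -/

lemma pd_add {f g : E4 → V} {y : E4} (i : Fin 4) (hf : DifferentiableAt ℝ f y)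
    (hg : DifferentiableAt ℝ g y) : pd i (fun z => f z + g z) y = pd i f y + pd i g y := by
  simp only [pd]; rw [fderiv_fun_add hf hg]; rfl

lemma pd_sub {f g : E4 → V} {y : E4} (i : Fin 4) (hf : DifferentiableAt ℝ f y)
    (hg : DifferentiableAt ℝ g y) : pd i (fun z => f z - g z) y = pd i f y - pd i g y := by
  simp only [pd]; rw [fderiv_fun_sub hf hg]; rfl

lemma pd_sum {ι : Type*} [Fintype ι] {f : ι → E4 → V} {y : E4} (i : Fin 4)
    (hf : ∀ j, DifferentiableAt ℝ (f j) y) :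
    pd i (fun z => ∑ j, f j z) y = ∑ j, pd i (f j) y := by
  simp only [pd]; rw [fderiv_fun_sum (fun j _ => hf j)]; simp

lemma pd_mul {A : Type*} [NormedCommRing A] [NormedAlgebra ℝ A] {f g : E4 → A} {y : E4}
    (i : Fin 4) (hf : DifferentiableAt ℝ f y) (hg : DifferentiableAt ℝ g y) :
    pd i (fun z => f z * g z) y = pd i f y * g y + f y * pd i g y := by
  simp only [pd]; rw [fderiv_fun_mul hf hg]; simp; ring

lemma pd_const (i : Fin 4) (c : V) (y : E4) : pd i (fun _ => c) y = 0 := by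
  simp [pd]

lemma pd_const_mul {A : Type*} [NormedCommRing A] [NormedAlgebra ℝ A] {f : E4 → A} {y : E4}
    (i : Fin 4) (c : A) (hf : DifferentiableAt ℝ f y) :
    pd i (fun z => c * f z) y = c * pd i f y := by
  rw [pd_mul i (differentiableAt_const c) hf, pd_const]; ring

lemma pd_congr {f g : E4 → V} {y : E4} (i : Fin 4) (h : f =ᶠ[nhds y] g) : pd i f y = pd i g y := by
  simp only [pd]; rw [h.fderiv_eq]

lemma pd_congr_on {f g : E4 → V} {O : Set E4} (hO : IsOpen O) {y : E4} (hy : y ∈ O) (i : Fin 4)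
    (h : ∀ z ∈ O, f z = g z) : pd i f y = pd i g y :=
  pd_congr i (Filter.eventuallyEq_of_mem (hO.mem_nhds hy) h)

lemma differentiableAt_of_smooth {f : E4 → V} {O : Set E4} (hf : ContDiffOn ℝ ∞ f O)
    (hO : IsOpen O) {y : E4} (hy : y ∈ O) : DifferentiableAt ℝ f y :=
  (hf.contDiffAt (hO.mem_nhds hy)).differentiableAt (by simp)

lemma smooth_pd {f : E4 → V} {O : Set E4} (hf : ContDiffOn ℝ ∞ f O) (hO : IsOpen O)
    (i : Fin 4) : ContDiffOn ℝ ∞ (pd i f) O :=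
  (hf.fderiv_of_isOpen hO (by simp)).clm_apply contDiffOn_const

lemma pd_comm {f : E4 → V} {O : Set E4} (hf : ContDiffOn ℝ ∞ f O) (hO : IsOpen O) {y : E4}
    (hy : y ∈ O) (i j : Fin 4) : pd i (pd j f) y = pd j (pd i f) y := by
  have h1 : DifferentiableAt ℝ (fderiv ℝ f) y :=
    differentiableAt_of_smooth (hf.fderiv_of_isOpen hO (m := ∞) (by simp)) hO hy
  have h2 : IsSymmSndFDerivAt ℝ f y :=
    (hf.contDiffAt (hO.mem_nhds hy)).isSymmSndFDerivAt (by simpa using (ENat.LEInfty.out : (2 : ℕ∞ω) ≤ ∞))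
  have key : ∀ a b : Fin 4, pd a (pd b f) y =
      fderiv ℝ (fderiv ℝ f) y (EuclideanSpace.single a 1) (EuclideanSpace.single b 1) := by
    intro a b
    change fderiv ℝ (fun z => fderiv ℝ f z (EuclideanSpace.single b 1)) y _ = _
    rw [fderiv_clm_apply h1 (differentiableAt_const _)]
    simp
  rw [key, key]
  exact h2 _ _

end PartialDerivatives

/-- The components of a smooth, symmetric and non-degenerate metric on an open set. -/
structure IsMetricOn (g : Fin 4 → Fin 4 → E4 → ℝ) (O : Set E4) : Prop where
  isOpen : IsOpen O
  smooth (a b : Fin 4) : ContDiffOn ℝ ∞ (g a b) O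
  symm (a b : Fin 4) (y : E4) : g a b y = g b a y
  det_ne (y : E4) : y ∈ O → (Matrix.of fun i j => g i j y).det ≠ 0

namespace IsMetricOn

variable {g : Fin 4 → Fin 4 → E4 → ℝ} {O : Set E4} (hg : IsMetricOn g O) {y : E4} (hy : y ∈ O)
include hg

/-- The matrix of metric components. -/
abbrev _root_.MarsSimon.gMat (g : Fin 4 → Fin 4 → E4 → ℝ) (y : E4) : Matrix (Fin 4) (Fin 4) ℝ :=
  Matrix.of fun i j => g i j y

/-- The connection matrices `(Γ_a)^m_n`. -/
abbrev _root_.MarsSimon.gammaMat (g : Fin 4 → Fin 4 → E4 → ℝ) (a : Fin 4) (y : E4) :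
    Matrix (Fin 4) (Fin 4) ℝ :=
  Matrix.of fun m n => christoffel g m a n y

/-- Cramer's rule: an entry of the inverse is a cofactor divided by the determinant, and both are
polynomials in the components. -/
lemma smooth_ginv (a b : Fin 4) : ContDiffOn ℝ ∞ (ginv g a b) O := by
  have hdet : ∀ N : Fin 4 → Fin 4 → E4 → ℝ, (∀ i j, ContDiffOn ℝ ∞ (N i j) O) →
      ContDiffOn ℝ ∞ (fun y => (Matrix.of fun i j => N i j y).det) O := by
    intro N hN
    simp only [Matrix.det_apply, Matrix.of_apply]
    refine ContDiffOn.sum fun p _ => ?_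
    exact ContDiffOn.const_smul _ (contDiffOn_prod fun i _ => hN _ _)
  have h1 : ∀ y ∈ O, ginv g a b y = ((gMat g y).det)⁻¹ *
      (Matrix.of fun i j => (Matrix.updateRow (gMat g y) b (Pi.single a 1)) i j).det := by
    intro y _
    rw [ginv, Matrix.inv_def, Matrix.smul_apply, Ring.inverse_eq_inv', smul_eq_mul,
      Matrix.adjugate_apply]
    rfl
  refine ContDiffOn.congr ?_ h1
  refine ContDiffOn.mul ((hdet g hg.smooth).inv hg.det_ne) (hdet _ ?_)
  intro i j
  by_cases h : i = b
  · subst h; simp only [Matrix.updateRow_self]; exact contDiffOn_const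
  · simp only [Matrix.updateRow_ne h]; exact hg.smooth i j

lemma smooth_christoffel (c a b : Fin 4) : ContDiffOn ℝ ∞ (christoffel g c a b) O := by
  unfold christoffel
  refine contDiffOn_const.mul (ContDiffOn.sum fun l _ => (hg.smooth_ginv c l).mul ?_)
  exact ((smooth_pd (hg.smooth b l) hg.isOpen a).add (smooth_pd (hg.smooth a l) hg.isOpen b)).sub
    (smooth_pd (hg.smooth a b) hg.isOpen l)

lemma symm_fun (a b : Fin 4) : g a b = g b a := funext (hg.symm a b)

lemma christoffel_comm (c a b : Fin 4) : christoffel g c a b = christoffel g c b a := by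
  funext y
  simp only [christoffel]
  congr 1
  refine Finset.sum_congr rfl fun l _ => ?_
  rw [hg.symm_fun a b]; ring

lemma ginv_symm (a b : Fin 4) (y : E4) : ginv g a b y = ginv g b a y := by
  have h : (gMat g y)ᵀ = gMat g y := by
    ext i j; exact hg.symm j i y
  have h2 : ((gMat g y)⁻¹)ᵀ = (gMat g y)⁻¹ := by rw [Matrix.transpose_nonsing_inv, h]
  exact congrFun (congrFun h2 b) a

include hy

lemma gMat_mul_inv : gMat g y * (gMat g y)⁻¹ = 1 :=
  Matrix.mul_nonsing_inv _ (isUnit_iff_ne_zero.2 (hg.det_ne y hy))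

lemma inv_mul_gMat : (gMat g y)⁻¹ * gMat g y = 1 :=
  Matrix.nonsing_inv_mul _ (isUnit_iff_ne_zero.2 (hg.det_ne y hy))

/-- Multiplying by g undoes the inverse metric in the definition and leaves the Christoffel symbols
of the first kind. -/
lemma lower_christoffel (d a b : Fin 4) : ∑ c, g d c y * christoffel g c a b y =
    1 / 2 * (pd a (g b d) y + pd b (g a d) y - pd d (g a b) y) := by
  set v : Fin 4 → ℝ := fun l => pd a (g b l) y + pd b (g a l) y - pd l (g a b) y with hv
  have h : (gMat g y) *ᵥ ((gMat g y)⁻¹ *ᵥ v) = v := by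
    rw [Matrix.mulVec_mulVec, hg.gMat_mul_inv hy, Matrix.one_mulVec]
  have h2 := congrFun h d
  change _ = 1 / 2 * v d
  rw [← h2]
  simp only [Matrix.mulVec, dotProduct, Finset.mul_sum, christoffel, ginv, Matrix.of_apply]
  refine Finset.sum_congr rfl fun c _ => Finset.sum_congr rfl fun l _ => ?_
  simp only [hv]; ring

/-- The metric is parallel. -/
lemma pd_metric (c a b : Fin 4) : pd c (g a b) y =
    ∑ l, (christoffel g l c a y * g l b y + christoffel g l c b y * g a l y) := by
  have h1 := hg.lower_christoffel hy b c a
  have h2 := hg.lower_christoffel hy a c b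
  rw [Finset.sum_add_distrib]
  have e1 : ∑ l, christoffel g l c a y * g l b y = ∑ l, g b l y * christoffel g l c a y :=
    Finset.sum_congr rfl fun l _ => by rw [hg.symm l b]; ring
  have e2 : ∑ l, christoffel g l c b y * g a l y = ∑ l, g a l y * christoffel g l c b y :=
    Finset.sum_congr rfl fun l _ => by ring
  rw [e1, e2, h1, h2, hg.symm_fun b a, hg.symm_fun c a, hg.symm_fun c b]
  ring

/-- The inverse metric is parallel. -/
lemma pd_ginv (c a b : Fin 4) : pd c (ginv g a b) y =
    - ∑ l, (christoffel g a c l y * ginv g l b y + christoffel g b c l y * ginv g a l y) := by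
  have hd := fun i j => differentiableAt_of_smooth (hg.smooth i j) hg.isOpen hy
  have hdi := fun i j => differentiableAt_of_smooth (hg.smooth_ginv i j) hg.isOpen hy
  set dG : Matrix (Fin 4) (Fin 4) ℝ := Matrix.of fun i j => pd c (g i j) y with hdG
  set dI : Matrix (Fin 4) (Fin 4) ℝ := Matrix.of fun i j => pd c (ginv g i j) y with hdI
  -- This is g⁻¹ g = 1 differentiated. Solving for the derivative of g⁻¹ and inserting that of g
  -- gives the claim.
  have h1 : dI * gMat g y + (gMat g y)⁻¹ * dG = 0 := by
    ext i j
    have h : pd c (fun z => ∑ l, ginv g i l z * g l j z) y = 0 := by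
      rw [pd_congr_on hg.isOpen hy c (g := fun _ => (1 : Matrix (Fin 4) (Fin 4) ℝ) i j)]
      · exact pd_const _ _ _
      · intro z hz
        exact congrFun (congrFun (hg.inv_mul_gMat hz) i) j
    rw [pd_sum _ fun l => (hdi i l).fun_mul (hd l j)] at h
    simp only [pd_mul _ (hdi i _) (hd _ j), Finset.sum_add_distrib] at h
    exact h
  have h2 : dG = (gammaMat g c y)ᵀ * gMat g y + gMat g y * gammaMat g c y := by
    ext i j
    change pd c (g i j) y = _
    rw [hg.pd_metric hy, Finset.sum_add_distrib]
    simp only [Matrix.add_apply, Matrix.mul_apply, Matrix.transpose_apply, Matrix.of_apply]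
    congr 1
    exact Finset.sum_congr rfl fun l _ => mul_comm _ _
  have h3 : dI = - ((gMat g y)⁻¹ * (gammaMat g c y)ᵀ) - gammaMat g c y * (gMat g y)⁻¹ := by
    have e1 : dI = dI * gMat g y * (gMat g y)⁻¹ := by
      rw [Matrix.mul_assoc, hg.gMat_mul_inv hy, Matrix.mul_one]
    rw [e1, eq_neg_of_add_eq_zero_left h1, h2]
    simp only [Matrix.mul_add, Matrix.add_mul, Matrix.neg_mul, neg_add]
    rw [← Matrix.mul_assoc ((gMat g y)⁻¹) (gMat g y), hg.inv_mul_gMat hy, Matrix.one_mul,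
      Matrix.mul_assoc _ (_ * gMat g y), Matrix.mul_assoc _ (gMat g y), hg.gMat_mul_inv hy,
      Matrix.mul_one]
    abel
  have h4 := congrFun (congrFun h3 a) b
  change pd c (ginv g a b) y = _ at h4
  rw [h4, Finset.sum_add_distrib]
  simp only [Matrix.sub_apply, Matrix.neg_apply, Matrix.mul_apply, Matrix.transpose_apply,
    Matrix.of_apply, neg_add, sub_eq_add_neg]
  rw [add_comm]
  congr 1
  congr 1
  exact Finset.sum_congr rfl fun l _ => mul_comm _ _

end IsMetricOn

end MarsSimon

/-! ## Symmetries of the Riemann tensor -/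

namespace MarsSimon

open Matrix

/-- The curvature matrices `(R_{ab})^m_n`. -/
abbrev riemannMat (g : Fin 4 → Fin 4 → E4 → ℝ) (a b : Fin 4) (y : E4) :
    Matrix (Fin 4) (Fin 4) ℝ :=
  Matrix.of fun m n => riemann g m n a b y

namespace IsMetricOn

variable {g : Fin 4 → Fin 4 → E4 → ℝ} {O : Set E4} (hg : IsMetricOn g O) {y : E4} (hy : y ∈ O)
include hg

lemma smooth_riemann (m n a b : Fin 4) : ContDiffOn ℝ ∞ (riemann g m n a b) O := by
  unfold riemann
  have h := hg.smooth_christoffel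
  exact ((smooth_pd (h m b n) hg.isOpen a).sub (smooth_pd (h m a n) hg.isOpen b)).add
    (ContDiffOn.sum fun l _ => ((h m a l).mul (h l b n)).sub ((h m b l).mul (h l a n)))

lemma smooth_riemannLow (m n a b : Fin 4) : ContDiffOn ℝ ∞ (riemannLow g m n a b) O := by
  unfold riemannLow
  exact ContDiffOn.sum fun l _ => (hg.smooth m l).mul (hg.smooth_riemann l n a b)

omit hg in
-- In the form ∂_a Γ_b - ∂_b Γ_a + [Γ_a, Γ_b] the summed indices disappear, and the curvature
-- identities become computations in a noncommutative ring.
lemma riemannMat_eq (g : Fin 4 → Fin 4 → E4 → ℝ) (a b : Fin 4) (y : E4) : riemannMat g a b y =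
    (Matrix.of fun m n => pd a (christoffel g m b n) y)
      - (Matrix.of fun m n => pd b (christoffel g m a n) y)
      + (gammaMat g a y * gammaMat g b y - gammaMat g b y * gammaMat g a y) := by
  ext m n
  simp [riemann, Matrix.mul_apply, Finset.sum_sub_distrib]

omit hg in
lemma riemann_antisymm (g : Fin 4 → Fin 4 → E4 → ℝ) (m n a b : Fin 4) (y : E4) :
    riemann g m n a b y = - riemann g m n b a y := by
  have h : riemannMat g a b y = - riemannMat g b a y := by
    rw [riemannMat_eq, riemannMat_eq]; abel
  exact congrFun (congrFun h m) n

omit hg in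
lemma riemannLow_antisymm_right (g : Fin 4 → Fin 4 → E4 → ℝ) (m n a b : Fin 4) (y : E4) :
    riemannLow g m n a b y = - riemannLow g m n b a y := by
  simp only [riemannLow, ← Finset.sum_neg_distrib]
  exact Finset.sum_congr rfl fun l _ => by rw [riemann_antisymm g l n a b]; ring

/-- Torsion-freeness: once the lower indices of every Γ are sorted, the terms cancel in pairs. -/
lemma riemann_bianchi (m n a b : Fin 4) (y : E4) :
    riemann g m n a b y + riemann g m a b n y + riemann g m b n a y = 0 := by
  simp only [riemann]
  rw [hg.christoffel_comm m b n, hg.christoffel_comm m a n, hg.christoffel_comm m b a]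
  have h : ∀ i j k : Fin 4, ∑ l, (christoffel g m i l y * christoffel g l j k y
        - christoffel g m j l y * christoffel g l i k y) =
      ∑ l, christoffel g m i l y * christoffel g l j k y -
      ∑ l, christoffel g m j l y * christoffel g l i k y := fun i j k => Finset.sum_sub_distrib _ _
  have hc : ∀ i j k : Fin 4, ∑ l, christoffel g m i l y * christoffel g l j k y =
      ∑ l, christoffel g m i l y * christoffel g l k j y := fun i j k =>
    Finset.sum_congr rfl fun l _ => by rw [hg.christoffel_comm l j k]
  rw [h, h, h, hc a b n, hc b a n, hc n b a]
  ring

lemma riemannLow_bianchi (m n a b : Fin 4) (y : E4) :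
    riemannLow g m n a b y + riemannLow g m a b n y + riemannLow g m b n a y = 0 := by
  simp only [riemannLow, ← Finset.sum_add_distrib, ← mul_add, hg.riemann_bianchi]
  simp

include hy

lemma differentiableAt (a b : Fin 4) : DifferentiableAt ℝ (g a b) y :=
  differentiableAt_of_smooth (hg.smooth a b) hg.isOpen hy

lemma differentiableAt_christoffel (c a b : Fin 4) : DifferentiableAt ℝ (christoffel g c a b) y :=
  differentiableAt_of_smooth (hg.smooth_christoffel c a b) hg.isOpen hy

lemma differentiableAt_riemann (m n a b : Fin 4) : DifferentiableAt ℝ (riemann g m n a b) y :=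
  differentiableAt_of_smooth (hg.smooth_riemann m n a b) hg.isOpen hy

lemma pd_gMat (c : Fin 4) : (Matrix.of fun i j => pd c (g i j) y) =
    (gammaMat g c y)ᵀ * gMat g y + gMat g y * gammaMat g c y := by
  ext i j
  change pd c (g i j) y = _
  rw [hg.pd_metric hy, Finset.sum_add_distrib]
  simp only [Matrix.add_apply, Matrix.mul_apply, Matrix.transpose_apply, Matrix.of_apply]
  congr 1
  exact Finset.sum_congr rfl fun l _ => mul_comm _ _

/-- The derivative of ∂_c g = Γ_cᵀ g + g Γ_c. Its antisymmetric part in `a`, `c` brings in the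
curvature. -/
lemma pd_pd_gMat (a c : Fin 4) : (Matrix.of fun i j => pd a (pd c (g i j)) y) =
    (Matrix.of fun m n => pd a (christoffel g m c n) y)ᵀ * gMat g y
      + (gammaMat g c y)ᵀ * (Matrix.of fun i j => pd a (g i j) y)
      + (Matrix.of fun i j => pd a (g i j) y) * gammaMat g c y
      + gMat g y * (Matrix.of fun m n => pd a (christoffel g m c n) y) := by
  have hd := fun i j => hg.differentiableAt hy i j
  have hdi := fun i j k => hg.differentiableAt_christoffel hy i j k
  ext i j
  simp only [Matrix.add_apply, Matrix.mul_apply, Matrix.transpose_apply, Matrix.of_apply]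
  rw [pd_congr_on hg.isOpen hy a (g := fun z => ∑ l, (christoffel g l c i z * g l j z +
      christoffel g l c j z * g i l z)) (fun z hz => hg.pd_metric hz c i j),
    pd_sum _ fun l => ((hdi l c i).fun_mul (hd l j)).fun_add ((hdi l c j).fun_mul (hd i l)),
    ← Finset.sum_add_distrib, ← Finset.sum_add_distrib, ← Finset.sum_add_distrib]
  refine Finset.sum_congr rfl fun l _ => ?_
  rw [pd_add _ ((hdi l c i).fun_mul (hd l j)) ((hdi l c j).fun_mul (hd i l)),
    pd_mul _ (hdi l c i) (hd l j), pd_mul _ (hdi l c j) (hd i l)]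
  ring

/-- The equality of the mixed second derivatives of g amounts to R_abᵀ g + g R_ab = 0. -/
lemma riemannLow_antisymm_left (m n a b : Fin 4) :
    riemannLow g m n a b y = - riemannLow g n m a b y := by
  have h : (riemannMat g a b y)ᵀ * gMat g y + gMat g y * riemannMat g a b y = 0 := by
    have h1 : (Matrix.of fun i j => pd a (pd b (g i j)) y) =
        (Matrix.of fun i j => pd b (pd a (g i j)) y) := by
      ext i j; exact pd_comm (hg.smooth i j) hg.isOpen hy a b
    rw [hg.pd_pd_gMat hy, hg.pd_pd_gMat hy, hg.pd_gMat hy, hg.pd_gMat hy] at h1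
    rw [riemannMat_eq]
    simp only [transpose_add, transpose_sub, transpose_mul]
    rw [← sub_eq_zero] at h1
    rw [← h1]
    noncomm_ring
  have h2 := congrFun (congrFun h n) m
  simp only [Matrix.add_apply, Matrix.mul_apply, Matrix.transpose_apply, Matrix.of_apply,
    Matrix.zero_apply] at h2
  simp only [riemannLow]
  rw [add_comm] at h2
  have h3 := eq_neg_of_add_eq_zero_right h2
  rw [← h3]
  exact Finset.sum_congr rfl fun l _ => by rw [hg.symm m l]; ring

/-- A linear consequence of four instances of the first Bianchi identity and the two antisymmetries.
-/
lemma riemannLow_pair_symm (m n a b : Fin 4) :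
    riemannLow g m n a b y = riemannLow g a b m n y := by
  have A := fun m n a b => hg.riemannLow_antisymm_left hy m n a b
  have B := fun m n a b => riemannLow_antisymm_right g m n a b y
  have C := fun m n a b => hg.riemannLow_bianchi m n a b y
  linarith [C m n a b, C n a b m, C a b m n, C b m n a, A m n a b, B m n a b, A n a b m, B n a b m,
    A a b m n, B a b m n, A b m n a, B b m n a, A m a b n, B m a b n, A m b n a, B m b n a,
    A n b m a, B n b m a, A n m a b, B n m a b, A a m n b, B a m n b, A a n b m, B a n b m,
    A b n a m, B b n a m, A b a m n, B b a m n]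

end IsMetricOn

end MarsSimon

/-! ## Covariant derivatives, the second Bianchi identity and Killing fields -/

namespace MarsSimon

open Matrix

/-- The covariant derivative `∇_e T_{ab}`. -/
def covD₂ (g : Fin 4 → Fin 4 → E4 → ℝ) (T : Fin 4 → Fin 4 → E4 → ℝ) (e a b : Fin 4) (y : E4) : ℝ :=
  pd e (T a b) y - ∑ l, (christoffel g l e a y * T l b y + christoffel g l e b y * T a l y)

/-- The covariant derivative `∇_e T_{abcd}`. -/
def covD₄ (g : Fin 4 → Fin 4 → E4 → ℝ) (T : Fin 4 → Fin 4 → Fin 4 → Fin 4 → E4 → ℝ)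
    (e a b c d : Fin 4) (y : E4) : ℝ :=
  pd e (T a b c d) y - ∑ l, (christoffel g l e a y * T l b c d y + christoffel g l e b y * T a l c d y
    + christoffel g l e c y * T a b l d y + christoffel g l e d y * T a b c l y)

namespace IsMetricOn

variable {g : Fin 4 → Fin 4 → E4 → ℝ} {O : Set E4} (hg : IsMetricOn g O) {y : E4} (hy : y ∈ O)
include hg hy

lemma pd_riemannMat (e a b : Fin 4) : (Matrix.of fun m n => pd e (riemann g m n a b) y) =
    (Matrix.of fun m n => pd e (pd a (christoffel g m b n)) y)
      - (Matrix.of fun m n => pd e (pd b (christoffel g m a n)) y)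
      + ((Matrix.of fun m n => pd e (christoffel g m a n) y) * gammaMat g b y
        + gammaMat g a y * (Matrix.of fun m n => pd e (christoffel g m b n) y)
        - (Matrix.of fun m n => pd e (christoffel g m b n) y) * gammaMat g a y
        - gammaMat g b y * (Matrix.of fun m n => pd e (christoffel g m a n) y)) := by
  have hd := fun i j k => hg.differentiableAt_christoffel hy i j k
  have hdd := fun l i j k => differentiableAt_of_smooth
    (smooth_pd (hg.smooth_christoffel i j k) hg.isOpen l) hg.isOpen hy
  ext m n
  simp only [Matrix.add_apply, Matrix.sub_apply, Matrix.mul_apply, Matrix.of_apply]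
  unfold riemann
  have h2 : ∀ l, DifferentiableAt ℝ (fun z => christoffel g m a l z * christoffel g l b n z
      - christoffel g m b l z * christoffel g l a n z) y := fun l =>
    ((hd m a l).fun_mul (hd l b n)).fun_sub ((hd m b l).fun_mul (hd l a n))
  rw [pd_add _ ((hdd a m b n).fun_sub (hdd b m a n)) (DifferentiableAt.fun_sum fun l _ => h2 l),
    pd_sub _ (hdd a m b n) (hdd b m a n), pd_sum _ h2, ← Finset.sum_add_distrib,
    ← Finset.sum_sub_distrib, ← Finset.sum_sub_distrib]
  congr 1
  refine Finset.sum_congr rfl fun l _ => ?_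
  rw [pd_sub _ ((hd m a l).fun_mul (hd l b n)) ((hd m b l).fun_mul (hd l a n)),
    pd_mul _ (hd m a l) (hd l b n), pd_mul _ (hd m b l) (hd l a n)]
  ring

/-- The part of `∇_e R_{mnab}` that involves the connection on the first two indices. -/
lemma pd_riemannLow (e m n a b : Fin 4) : pd e (riemannLow g m n a b) y
      - ∑ l, (christoffel g l e m y * riemannLow g l n a b y
        + christoffel g l e n y * riemannLow g m l a b y) =
    (gMat g y * ((Matrix.of fun m n => pd e (riemann g m n a b) y)
      + gammaMat g e y * riemannMat g a b y - riemannMat g a b y * gammaMat g e y)) m n := by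
  have hd := fun i j => hg.differentiableAt hy i j
  have hdr := fun i j k l => hg.differentiableAt_riemann hy i j k l
  have h1 : pd e (riemannLow g m n a b) y =
      ((Matrix.of fun i j => pd e (g i j) y) * riemannMat g a b y
        + gMat g y * (Matrix.of fun m n => pd e (riemann g m n a b) y)) m n := by
    unfold riemannLow
    rw [pd_sum _ fun l => (hd m l).fun_mul (hdr l n a b)]
    simp only [pd_mul _ (hd m _) (hdr _ n a b), Finset.sum_add_distrib, Matrix.add_apply,
      Matrix.mul_apply, Matrix.of_apply]
  have h2 : ∑ l, (christoffel g l e m y * riemannLow g l n a b y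
        + christoffel g l e n y * riemannLow g m l a b y) =
      ((gammaMat g e y)ᵀ * (gMat g y * riemannMat g a b y)
        + (gMat g y * riemannMat g a b y) * gammaMat g e y) m n := by
    rw [Finset.sum_add_distrib]
    simp only [Matrix.add_apply, Matrix.mul_apply, Matrix.transpose_apply, Matrix.of_apply,
      riemannLow]
    congr 1
    exact Finset.sum_congr rfl fun l _ => mul_comm _ _
  rw [h1, h2, hg.pd_gMat hy, ← Matrix.sub_apply]
  refine congrFun (congrFun ?_ m) n
  noncomm_ring

/-- Separates the connection terms on the last two indices. In a cyclic sum these cancel in pairs by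
the symmetry of Γ, which leaves only a matrix identity. -/
lemma covD₄_riemannLow (e m n a b : Fin 4) : covD₄ g (riemannLow g) e m n a b y =
    (gMat g y * ((Matrix.of fun m n => pd e (riemann g m n a b) y)
      + gammaMat g e y * riemannMat g a b y - riemannMat g a b y * gammaMat g e y)) m n
    - ∑ l, christoffel g l e a y * riemannLow g m n l b y
    - ∑ l, christoffel g l e b y * riemannLow g m n a l y := by
  rw [← hg.pd_riemannLow hy, covD₄]
  simp only [Finset.sum_add_distrib]
  ring

/-- The second Bianchi identity. -/
lemma covD₄_riemannLow_bianchi (e m n a b : Fin 4) : covD₄ g (riemannLow g) e m n a b y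
    + covD₄ g (riemannLow g) a m n b e y + covD₄ g (riemannLow g) b m n e a y = 0 := by
  have hc : ∀ i j k l : Fin 4, ∑ p, christoffel g p i j y * riemannLow g m n p k y =
      - ∑ p, christoffel g p j i y * riemannLow g m n k p y := by
    intro i j k _
    rw [← Finset.sum_neg_distrib]
    exact Finset.sum_congr rfl fun p _ => by
      rw [hg.christoffel_comm p i j, riemannLow_antisymm_right g m n p k]; ring
  -- The cyclic sum of ∂_e R_ab + [Γ_e, R_ab]. The second derivatives of Γ cancel because partial
  -- derivatives commute, and the other terms cancel by expansion, the cubic ones by the Jacobi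
  -- identity.
  have hM : ((Matrix.of fun m n => pd e (riemann g m n a b) y)
      + gammaMat g e y * riemannMat g a b y - riemannMat g a b y * gammaMat g e y)
      + ((Matrix.of fun m n => pd a (riemann g m n b e) y)
      + gammaMat g a y * riemannMat g b e y - riemannMat g b e y * gammaMat g a y)
      + ((Matrix.of fun m n => pd b (riemann g m n e a) y)
      + gammaMat g b y * riemannMat g e a y - riemannMat g e a y * gammaMat g b y) = 0 := by
    have hs : ∀ i j k : Fin 4, (Matrix.of fun m n => pd i (pd j (christoffel g m k n)) y) =
        (Matrix.of fun m n => pd j (pd i (christoffel g m k n)) y) := by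
      intro i j k; ext m n
      exact pd_comm (hg.smooth_christoffel m k n) hg.isOpen hy i j
    rw [hg.pd_riemannMat hy, hg.pd_riemannMat hy, hg.pd_riemannMat hy, riemannMat_eq, riemannMat_eq,
      riemannMat_eq, hs a e b, hs e b a, hs b a e]
    noncomm_ring
  rw [hg.covD₄_riemannLow hy, hg.covD₄_riemannLow hy, hg.covD₄_riemannLow hy, hc e a b 0,
    hc a b e 0, hc b e a 0]
  have h : ∀ X Y Z : Matrix (Fin 4) (Fin 4) ℝ, X + Y + Z = 0 →
      (gMat g y * X) m n + (gMat g y * Y) m n + (gMat g y * Z) m n = 0 := by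
    intro X Y Z hXYZ
    rw [← Matrix.add_apply, ← Matrix.add_apply, ← Matrix.mul_add, ← Matrix.mul_add, hXYZ,
      Matrix.mul_zero, Matrix.zero_apply]
  linear_combination h _ _ _ hM

/-! ### The Ricci identity for 1-forms -/

section Killing

variable {x : Fin 4 → E4 → ℝ} (hx : ∀ a, ContDiffOn ℝ ∞ (x a) O)
include hx

/-- The Ricci identity for a 1-form. -/
lemma ricci_identity (a b c : Fin 4) :
    covD₂ g (fun a b y => pd a (x b) y - ∑ l, christoffel g l a b y * x l y) a b c y
    - covD₂ g (fun a b y => pd a (x b) y - ∑ l, christoffel g l a b y * x l y) b a c y =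
    - ∑ n, riemann g n c a b y * x n y := by
  have hd := fun i j k => hg.differentiableAt_christoffel hy i j k
  have hdx := fun i => differentiableAt_of_smooth (hx i) hg.isOpen hy
  have hdd := fun i j => differentiableAt_of_smooth (smooth_pd (hx j) hg.isOpen i) hg.isOpen hy
  have hp : ∀ a b c : Fin 4, pd a (fun y => pd b (x c) y - ∑ l, christoffel g l b c y * x l y) y =
      pd a (pd b (x c)) y - ∑ l, (pd a (christoffel g l b c) y * x l y
        + christoffel g l b c y * pd a (x l) y) := by
    intro a b c
    rw [pd_sub _ (hdd b c) (DifferentiableAt.fun_sum fun l _ => (hd l b c).fun_mul (hdx l)),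
      pd_sum _ fun l => (hd l b c).fun_mul (hdx l)]
    congr 1
    exact Finset.sum_congr rfl fun l _ => pd_mul _ (hd l b c) (hdx l)
  simp only [covD₂, hp, riemann]
  rw [pd_comm (hx c) hg.isOpen hy a b]
  simp only [Finset.sum_add_distrib, mul_sub, add_mul, sub_mul, Finset.sum_sub_distrib,
    Finset.mul_sum, Finset.sum_mul, hg.christoffel_comm _ b a]
  have hs : ∀ i j : Fin 4, ∑ l, ∑ k, christoffel g l i c y * (christoffel g k j l y * x k y) =
      ∑ n, ∑ l, christoffel g n j l y * christoffel g l i c y * x n y := by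
    intro i j
    rw [Finset.sum_comm]
    exact Finset.sum_congr rfl fun _ _ => Finset.sum_congr rfl fun _ _ => by ring
  rw [hs a b, hs b a]
  ring

end Killing

/-- The second derivatives of a Killing vector field: `∇_a F_{bc} = ξ^d R_{dabc}`. -/
lemma covD₂_killingForm {ξ : Fin 4 → E4 → ℝ} (hξ : ∀ a, ContDiffOn ℝ ∞ (ξ a) O)
    (hk : ∀ z ∈ O, ∀ a b, killingForm g ξ a b z + killingForm g ξ b a z = 0) (a b c : Fin 4) :
    covD₂ g (killingForm g ξ) a b c y = ∑ d, ξ d y * riemannLow g d a b c y := by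
  have hx : ∀ a, ContDiffOn ℝ ∞ (lower g ξ a) O := fun a => by
    unfold lower; exact ContDiffOn.sum fun b _ => (hg.smooth a b).mul (hξ b)
  have K : ∀ a b c : Fin 4, covD₂ g (killingForm g ξ) a b c y
      - covD₂ g (killingForm g ξ) b a c y = - ∑ d, ξ d y * riemannLow g d c a b y := by
    intro a b c
    refine (hg.ricci_identity hy hx a b c).trans ?_
    simp only [lower, riemannLow, Finset.mul_sum]
    rw [Finset.sum_comm]
    congr 1
    refine Finset.sum_congr rfl fun _ _ => Finset.sum_congr rfl fun _ _ => ?_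
    rw [hg.symm]; ring
  have S : ∀ a b c : Fin 4, covD₂ g (killingForm g ξ) a b c y =
      - covD₂ g (killingForm g ξ) a c b y := by
    intro a b c
    have h1 : pd a (killingForm g ξ b c) y = - pd a (killingForm g ξ c b) y := by
      have : pd a (killingForm g ξ b c) y = pd a (fun z => (-1) * killingForm g ξ c b z) y :=
        pd_congr_on hg.isOpen hy a fun z hz => by linarith [hk z hz b c]
      rw [this, pd_const_mul]
      · ring
      · refine differentiableAt_of_smooth (O := O) ?_ hg.isOpen hy
        unfold killingForm
        exact (smooth_pd (hx b) hg.isOpen c).sub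
          (ContDiffOn.sum fun l _ => (hg.smooth_christoffel l c b).mul (hx l))
    have h2 : ∑ l, (christoffel g l a b y * killingForm g ξ l c y
        + christoffel g l a c y * killingForm g ξ b l y) =
        - ∑ l, (christoffel g l a c y * killingForm g ξ l b y
        + christoffel g l a b y * killingForm g ξ c l y) := by
      rw [← Finset.sum_neg_distrib]
      refine Finset.sum_congr rfl fun l _ => ?_
      have e1 : killingForm g ξ b l y = - killingForm g ξ l b y := by linarith [hk y hy b l]
      have e2 : killingForm g ξ c l y = - killingForm g ξ l c y := by linarith [hk y hy c l]
      rw [e1, e2]; ring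
    simp only [covD₂]
    rw [h1, h2]; ring
  have B : ∀ a b c : Fin 4, ∑ d, ξ d y * riemannLow g d a b c y
      + ∑ d, ξ d y * riemannLow g d b c a y + ∑ d, ξ d y * riemannLow g d c a b y = 0 := by
    intro a b c
    rw [← Finset.sum_add_distrib, ← Finset.sum_add_distrib]
    refine Finset.sum_eq_zero fun d _ => ?_
    rw [← mul_add, ← mul_add, hg.riemannLow_bianchi, mul_zero]
  -- Koszul's trick: by the antisymmetry `S`, the combination K(a,b,c) + K(c,a,b) - K(b,c,a)
  -- isolates 2∇_a F_bc, and `B` reduces the right-hand side to a single curvature term.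
  linarith [K a b c, K b c a, K c a b, S a b c, S b c a, S c a b, B a b c]

end IsMetricOn

end MarsSimon

/-! ## First-order jets in a parallel frame -/

namespace MarsSimon

/-- `f` has the value `v` at `p`, and the derivatives `d` in the directions of the frame `E`. -/
structure Jet (E : Fin 4 → Fin 4 → ℂ) (p : E4) (f : E4 → ℂ) (v : ℂ) (d : Fin 4 → ℂ) : Prop where
  diff : DifferentiableAt ℝ f p
  val : f p = v
  deriv (k : Fin 4) : ∑ a, E k a * pd a f p = d k

namespace Jet

variable {E : Fin 4 → Fin 4 → ℂ} {p : E4} {f f' : E4 → ℂ} {v v' : ℂ} {d d' : Fin 4 → ℂ}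

lemma of_differentiableAt (hf : DifferentiableAt ℝ f p) :
    Jet E p f (f p) (fun k => ∑ a, E k a * pd a f p) := ⟨hf, rfl, fun _ => rfl⟩

lemma congr (h : Jet E p f v d) (h1 : v = v') (h2 : ∀ k, d k = d' k) : Jet E p f v' d' :=
  ⟨h.diff, h.val.trans h1, fun k => (h.deriv k).trans (h2 k)⟩

lemma congr_fun (h : Jet E p f v d) (hf : f' =ᶠ[nhds p] f) : Jet E p f' v d :=
  ⟨h.diff.congr_of_eventuallyEq hf, hf.self_of_nhds.trans h.val, fun k => by
    simp only [pd_congr _ hf]; exact h.deriv k⟩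

lemma add (h : Jet E p f v d) (h' : Jet E p f' v' d') :
    Jet E p (fun y => f y + f' y) (v + v') (fun k => d k + d' k) :=
  ⟨h.diff.fun_add h'.diff, by rw [h.val, h'.val], fun k => by
    simp only [pd_add _ h.diff h'.diff, mul_add, Finset.sum_add_distrib, h.deriv, h'.deriv]⟩

lemma mul (h : Jet E p f v d) (h' : Jet E p f' v' d') :
    Jet E p (fun y => f y * f' y) (v * v') (fun k => d k * v' + v * d' k) :=
  ⟨h.diff.fun_mul h'.diff, by rw [h.val, h'.val], fun k => by
    simp only [pd_mul _ h.diff h'.diff, ← h.deriv, ← h'.deriv, h.val, h'.val, mul_add,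
      Finset.sum_add_distrib, Finset.sum_mul, Finset.mul_sum]
    congr 1 <;> exact Finset.sum_congr rfl fun _ _ => by ring⟩

lemma const (c : ℂ) : Jet E p (fun _ => c) c (fun _ => 0) :=
  ⟨differentiableAt_const c, rfl, fun k => by simp [pd_const]⟩

lemma const_mul (c : ℂ) (h : Jet E p f v d) :
    Jet E p (fun y => c * f y) (c * v) (fun k => c * d k) :=
  ((const c).mul h).congr rfl fun k => by ring

lemma sub (h : Jet E p f v d) (h' : Jet E p f' v' d') :
    Jet E p (fun y => f y - f' y) (v - v') (fun k => d k - d' k) :=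
  ⟨h.diff.fun_sub h'.diff, by rw [h.val, h'.val], fun k => by
    simp only [pd_sub _ h.diff h'.diff, mul_sub, Finset.sum_sub_distrib, h.deriv, h'.deriv]⟩

lemma sum {ι : Type*} [Fintype ι] {f : ι → E4 → ℂ} {v : ι → ℂ} {d : ι → Fin 4 → ℂ}
    (h : ∀ i, Jet E p (f i) (v i) (d i)) :
    Jet E p (fun y => ∑ i, f i y) (∑ i, v i) (fun k => ∑ i, d i k) :=
  ⟨DifferentiableAt.fun_sum fun i _ => (h i).diff, Finset.sum_congr rfl fun i _ => (h i).val,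
    fun k => by
      simp only [pd_sum _ fun i => (h i).diff, Finset.mul_sum]
      rw [Finset.sum_comm]
      exact Finset.sum_congr rfl fun i _ => (h i).deriv k⟩

/-- Converts an identity between functions near `p` into one between their derivatives. The
symmetries of ∇R and the constancy of the volume form are obtained in this way. -/
lemma deriv_unique (h : Jet E p f v d) (h' : Jet E p f v' d') (k : Fin 4) : d k = d' k :=
  (h.deriv k).symm.trans (h'.deriv k)

lemma inv (h : Jet E p f v d) (hv : v ≠ 0) :
    Jet E p (fun y => (f y)⁻¹) v⁻¹ (fun k => - (v⁻¹ * v⁻¹ * d k)) := by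
  have h0 : f p ≠ 0 := by rw [h.val]; exact hv
  have hd := h.diff.fun_inv h0
  -- Near `p` the product of `f` and its inverse is constantly 1; the product rule then determines
  -- the derivative of the inverse.
  have h1 := (const (E := E) (p := p) 1).congr_fun (f' := fun y => f y * (f y)⁻¹) (by
    filter_upwards [h.diff.continuousAt.eventually_ne h0] with y hy using mul_inv_cancel₀ hy)
  have h2 := h.mul (of_differentiableAt (E := E) hd)
  refine (of_differentiableAt (E := E) hd).congr (by rw [h.val]) fun k => ?_
  have h3 := h2.deriv_unique h1 k
  simp only [h.val] at h3
  have h4 : v⁻¹ * v = 1 := inv_mul_cancel₀ hv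
  linear_combination v⁻¹ * h3 - (∑ a, E k a * pd a (fun y => (f y)⁻¹) p) * h4

end Jet

lemma pd_ofReal {f : E4 → ℝ} {y : E4} (i : Fin 4) (hf : DifferentiableAt ℝ f y) :
    pd i (fun z => (f z : ℂ)) y = ((pd i f y : ℝ) : ℂ) := by
  have := (Complex.ofRealCLM.hasFDerivAt.comp y hf.hasFDerivAt).fderiv
  simp only [pd]
  change fderiv ℝ (Complex.ofRealCLM ∘ f) y _ = _
  rw [this]; simp

lemma differentiableAt_ofReal {f : E4 → ℝ} {y : E4} (hf : DifferentiableAt ℝ f y) :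
    DifferentiableAt ℝ (fun z => (f z : ℂ)) y :=
  Complex.ofRealCLM.differentiableAt.comp y hf

/-! ### Components in a frame that is parallel at a point -/

section Hats

/-- Vector fields with value `E i` at `p` and covariant derivative zero there. -/
def frame (Γ : Fin 4 → Fin 4 → Fin 4 → ℂ) (E : Fin 4 → Fin 4 → ℂ) (p : E4) (i a : Fin 4) (y : E4) :
    ℂ :=
  E i a - ∑ c, ((y c - p c : ℝ) : ℂ) * ∑ b, E i b * Γ a c b

/-- The components of a 1-form in a frame. -/
def hat₁ (e : Fin 4 → Fin 4 → E4 → ℂ) (u : Fin 4 → E4 → ℂ) (i : Fin 4) (y : E4) : ℂ :=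
  ∑ a, e i a y * u a y

/-- The components of a 2-tensor in a frame. -/
def hat₂ (e : Fin 4 → Fin 4 → E4 → ℂ) (T : Fin 4 → Fin 4 → E4 → ℂ) (i j : Fin 4) (y : E4) : ℂ :=
  ∑ a, ∑ b, e i a y * e j b y * T a b y

/-- The components of a 4-tensor in a frame. -/
def hat₄ (e : Fin 4 → Fin 4 → E4 → ℂ) (T : Fin 4 → Fin 4 → Fin 4 → Fin 4 → E4 → ℂ)
    (i j k l : Fin 4) (y : E4) : ℂ :=
  hat₂ e (fun a b => hat₂ e (T a b) k l) i j y

/-- The trace of a 2-tensor with respect to `K`. -/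
def trK (K : Fin 4 → Fin 4 → E4 → ℂ) (T : Fin 4 → Fin 4 → E4 → ℂ) (y : E4) : ℂ :=
  ∑ a, ∑ b, K a b y * T a b y

/-- The contraction of two 2-tensors with respect to `K`. -/
def contr₂ (K : Fin 4 → Fin 4 → E4 → ℂ) (A B : Fin 4 → Fin 4 → E4 → ℂ) (y : E4) : ℂ :=
  ∑ a, ∑ b, ∑ c, ∑ d, K a c y * K b d y * A a b y * B c d y

section Linear

variable (e K : Fin 4 → Fin 4 → E4 → ℂ)

lemma hat₂_hat₂_comm (T : Fin 4 → Fin 4 → Fin 4 → Fin 4 → E4 → ℂ) (i j k l : Fin 4) (y : E4) :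
    hat₂ e (fun c d => hat₂ e (fun a b => T a b c d) i j) k l y = hat₄ e T i j k l y := by
  simp only [hat₄, hat₂, Finset.mul_sum]
  calc _ = ∑ c, ∑ a, ∑ d, ∑ b, e k c y * e l d y * (e i a y * e j b y * T a b c d y) :=
        Finset.sum_congr rfl fun _ _ => Finset.sum_comm
    _ = ∑ a, ∑ c, ∑ d, ∑ b, e k c y * e l d y * (e i a y * e j b y * T a b c d y) :=
        Finset.sum_comm
    _ = ∑ a, ∑ c, ∑ b, ∑ d, e k c y * e l d y * (e i a y * e j b y * T a b c d y) :=
        Finset.sum_congr rfl fun _ _ => Finset.sum_congr rfl fun _ _ => Finset.sum_comm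
    _ = ∑ a, ∑ b, ∑ c, ∑ d, e k c y * e l d y * (e i a y * e j b y * T a b c d y) :=
        Finset.sum_congr rfl fun _ _ => Finset.sum_comm
    _ = _ := Finset.sum_congr rfl fun _ _ => Finset.sum_congr rfl fun _ _ =>
        Finset.sum_congr rfl fun _ _ => Finset.sum_congr rfl fun _ _ => by ring

lemma hat₂_mul (u v : Fin 4 → E4 → ℂ) (i j : Fin 4) (y : E4) :
    hat₂ e (fun a b y => u a y * v b y) i j y = hat₁ e u i y * hat₁ e v j y := by
  simp only [hat₂, hat₁, Finset.sum_mul_sum]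
  exact Finset.sum_congr rfl fun _ _ => Finset.sum_congr rfl fun _ _ => by ring

lemma hat₂_add (S T : Fin 4 → Fin 4 → E4 → ℂ) (i j : Fin 4) (y : E4) :
    hat₂ e (fun a b y => S a b y + T a b y) i j y = hat₂ e S i j y + hat₂ e T i j y := by
  simp only [hat₂, mul_add, Finset.sum_add_distrib]

lemma hat₂_smul (c : E4 → ℂ) (T : Fin 4 → Fin 4 → E4 → ℂ) (i j : Fin 4) (y : E4) :
    hat₂ e (fun a b y => c y * T a b y) i j y = c y * hat₂ e T i j y := by
  simp only [hat₂, Finset.mul_sum]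
  exact Finset.sum_congr rfl fun _ _ => Finset.sum_congr rfl fun _ _ => by ring

lemma hat₁_smul (c : E4 → ℂ) (u : Fin 4 → E4 → ℂ) (i : Fin 4) (y : E4) :
    hat₁ e (fun a y => c y * u a y) i y = c y * hat₁ e u i y := by
  simp only [hat₁, Finset.mul_sum]
  exact Finset.sum_congr rfl fun _ _ => by ring

/-- Contractions commute with taking the frame components of spectator indices. -/
lemma hat₂_contr₂ (A : Fin 4 → Fin 4 → E4 → ℂ) (B : Fin 4 → Fin 4 → Fin 4 → Fin 4 → E4 → ℂ)
    (i j : Fin 4) (y : E4) : hat₂ e (fun a b => contr₂ K A (B a b)) i j y =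
      contr₂ K A (fun c d => hat₂ e (fun a b => B a b c d) i j) y := by
  have h : ∀ (w : Fin 4 → Fin 4 → ℂ) (q : Fin 4 → Fin 4 → Fin 4 → Fin 4 → ℂ)
      (r : Fin 4 → Fin 4 → Fin 4 → Fin 4 → Fin 4 → Fin 4 → ℂ),
      ∑ m, ∑ n, w m n * ∑ a, ∑ b, ∑ c, ∑ d, q a b c d * r m n a b c d =
      ∑ a, ∑ b, ∑ c, ∑ d, q a b c d * ∑ m, ∑ n, w m n * r m n a b c d := by
    intro w q r
    have hmn : ∀ f : Fin 4 → Fin 4 → Fin 4 → ℂ, ∑ m, ∑ n, ∑ a, f m n a = ∑ a, ∑ m, ∑ n, f m n a := by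
      intro f
      rw [Finset.sum_comm' (t' := Finset.univ) (s' := fun _ => Finset.univ) (by simp)]
      calc _ = ∑ n, ∑ a, ∑ m, f m n a := Finset.sum_congr rfl fun _ _ => Finset.sum_comm
        _ = ∑ a, ∑ n, ∑ m, f m n a := Finset.sum_comm
        _ = _ := Finset.sum_congr rfl fun _ _ => Finset.sum_comm
    simp only [Finset.mul_sum]
    rw [hmn]
    refine Finset.sum_congr rfl fun a _ => ?_
    rw [hmn]
    refine Finset.sum_congr rfl fun b _ => ?_
    rw [hmn]
    refine Finset.sum_congr rfl fun c _ => ?_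
    rw [hmn]
    exact Finset.sum_congr rfl fun d _ => Finset.sum_congr rfl fun m _ =>
      Finset.sum_congr rfl fun n _ => by ring
  simp only [hat₂, contr₂]
  exact h (fun m n => e i m y * e j n y) (fun a b c d => K a c y * K b d y * A a b y)
    (fun m n _ _ c d => B m n c d y)

end Linear

variable {Γ : Fin 4 → Fin 4 → Fin 4 → ℂ} {E : Fin 4 → Fin 4 → ℂ} {p : E4}

lemma frame_self (i a : Fin 4) : frame Γ E p i a p = E i a := by simp [frame]

lemma differentiableAt_coord (c : Fin 4) : DifferentiableAt ℝ (fun y : E4 => ((y c - p c : ℝ) : ℂ)) p :=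
  differentiableAt_ofReal (f := fun y : E4 => y c - p c) (by fun_prop)

lemma differentiableAt_frame (i a : Fin 4) : DifferentiableAt ℝ (frame Γ E p i a) p := by
  unfold frame
  exact (differentiableAt_const _).sub
    (DifferentiableAt.fun_sum fun c _ => (differentiableAt_coord c).mul (differentiableAt_const _))

lemma pd_frame (c i a : Fin 4) : pd c (frame Γ E p i a) p = - ∑ b, E i b * Γ a c b := by
  have h : ∀ k, pd c (fun y : E4 => ((y k - p k : ℝ) : ℂ)) p = if k = c then 1 else 0 := by
    intro k
    rw [pd_ofReal c (f := fun y : E4 => y k - p k) (by fun_prop)]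
    rw [pd_sub c (f := fun y : E4 => y k) (y := p) (by fun_prop) (differentiableAt_const _), pd_const]
    have : pd c (fun y : E4 => y k) p = if k = c then 1 else 0 := by
      simp only [pd]
      change fderiv ℝ (EuclideanSpace.proj k : E4 →L[ℝ] ℝ) p _ = _
      rw [ContinuousLinearMap.fderiv]
      simp
    rw [this]; split_ifs <;> simp
  unfold frame
  rw [pd_sub _ (differentiableAt_const _) (DifferentiableAt.fun_sum fun c _ =>
    (differentiableAt_coord c).fun_mul (differentiableAt_const _)), pd_const,
    pd_sum _ fun c => (differentiableAt_coord c).fun_mul (differentiableAt_const _)]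
  simp only [pd_mul _ (differentiableAt_coord _) (differentiableAt_const _), h, pd_const]
  simp

lemma differentiableAt_hat₁ {u : Fin 4 → E4 → ℂ} (hu : ∀ a, DifferentiableAt ℝ (u a) p) (i : Fin 4) :
    DifferentiableAt ℝ (hat₁ (frame Γ E p) u i) p :=
  DifferentiableAt.fun_sum fun a _ => (differentiableAt_frame i a).fun_mul (hu a)

lemma differentiableAt_hat₂ {T : Fin 4 → Fin 4 → E4 → ℂ} (hT : ∀ a b, DifferentiableAt ℝ (T a b) p)
    (i j : Fin 4) : DifferentiableAt ℝ (hat₂ (frame Γ E p) T i j) p :=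
  DifferentiableAt.fun_sum fun a _ => DifferentiableAt.fun_sum fun b _ =>
    ((differentiableAt_frame i a).fun_mul (differentiableAt_frame j b)).fun_mul (hT a b)

lemma hat₁_self (u : Fin 4 → E4 → ℂ) (i : Fin 4) :
    hat₁ (frame Γ E p) u i p = ∑ a, E i a * u a p := by
  simp only [hat₁, frame_self]

lemma hat₂_self (T : Fin 4 → Fin 4 → E4 → ℂ) (i j : Fin 4) :
    hat₂ (frame Γ E p) T i j p = ∑ a, ∑ b, E i a * E j b * T a b p := by
  simp only [hat₂, frame_self]

/-- The linear term of the frame supplies exactly the Christoffel correction: differentiating a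
frame component gives the frame component of the covariant derivative. -/
lemma pd_hat₁ {u : Fin 4 → E4 → ℂ} (hu : ∀ a, DifferentiableAt ℝ (u a) p) (c i : Fin 4) :
    pd c (hat₁ (frame Γ E p) u i) p = ∑ a, E i a * (pd c (u a) p - ∑ l, Γ l c a * u l p) := by
  unfold hat₁
  rw [pd_sum _ fun a => (differentiableAt_frame i a).fun_mul (hu a)]
  simp only [pd_mul _ (differentiableAt_frame i _) (hu _), pd_frame, frame_self, mul_sub,
    Finset.sum_add_distrib, Finset.sum_sub_distrib, neg_mul, Finset.sum_neg_distrib,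
    Finset.sum_mul, Finset.mul_sum]
  rw [Finset.sum_comm]
  have : ∑ y, ∑ x, E i y * Γ x c y * u x p = ∑ y, ∑ x, E i y * (Γ x c y * u x p) :=
    Finset.sum_congr rfl fun _ _ => Finset.sum_congr rfl fun _ _ => by ring
  rw [this]; ring

lemma pd_hat₂ {T : Fin 4 → Fin 4 → E4 → ℂ} (hT : ∀ a b, DifferentiableAt ℝ (T a b) p)
    (c i j : Fin 4) : pd c (hat₂ (frame Γ E p) T i j) p = ∑ a, ∑ b, E i a * E j b *
      (pd c (T a b) p - ∑ l, (Γ l c a * T l b p + Γ l c b * T a l p)) := by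
  have h1 : hat₂ (frame Γ E p) T i j =
      hat₁ (frame Γ E p) (fun a => hat₁ (frame Γ E p) (T a) j) i := by
    funext y
    simp only [hat₂, hat₁, Finset.mul_sum, mul_assoc]
  rw [h1, pd_hat₁ fun a => differentiableAt_hat₁ (hT a) j]
  refine Finset.sum_congr rfl fun a _ => ?_
  rw [pd_hat₁ (hT a)]
  simp only [hat₁_self, Finset.sum_add_distrib, mul_sub, mul_add, Finset.sum_sub_distrib,
    Finset.mul_sum]
  rw [Finset.sum_comm (f := fun l b => E i a * (Γ l c a * (E j b * T l b p)))]
  have e1 : ∀ b l, E i a * (Γ l c a * (E j b * T l b p)) = E i a * E j b * (Γ l c a * T l b p) :=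
    fun _ _ => by ring
  simp only [e1, mul_assoc]
  ring

/-- The trace `K` is, up to second order at `p`, the sum of the squares of the frame vectors. -/
structure IsFrameTrace (Γ : Fin 4 → Fin 4 → Fin 4 → ℂ) (E : Fin 4 → Fin 4 → ℂ) (p : E4)
    (K : Fin 4 → Fin 4 → E4 → ℂ) : Prop where
  diff (a b : Fin 4) : DifferentiableAt ℝ (K a b) p
  val (a b : Fin 4) : K a b p = ∑ i, E i a * E i b
  deriv (c a b : Fin 4) : pd c (K a b) p = - ∑ l, (Γ a c l * K l b p + Γ b c l * K a l p)

variable {K : Fin 4 → Fin 4 → E4 → ℂ} (hK : IsFrameTrace Γ E p K)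
include hK

lemma IsFrameTrace.sum_eq (T : Fin 4 → Fin 4 → ℂ) :
    ∑ a, ∑ b, K a b p * T a b = ∑ i, ∑ a, ∑ b, E i a * E i b * T a b := by
  simp only [hK.val, Finset.sum_mul]
  calc _ = ∑ a, ∑ i, ∑ b, E i a * E i b * T a b :=
        Finset.sum_congr rfl fun _ _ => Finset.sum_comm
    _ = _ := Finset.sum_comm

/-- At `p` the tensor `K` is Σ E_i ⊗ E_i and parallel, so to first order the trace is the sum of the
diagonal frame components. -/
lemma jet_trK {T : Fin 4 → Fin 4 → E4 → ℂ} (hT : ∀ a b, DifferentiableAt ℝ (T a b) p)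
    {v : Fin 4 → ℂ} {d : Fin 4 → Fin 4 → ℂ}
    (h : ∀ i, Jet E p (hat₂ (frame Γ E p) T i i) (v i) (d i)) :
    Jet E p (trK K T) (∑ i, v i) (fun k => ∑ i, d i k) := by
  refine ⟨DifferentiableAt.fun_sum fun a _ => DifferentiableAt.fun_sum fun b _ =>
    (hK.diff a b).fun_mul (hT a b), ?_, fun k => ?_⟩
  · simp only [← (h _).val, hat₂_self, trK]
    exact hK.sum_eq fun a b => T a b p
  · simp only [← (h _).deriv]
    rw [Finset.sum_comm]
    refine Finset.sum_congr rfl fun c _ => ?_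
    rw [← Finset.mul_sum]
    congr 1
    simp only [pd_hat₂ hT]
    rw [← hK.sum_eq]
    unfold trK
    rw [pd_sum _ fun a => DifferentiableAt.fun_sum fun b _ => (hK.diff a b).fun_mul (hT a b)]
    simp only [pd_sum _ fun b => (hK.diff _ b).fun_mul (hT _ b), pd_mul _ (hK.diff _ _) (hT _ _),
      hK.deriv, Finset.sum_add_distrib, neg_mul, Finset.sum_neg_distrib, mul_sub, mul_add,
      Finset.sum_sub_distrib, Finset.sum_mul, Finset.mul_sum, neg_add, add_mul]
    have e1 : ∑ a, ∑ b, ∑ l, Γ a c l * K l b p * T a b p =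
        ∑ a, ∑ b, ∑ l, K a b p * (Γ l c a * T l b p) := by
      calc _ = ∑ a, ∑ l, ∑ b, Γ a c l * K l b p * T a b p :=
            Finset.sum_congr rfl fun _ _ => Finset.sum_comm
        _ = ∑ l, ∑ a, ∑ b, Γ a c l * K l b p * T a b p := Finset.sum_comm
        _ = ∑ l, ∑ b, ∑ a, Γ a c l * K l b p * T a b p :=
            Finset.sum_congr rfl fun _ _ => Finset.sum_comm
        _ = _ := Finset.sum_congr rfl fun _ _ => Finset.sum_congr rfl fun _ _ =>
            Finset.sum_congr rfl fun _ _ => by ring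
    have e2 : ∑ a, ∑ b, ∑ l, Γ b c l * K a l p * T a b p =
        ∑ a, ∑ b, ∑ l, K a b p * (Γ l c b * T a l p) := by
      refine Finset.sum_congr rfl fun a _ => ?_
      rw [Finset.sum_comm]
      exact Finset.sum_congr rfl fun _ _ => Finset.sum_congr rfl fun _ _ => by ring
    rw [e1, e2]; ring

lemma differentiableAt_contr₂ {A B : Fin 4 → Fin 4 → E4 → ℂ}
    (hA : ∀ a b, DifferentiableAt ℝ (A a b) p) (hB : ∀ a b, DifferentiableAt ℝ (B a b) p) :
    DifferentiableAt ℝ (contr₂ K A B) p :=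
  DifferentiableAt.fun_sum fun a _ => DifferentiableAt.fun_sum fun b _ =>
    DifferentiableAt.fun_sum fun c _ => DifferentiableAt.fun_sum fun d _ =>
      (((hK.diff a c).fun_mul (hK.diff b d)).fun_mul (hA a b)).fun_mul (hB c d)

/-- A double contraction is a trace of a trace, so `jet_trK` is applied twice, the inner trace
having first been moved outside the frame components. -/
lemma jet_contr₂ {A B : Fin 4 → Fin 4 → E4 → ℂ}
    (hA : ∀ a b, DifferentiableAt ℝ (A a b) p) (hB : ∀ a b, DifferentiableAt ℝ (B a b) p)
    {v w : Fin 4 → Fin 4 → ℂ} {d d' : Fin 4 → Fin 4 → Fin 4 → ℂ}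
    (hv : ∀ i j, Jet E p (hat₂ (frame Γ E p) A i j) (v i j) (d i j))
    (hw : ∀ i j, Jet E p (hat₂ (frame Γ E p) B i j) (w i j) (d' i j)) :
    Jet E p (contr₂ K A B) (∑ i, ∑ j, v i j * w i j)
      (fun k => ∑ i, ∑ j, (d i j k * w i j + v i j * d' i j k)) := by
  have h1 : contr₂ K A B = trK K (fun a c => trK K (fun b d y => A a b y * B c d y)) := by
    funext y
    simp only [contr₂, trK, Finset.mul_sum]
    refine Finset.sum_congr rfl fun a _ => ?_
    rw [Finset.sum_comm]
    exact Finset.sum_congr rfl fun _ _ => Finset.sum_congr rfl fun _ _ =>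
      Finset.sum_congr rfl fun _ _ => by ring
  rw [h1]
  have hd : ∀ a c b d, DifferentiableAt ℝ (fun y => A a b y * B c d y) p := fun a c b d =>
    (hA a b).fun_mul (hB c d)
  refine jet_trK hK (T := fun a c => trK K (fun b d y => A a b y * B c d y))
    (fun a c => DifferentiableAt.fun_sum fun b _ => DifferentiableAt.fun_sum fun d _ =>
      (hK.diff b d).fun_mul (hd a c b d)) fun i => ?_
  have h2 : hat₂ (frame Γ E p) (fun a c => trK K (fun b d y => A a b y * B c d y)) i i =
      trK K (fun b d => hat₂ (frame Γ E p) (fun a c y => A a b y * B c d y) i i) := by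
    funext y
    simp only [hat₂, trK, Finset.mul_sum]
    set e := frame Γ E p
    calc _ = ∑ a, ∑ b, ∑ c, ∑ d, e i a y * e i c y * (K b d y * (A a b y * B c d y)) :=
          Finset.sum_congr rfl fun _ _ => Finset.sum_comm
      _ = ∑ b, ∑ a, ∑ c, ∑ d, e i a y * e i c y * (K b d y * (A a b y * B c d y)) :=
          Finset.sum_comm
      _ = ∑ b, ∑ a, ∑ d, ∑ c, e i a y * e i c y * (K b d y * (A a b y * B c d y)) :=
          Finset.sum_congr rfl fun _ _ => Finset.sum_congr rfl fun _ _ => Finset.sum_comm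
      _ = ∑ b, ∑ d, ∑ a, ∑ c, e i a y * e i c y * (K b d y * (A a b y * B c d y)) :=
          Finset.sum_congr rfl fun _ _ => Finset.sum_comm
      _ = _ := Finset.sum_congr rfl fun _ _ => Finset.sum_congr rfl fun _ _ =>
          Finset.sum_congr rfl fun _ _ => Finset.sum_congr rfl fun _ _ => by ring
  rw [h2]
  refine jet_trK hK (fun b d => differentiableAt_hat₂ (fun a c => hd a c b d) i i) fun j => ?_
  have h3 : hat₂ (frame Γ E p) (fun b d => hat₂ (frame Γ E p) (fun a c y => A a b y * B c d y) i i)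
      j j = fun y => hat₂ (frame Γ E p) A i j y * hat₂ (frame Γ E p) B i j y := by
    funext y
    rw [hat₂_hat₂_comm (T := fun a c b d y => A a b y * B c d y)]
    have h4 : ∀ a c, hat₂ (frame Γ E p) (fun b d y => A a b y * B c d y) j j =
        fun y => hat₁ (frame Γ E p) (A a) j y * hat₁ (frame Γ E p) (B c) j y := by
      intro a c; funext y; exact hat₂_mul _ (A a) (B c) j j y
    simp only [hat₄, h4]
    rw [hat₂_mul (u := fun a => hat₁ (frame Γ E p) (A a) j)
      (v := fun a => hat₁ (frame Γ E p) (B a) j)]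
    simp only [hat₁, hat₂, Finset.mul_sum, mul_assoc]
  rw [h3]
  exact (hv i j).mul (hw i j)

end Hats

end MarsSimon

/-! ## Duality of 2-forms and Weyl tensors -/

namespace MarsSimon

section Hodge

variable {R : Type*} [CommRing R]

/-- The Hodge dual of a 2-form in an orthonormal frame of a four-dimensional space. -/
def hodge (F : Fin 4 → Fin 4 → R) (i j : Fin 4) : R :=
  !![0, F 2 3, F 3 1, F 1 2; F 3 2, 0, F 0 3, F 2 0; F 1 3, F 3 0, 0, F 0 1;
    F 2 1, F 0 2, F 1 0, 0] i j

/-- The Levi-Civita symbol. -/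
def levi (R : Type*) [CommRing R] (a b c d : Fin 4) : R :=
  hodge (fun k l => (if k = c then if l = d then 1 else 0 else 0)
    - (if k = d then if l = c then 1 else 0 else 0)) a b

/-- An entry of the dual is zero or one entry of `F`, at a place independent of `F`. Linearity and
contraction formulas then need only two cases. -/
lemma hodge_apply (i j : Fin 4) :
    (∀ F : Fin 4 → Fin 4 → R, hodge F i j = 0) ∨
      ∃ p q, ∀ F : Fin 4 → Fin 4 → R, hodge F i j = F p q :=
  by
  fin_cases i <;> fin_cases j <;>
    first
    | exact Or.inl fun F => rfl
    | exact Or.inr ⟨_, _, fun F => rfl⟩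

/-- There is no factor ½ here: for a 2-form the sum is twice the dual. -/
lemma sum_levi_mul (F : Fin 4 → Fin 4 → R) (i j : Fin 4) :
    ∑ k, ∑ l, levi R i j k l * F k l = hodge (fun k l => F k l - F l k) i j := by
  rcases hodge_apply (R := R) i j with h | ⟨p, q, h⟩
  · simp [levi, h]
  · simp [levi, h, sub_mul, Finset.sum_sub_distrib]

lemma hodge_smul (c : R) (F : Fin 4 → Fin 4 → R) (i j : Fin 4) :
    hodge (fun k l => c * F k l) i j = c * hodge F i j := by
  rcases hodge_apply (R := R) i j with h | ⟨p, q, h⟩ <;> simp [h]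

lemma hodge_add (F G : Fin 4 → Fin 4 → R) (i j : Fin 4) :
    hodge (fun k l => F k l + G k l) i j = hodge F i j + hodge G i j := by
  rcases hodge_apply (R := R) i j with h | ⟨p, q, h⟩ <;> simp [h]

lemma hodge_sum {ι : Type*} [Fintype ι] (F : ι → Fin 4 → Fin 4 → R) (i j : Fin 4) :
    hodge (fun k l => ∑ e, F e k l) i j = ∑ e, hodge (F e) i j := by
  rcases hodge_apply (R := R) i j with h | ⟨p, q, h⟩ <;> simp [h]

lemma hodge_hodge (F : Fin 4 → Fin 4 → R) (h0 : ∀ i, F i i = 0)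
    (i j : Fin 4) : hodge (hodge F) i j = F i j := by
  fin_cases i <;> fin_cases j <;> simp [hodge, h0]

lemma hodge_antisymm (F : Fin 4 → Fin 4 → R) (hF : ∀ i j, F i j = - F j i) (i j : Fin 4) :
    hodge F i j = - hodge F j i := by
  fin_cases i <;> fin_cases j <;>
    first
    | exact neg_zero.symm
    | exact hF _ _

lemma hodge_map {S : Type*} [CommRing S] (f : R →+* S) (F : Fin 4 → Fin 4 → R) (i j : Fin 4) :
    hodge (fun k l => f (F k l)) i j = f (hodge F i j) := by
  fin_cases i <;> fin_cases j <;> first | exact (map_zero f).symm | rfl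

/-- Carries identities for the symbol from ℤ, where they are decidable, to every commutative ring.
-/
lemma levi_map {S : Type*} [CommRing S] (f : R →+* S) (a b c d : Fin 4) :
    levi S a b c d = f (levi R a b c d) := by
  rw [levi, levi, ← hodge_map]
  congr 1
  funext k l
  split_ifs <;> simp

lemma levi_int_comm : ∀ a b c d : Fin 4, levi ℤ a b c d = levi ℤ c d a b := by decide

lemma levi_int_self : ∀ a b d : Fin 4, levi ℤ a b a d = 0 := by decide

lemma levi_comm (a b c d : Fin 4) : levi R a b c d = levi R c d a b := by
  rw [levi_map (Int.castRingHom R), levi_int_comm, ← levi_map]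

lemma levi_int_swap : ∀ a b c d : Fin 4, levi ℤ a c b d = - levi ℤ a b c d := by decide

lemma levi_swap (a b c d : Fin 4) : levi R a c b d = - levi R a b c d := by
  rw [levi_map (Int.castRingHom R), levi_int_swap, map_neg, ← levi_map]

lemma levi_self (a b d : Fin 4) : levi R a b a d = 0 := by
  rw [levi_map (Int.castRingHom R), levi_int_self, map_zero]

/-- Laplace expansion along the first two rows: the complementary minors are the entries of the dual
of w ∧ z. -/
lemma det_eq_sum_hodge (u v w z : Fin 4 → R) : (Matrix.of ![u, v, w, z]).det =
    ∑ a, ∑ b, u a * v b * hodge (fun k l => w k * z l - w l * z k) a b := by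
  simp [Matrix.det_succ_row_zero, Fin.sum_univ_succ, hodge, Fin.succAbove, Matrix.submatrix]
  ring

lemma det_single_eq_levi (a b c d : Fin 4) :
    (Matrix.of ![Pi.single a 1, Pi.single b 1, Pi.single c 1, Pi.single d (1 : R)]).det =
      levi R a b c d := by
  rw [det_eq_sum_hodge]
  rcases hodge_apply (R := R) a b with h | ⟨p, q, h⟩
  · simp [levi, Pi.single_apply, h]
  · simp only [levi, Pi.single_apply, h, ite_mul, mul_ite, mul_one, mul_zero, one_mul, zero_mul,
      Finset.sum_ite_eq', Finset.mem_univ, if_true]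
    split_ifs <;> simp

end Hodge

/-! ### Self-dual 2-forms and the double dual of a Weyl tensor -/

section SelfDual

/-- `A` is a 2-form in the eigenspace of `hodge` with eigenvalue `s = ±1`. -/
structure IsSelfDual (s : ℂ) (A : Fin 4 → Fin 4 → ℂ) : Prop where
  antisymm (i j : Fin 4) : A i j = - A j i
  dual (i j : Fin 4) : s * hodge A i j = A i j

variable {s : ℂ}

lemma diag_eq_zero {A : Fin 4 → Fin 4 → ℂ} (h : ∀ i j, A i j = - A j i) (i : Fin 4) : A i i = 0 := by
  linear_combination (1 / 2 : ℂ) * h i i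

/-- A form of definite duality is determined by its three components A_0i, so identities between
products of such forms become polynomial identities in few unknowns. -/
lemma IsSelfDual.eq_matrix {A : Fin 4 → Fin 4 → ℂ} (h : IsSelfDual s A) (i j : Fin 4) :
    A i j = !![0, A 0 1, A 0 2, A 0 3; -A 0 1, 0, s * A 0 3, -(s * A 0 2);
      -A 0 2, -(s * A 0 3), 0, s * A 0 1; -A 0 3, s * A 0 2, -(s * A 0 1), 0] i j := by
  have h0 := diag_eq_zero h.antisymm
  have h1 : A 2 3 = s * A 0 1 := (h.dual 2 3).symm
  have h2 : A 3 1 = s * A 0 2 := (h.dual 3 1).symm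
  have h3 : A 1 2 = s * A 0 3 := (h.dual 1 2).symm
  have h4 : A 3 2 = - A 2 3 := h.antisymm 3 2
  have h5 : A 1 3 = - A 3 1 := h.antisymm 1 3
  have h6 : A 2 1 = - A 1 2 := h.antisymm 2 1
  have h7 : A 1 0 = - A 0 1 := h.antisymm 1 0
  have h8 : A 2 0 = - A 0 2 := h.antisymm 2 0
  have h9 : A 3 0 = - A 0 3 := h.antisymm 3 0
  rw [h1] at h4
  rw [h2] at h5
  rw [h3] at h6
  fin_cases i <;> fin_cases j <;>
    simp only [Fin.zero_eta, Fin.mk_one, Fin.reduceFinMk, Matrix.of_apply, Matrix.cons_val] <;>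
    first
    | exact h0 _
    | assumption

/-- Products of forms of opposite duality are symmetric. -/
lemma IsSelfDual.mul_symm (hs : s * s = 1) {A B : Fin 4 → Fin 4 → ℂ} (hA : IsSelfDual s A)
    (hB : IsSelfDual (-s) B) (a c : Fin 4) : ∑ m, A a m * B c m = ∑ m, A c m * B a m := by
  have eA := hA.eq_matrix
  have eB := hB.eq_matrix
  -- Only the six free components are kept. With s = ±1 substituted, each entry of the claim is a
  -- polynomial identity.
  generalize A 0 1 = p, A 0 2 = q, A 0 3 = r at eA
  generalize B 0 1 = p', B 0 2 = q', B 0 3 = r' at eB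
  simp only [eA, eB, Fin.sum_univ_four]
  clear eA eB hA hB
  rcases mul_self_eq_one_iff.1 hs with rfl | rfl <;>
  fin_cases a <;> fin_cases c <;> simp <;> ring

/-- The anticommutator of two forms of the same duality. -/
lemma IsSelfDual.anticomm (hs : s * s = 1) {A B : Fin 4 → Fin 4 → ℂ} (hA : IsSelfDual s A)
    (hB : IsSelfDual s B) (b e : Fin 4) : ∑ a, (A b a * B a e + B b a * A a e) =
      if b = e then - (1 / 2) * ∑ k, ∑ l, A k l * B k l else 0 := by
  have eA := hA.eq_matrix
  have eB := hB.eq_matrix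
  generalize A 0 1 = p, A 0 2 = q, A 0 3 = r at eA
  generalize B 0 1 = p', B 0 2 = q', B 0 3 = r' at eB
  simp only [eA, eB, Fin.sum_univ_four]
  clear eA eB hA hB
  rcases mul_self_eq_one_iff.1 hs with rfl | rfl <;>
  fin_cases b <;> fin_cases e <;> simp <;> ring

/-- For the metric δ_ij the dual is an involution on 2-forms, so 1 + s∗ is twice the projection onto
the eigenspace of s. -/
lemma isSelfDual_add_hodge (hs : s * s = 1) {F : Fin 4 → Fin 4 → ℂ} (hF : ∀ i j, F i j = - F j i) :
    IsSelfDual s (fun i j => F i j + s * hodge F i j) where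
  antisymm i j := by
    have h1 := hF i j
    have h2 := hodge_antisymm F hF i j
    linear_combination h1 + s * h2
  dual i j := by
    rw [hodge_add, hodge_smul, hodge_hodge F (diag_eq_zero hF)]
    linear_combination F i j * hs

/-- The algebraic symmetries of a Weyl tensor, in an orthonormal frame. -/
structure IsWeyl (W : Fin 4 → Fin 4 → Fin 4 → Fin 4 → ℂ) : Prop where
  left (a b c d : Fin 4) : W a b c d = - W b a c d
  right (a b c d : Fin 4) : W a b c d = - W a b d c
  pair (a b c d : Fin 4) : W a b c d = W c d a b
  bianchi (a b c d : Fin 4) : W a b c d + W a c d b + W a d b c = 0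
  trace (b d : Fin 4) : ∑ a, W a b a d = 0

/-- The left and right duals of a Weyl tensor agree. -/
lemma IsWeyl.hodge_comm {W : Fin 4 → Fin 4 → Fin 4 → Fin 4 → ℂ} (h : IsWeyl W) (a b c d : Fin 4) :
    hodge (W a b) c d = hodge (fun m n => W m n c d) a b := by
  have l0 : ∀ a c d, W a a c d = 0 := fun a c d =>
    diag_eq_zero (A := fun i j => W i j c d) (fun i j => h.left i j c d) a
  have r0 : ∀ a b c, W a b c c = 0 := fun a b c =>
    diag_eq_zero (A := W a b) (fun i j => h.right a b i j) c
  have l10 := h.left 1 0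
  have l20 := h.left 2 0
  have l30 := h.left 3 0
  have l21 := h.left 2 1
  have l31 := h.left 3 1
  have l32 := h.left 3 2
  have r10 := fun a b => h.right a b 1 0
  have r20 := fun a b => h.right a b 2 0
  have r30 := fun a b => h.right a b 3 0
  have r21 := fun a b => h.right a b 2 1
  have r31 := fun a b => h.right a b 3 1
  have r32 := fun a b => h.right a b 3 2
  have t : ∀ b d, W 0 b 0 d + W 1 b 1 d + W 2 b 2 d + W 3 b 3 d = 0 := fun b d => by
    rw [← h.trace b d, Fin.sum_univ_four]
  have p0201 := h.pair 0 2 0 1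
  have p0301 := h.pair 0 3 0 1
  have p0302 := h.pair 0 3 0 2
  have p1201 := h.pair 1 2 0 1
  have p1202 := h.pair 1 2 0 2
  have p1203 := h.pair 1 2 0 3
  have p1301 := h.pair 1 3 0 1
  have p1302 := h.pair 1 3 0 2
  have p1303 := h.pair 1 3 0 3
  have p1312 := h.pair 1 3 1 2
  have p2301 := h.pair 2 3 0 1
  have p2302 := h.pair 2 3 0 2
  have p2303 := h.pair 2 3 0 3
  have p2312 := h.pair 2 3 1 2
  have p2313 := h.pair 2 3 1 3
  have t00 := t 0 0
  have t11 := t 1 1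
  have t22 := t 2 2
  have t33 := t 3 3
  have t01 := t 0 1
  have t02 := t 0 2
  have t03 := t 0 3
  have t12 := t 1 2
  have t13 := t 1 3
  have t23 := t 2 3
  simp only [l0, r0, l10, l20, l30, l21, l31, l32, r10, r20, r30, r21, r31, r32, neg_neg,
    zero_add, add_zero] at t00 t11 t22 t33 t01 t02 t03 t12 t13 t23
  -- The trace conditions identify, up to sign, each of these components with the one in which both
  -- index pairs are replaced by their complements. Together with pair symmetry this is the equality
  -- of the two duals.
  have e1 : W 2 3 2 3 = W 0 1 0 1 := by linear_combination (t22 + t33 - t11 - t00) / 2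
  have e2 : W 1 3 1 3 = W 0 2 0 2 := by linear_combination (t11 + t33 - t22 - t00) / 2
  have e3 : W 1 2 1 2 = W 0 3 0 3 := by linear_combination (t11 + t22 - t33 - t00) / 2
  have e4 : W 0 3 1 3 = - W 0 2 1 2 := by linear_combination t01
  have e5 : W 0 3 2 3 = W 0 1 1 2 := by linear_combination t02
  have e6 : W 0 2 2 3 = - W 0 1 1 3 := by linear_combination - t03
  have e7 : W 1 3 2 3 = - W 0 1 0 2 := by linear_combination t12
  have e8 : W 1 2 2 3 = W 0 1 0 3 := by linear_combination - t13
  have e9 : W 1 2 1 3 = - W 0 2 0 3 := by linear_combination t23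
  clear t t00 t11 t22 t33 t01 t02 t03 t12 t13 t23
  fin_cases a <;> fin_cases b <;>
  simp only [hodge, Fin.zero_eta, Fin.mk_one, Fin.reduceFinMk, Matrix.of_apply, Matrix.cons_val,
    l0, l10, l20, l30, l21, l31, l32] <;>
  fin_cases c <;> fin_cases d <;>
  simp only [Fin.zero_eta, Fin.mk_one, Fin.reduceFinMk, Matrix.cons_val, r0, r10, r20, r30, r21,
    r31, r32, neg_zero, neg_neg, p0201, p0301, p0302, p1201, p1202, p1203, p1301, p1302, p1303, p1312, p2301, p2302, p2303, p2312, p2313, e1, e2, e3, e4, e5,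
    e6, e7, e8, e9]

end SelfDual

end MarsSimon

/-! ## Self-dual Weyl tensors -/

namespace MarsSimon

section SelfDualWeyl

variable {s : ℂ}

/-- The algebraic symmetries of a self-dual Weyl tensor, in an orthonormal frame. -/
structure IsSelfDualWeyl (s : ℂ) (X : Fin 4 → Fin 4 → Fin 4 → Fin 4 → ℂ) : Prop where
  dual (a b : Fin 4) : IsSelfDual s (X a b)
  pair (a b c d : Fin 4) : X a b c d = X c d a b
  trace (b d : Fin 4) : ∑ a, X a b a d = 0

namespace IsSelfDualWeyl

variable {X Y : Fin 4 → Fin 4 → Fin 4 → Fin 4 → ℂ}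

lemma right (h : IsSelfDualWeyl s X) (a b c d : Fin 4) : X a b c d = - X a b d c :=
  (h.dual a b).antisymm c d

lemma left (h : IsSelfDualWeyl s X) (a b c d : Fin 4) : X a b c d = - X b a c d := by
  rw [h.pair, h.right, h.pair]

lemma dual_left (h : IsSelfDualWeyl s X) (c d : Fin 4) : IsSelfDual s (fun a b => X a b c d) := by
  have : (fun a b => X a b c d) = X c d := by funext a b; exact h.pair a b c d
  rw [this]; exact h.dual c d

lemma trace_inner (h : IsSelfDualWeyl s X) (b d : Fin 4) : ∑ a, X b a a d = 0 := by
  have : ∑ a, X b a a d = - ∑ a, X a b a d := by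
    rw [← Finset.sum_neg_distrib]; exact Finset.sum_congr rfl fun a _ => h.left _ _ _ _
  rw [this, h.trace, neg_zero]

/-- Reversal of all four indices. -/
lemma reverse (h : IsSelfDualWeyl s X) (a b c d : Fin 4) : X a b c d = X d c b a := by
  rw [h.pair, h.left, h.right, neg_neg]

lemma add (hX : IsSelfDualWeyl s X) (hY : IsSelfDualWeyl s Y) :
    IsSelfDualWeyl s (fun a b c d => X a b c d + Y a b c d) where
  dual a b := ⟨fun i j => by rw [hX.right, hY.right]; ring, fun i j => by
    rw [hodge_add, mul_add, (hX.dual a b).dual, (hY.dual a b).dual]⟩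
  pair a b c d := by rw [hX.pair, hY.pair]
  trace b d := by rw [Finset.sum_add_distrib, hX.trace, hY.trace, add_zero]

lemma smul (c : ℂ) (hX : IsSelfDualWeyl s X) : IsSelfDualWeyl s (fun a b i j => c * X a b i j) where
  dual a b := ⟨fun i j => by rw [hX.right]; ring, fun i j => by
    rw [hodge_smul, mul_left_comm, (hX.dual a b).dual]⟩
  pair a b c d := by rw [hX.pair]
  trace b d := by rw [← Finset.mul_sum, hX.trace, mul_zero]

/-- The superenergy tensor of Weyl tensors of opposite duality is symmetric in its first and third
index. -/
lemma superenergy_symm (hs : s * s = 1) (hX : IsSelfDualWeyl s X) (hY : IsSelfDualWeyl (-s) Y)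
    (a b c d : Fin 4) : ∑ m, ∑ n, X a m n b * Y c m n d = ∑ m, ∑ n, X c m n b * Y a m n d := by
  rw [Finset.sum_comm, Finset.sum_comm (f := fun m n => X c m n b * Y a m n d)]
  exact Finset.sum_congr rfl fun n _ =>
    (hX.dual_left n b).mul_symm hs (hY.dual_left n d) a c

end IsSelfDualWeyl

/-- Pair symmetry of the dual part is the equality of left and right dual. Its trace vanishes by the
first Bianchi identity. -/
lemma IsWeyl.isSelfDualWeyl (hs : s * s = 1) {W : Fin 4 → Fin 4 → Fin 4 → Fin 4 → ℂ}
    (h : IsWeyl W) : IsSelfDualWeyl s (fun a b c d => W a b c d + s * hodge (W a b) c d) where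
  dual a b := isSelfDual_add_hodge hs (h.right a b)
  pair a b c d := by
    have : (fun m n => W m n c d) = W c d := by funext m n; exact h.pair m n c d
    rw [h.hodge_comm, this, h.pair]
  trace b d := by
    have l0 : ∀ a c d, W a a c d = 0 := fun a c d =>
      diag_eq_zero (A := fun i j => W i j c d) (fun i j => h.left i j c d) a
    have r0 : ∀ a b c, W a b c c = 0 := fun a b c =>
      diag_eq_zero (A := W a b) (fun i j => h.right a b i j) c
    have key : ∀ i j k : Fin 4, W i b j k + W j b k i + W k b i j = 0 := by
      intro i j k
      linear_combination - h.bianchi b i j k + h.left i b j k + h.left j b k i + h.left k b i j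
    rw [Finset.sum_add_distrib, h.trace, ← Finset.mul_sum, zero_add]
    have : ∑ a, hodge (W a b) a d = 0 := by
      fin_cases d <;> simp only [hodge, Fin.sum_univ_four, Fin.zero_eta, Fin.mk_one,
        Fin.reduceFinMk, Matrix.of_apply, Matrix.cons_val]
      · linear_combination key 1 3 2
      · linear_combination key 0 2 3
      · linear_combination key 0 3 1
      · linear_combination key 0 1 2
    rw [this, mul_zero]

/-- The metric in the space of self-dual 2-forms, in an orthonormal frame. -/
def sdOne (s : ℂ) (a b c d : Fin 4) : ℂ :=
  1 / 4 * (s * levi ℂ a b c d + ((if a = c then if b = d then 1 else 0 else 0)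
    - (if a = d then if b = c then 1 else 0 else 0)))

lemma levi_eq_hodge (a b c d : Fin 4) : levi ℂ a b c d =
    hodge (fun c d => (if a = c then if b = d then (1 : ℂ) else 0 else 0)
    - (if a = d then if b = c then 1 else 0 else 0)) c d := by
  rw [levi_comm, levi]
  congr 1
  funext k l
  simp only [eq_comm (a := a), eq_comm (a := b)]
  congr 1
  split_ifs <;> rfl

/-- `sdOne` is the self-dual part, in the last index pair, of ¼(δ_ac δ_bd - δ_ad δ_bc). -/
lemma isSelfDual_sdOne (hs : s * s = 1) (a b : Fin 4) : IsSelfDual s (sdOne s a b) := by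
  have h := isSelfDual_add_hodge hs (F := fun c d => 1 / 4 *
    ((if a = c then if b = d then (1 : ℂ) else 0 else 0)
    - (if a = d then if b = c then 1 else 0 else 0))) (fun c d => by ring)
  convert h using 1
  funext c d
  rw [hodge_smul, ← levi_eq_hodge, sdOne]
  ring

lemma sdOne_pair (a b c d : Fin 4) : sdOne s a b c d = sdOne s c d a b := by
  rw [sdOne, sdOne, levi_comm]
  simp only [eq_comm (a := a), eq_comm (a := b)]
  congr 2
  split_ifs <;> simp_all

/-- The self-dual Weyl tensor `𝓕 ⊗ 𝓕 - (1/3) 𝓕² 𝓘`. -/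
def sdSquare (s : ℂ) (F : Fin 4 → Fin 4 → ℂ) (a b c d : Fin 4) : ℂ :=
  F a b * F c d - (∑ k, ∑ l, F k l * F k l) / 3 * sdOne s a b c d

/-- The anticommutator of `F` with itself, halved. -/
lemma IsSelfDual.sq (hs : s * s = 1) {F : Fin 4 → Fin 4 → ℂ} (hF : IsSelfDual s F) (b d : Fin 4) :
    ∑ a, F b a * F a d = if b = d then - (1 / 4) * ∑ k, ∑ l, F k l * F k l else 0 := by
  have h := hF.anticomm hs hF b d
  rw [Finset.sum_add_distrib] at h
  split_ifs at h ⊢ <;> linear_combination (1 / 2 : ℂ) * h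

/-- The coefficient 1/3 makes the trace vanish: F_ab F_ad contributes ¼𝓕² δ_bd, and the trace of 𝓘
is ¾ δ_bd. -/
lemma isSelfDualWeyl_sdSquare (hs : s * s = 1) {F : Fin 4 → Fin 4 → ℂ} (hF : IsSelfDual s F) :
    IsSelfDualWeyl s (sdSquare s F) where
  dual a b := ⟨fun i j => by
      simp only [sdSquare]
      linear_combination F a b * hF.antisymm i j -
        (∑ k, ∑ l, F k l * F k l) / 3 * (isSelfDual_sdOne hs a b).antisymm i j,
    fun i j => by
      have : hodge (sdSquare s F a b) i j = F a b * hodge F i j +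
        -((∑ k, ∑ l, F k l * F k l) / 3) * hodge (sdOne s a b) i j := by
        rw [← hodge_smul, ← hodge_smul, ← hodge_add]
        congr 1
        funext k l
        simp only [sdSquare]; ring
      rw [this, sdSquare]
      linear_combination F a b * hF.dual i j -
        (∑ k, ∑ l, F k l * F k l) / 3 * (isSelfDual_sdOne hs a b).dual i j⟩
  pair a b c d := by rw [sdSquare, sdSquare, sdOne_pair]; ring
  trace b d := by
    have h1 : ∑ a, F a b * F a d = - ∑ a, F b a * F a d := by
      rw [← Finset.sum_neg_distrib]
      exact Finset.sum_congr rfl fun a _ => by rw [hF.antisymm a b]; ring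
    have h2 : ∑ a, sdOne s a b a d = if b = d then 3 / 4 else 0 := by
      simp only [sdOne, mul_add, mul_sub, Finset.sum_add_distrib, Finset.sum_sub_distrib,
        ← Finset.mul_sum, levi_self]
      by_cases h : b = d
      · simp [h]; norm_num
      · simp [h]
    simp only [sdSquare, Finset.sum_sub_distrib, ← Finset.mul_sum]
    rw [h1, h2, hF.sq hs]
    split_ifs <;> ring

end SelfDualWeyl

end MarsSimon

/-! ## Algebra of the Mars–Simon tensor -/

namespace MarsSimon

section MarsSimonAlgebra

variable {s : ℂ}

lemma IsSelfDual.add {A B : Fin 4 → Fin 4 → ℂ} (hA : IsSelfDual s A) (hB : IsSelfDual s B) :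
    IsSelfDual s (fun i j => A i j + B i j) :=
  ⟨fun i j => by linear_combination hA.antisymm i j + hB.antisymm i j, fun i j => by
    rw [hodge_add]; linear_combination hA.dual i j + hB.dual i j⟩

lemma IsSelfDual.smul (c : ℂ) {A : Fin 4 → Fin 4 → ℂ} (hA : IsSelfDual s A) :
    IsSelfDual s (fun i j => c * A i j) :=
  ⟨fun i j => by linear_combination c * hA.antisymm i j, fun i j => by
    rw [hodge_smul]; linear_combination c * hA.dual i j⟩

lemma IsSelfDual.sum {ι : Type*} [Fintype ι] {A : ι → Fin 4 → Fin 4 → ℂ}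
    (hA : ∀ e, IsSelfDual s (A e)) : IsSelfDual s (fun i j => ∑ e, A e i j) :=
  ⟨fun i j => by
    rw [← Finset.sum_neg_distrib]; exact Finset.sum_congr rfl fun e _ => (hA e).antisymm i j,
   fun i j => by
    rw [hodge_sum, Finset.mul_sum]; exact Finset.sum_congr rfl fun e _ => (hA e).dual i j⟩

/-- The derivative of `sdSquare`. -/
def sdSquareDeriv (s : ℂ) (F dF : Fin 4 → Fin 4 → ℂ) (a b c d : Fin 4) : ℂ :=
  dF a b * F c d + F a b * dF c d
    - (∑ k, ∑ l, (dF k l * F k l + F k l * dF k l)) / 3 * sdOne s a b c d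

/-- Polarisation: `sdSquare` is quadratic, and its derivative is its value at F + dF minus those at
F and at dF. -/
lemma isSelfDualWeyl_sdSquareDeriv (hs : s * s = 1) {F dF : Fin 4 → Fin 4 → ℂ}
    (hF : IsSelfDual s F) (hdF : IsSelfDual s dF) : IsSelfDualWeyl s (sdSquareDeriv s F dF) := by
  have h := ((isSelfDualWeyl_sdSquare hs (hF.add hdF)).add
    ((isSelfDualWeyl_sdSquare hs hF).smul (-1))).add ((isSelfDualWeyl_sdSquare hs hdF).smul (-1))
  convert h using 1
  funext a b c d
  have : ∑ k, ∑ l, (F k l + dF k l) * (F k l + dF k l) = ∑ k, ∑ l, F k l * F k l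
      + ∑ k, ∑ l, dF k l * dF k l + ∑ k, ∑ l, (dF k l * F k l + F k l * dF k l) := by
    simp only [← Finset.sum_add_distrib]
    exact Finset.sum_congr rfl fun _ _ => Finset.sum_congr rfl fun _ _ => by ring
  simp only [sdSquare, sdSquareDeriv, this]
  ring

/-- Contraction of the first index with `v`. -/
def ctr (v : Fin 4 → ℂ) (X : Fin 4 → Fin 4 → Fin 4 → Fin 4 → ℂ) (b c d : Fin 4) : ℂ :=
  ∑ a, v a * X a b c d

/-- Contraction with `N` and `x`. -/
def pairing (N : Fin 4 → Fin 4 → ℂ) (x : Fin 4 → ℂ) (B : Fin 4 → Fin 4 → Fin 4 → ℂ) : ℂ :=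
  ∑ b, ∑ c, ∑ d, B b c d * N b c * x d

/-! ### Terms annihilated by contraction with N and ξ -/

section Pairing

variable (N : Fin 4 → Fin 4 → ℂ) (x : Fin 4 → ℂ)

lemma pairing_add (B C : Fin 4 → Fin 4 → Fin 4 → ℂ) :
    pairing N x (fun b c d => B b c d + C b c d) = pairing N x B + pairing N x C := by
  simp only [pairing, add_mul, Finset.sum_add_distrib]

lemma pairing_smul (r : ℂ) (B : Fin 4 → Fin 4 → Fin 4 → ℂ) :
    pairing N x (fun b c d => r * B b c d) = r * pairing N x B := by
  simp only [pairing, Finset.mul_sum, mul_assoc]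

variable {N x} (hN : ∀ a b, N a b = N b a) (hNx : ∀ b, ∑ a, N a b * x a = 0)

include hNx in
lemma pairing_left (C : Fin 4 → Fin 4 → ℂ) : pairing N x (fun b c d => x b * C c d) = 0 := by
  have : pairing N x (fun b c d => x b * C c d) = ∑ c, ∑ d, (∑ b, N b c * x b) * (C c d * x d) := by
    simp only [pairing, Finset.sum_mul]
    rw [Finset.sum_comm]
    refine Finset.sum_congr rfl fun _ _ => ?_
    rw [Finset.sum_comm]
    exact Finset.sum_congr rfl fun _ _ => Finset.sum_congr rfl fun _ _ => by ring
  rw [this]; simp [hNx]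

include hN hNx in
-- Each term of 𝓘 vanishes for its own reason: the Levi-Civita symbol is antisymmetric in the
-- indices contracted with `N`, one metric term contracts `N` with `x`, and the other contracts `v`
-- with `x`.
lemma pairing_ctr_sdOne {v : Fin 4 → ℂ} (hv : ∑ a, v a * x a = 0) :
    pairing N x (ctr v (sdOne s)) = 0 := by
  obtain ⟨L, hL'⟩ : ∃ L : Fin 4 → Fin 4 → Fin 4 → ℂ, ∀ b c d, L b c d = ∑ a, v a * levi ℂ a b c d :=
    ⟨_, fun _ _ _ => rfl⟩
  have hL : ∑ b, ∑ c, ∑ d, L b c d * N b c * x d = 0 := by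
    have h1 : ∑ b, ∑ c, ∑ d, L b c d * N b c * x d = - ∑ b, ∑ c, ∑ d, L b c d * N b c * x d := by
      conv_lhs => rw [Finset.sum_comm]
      simp only [← Finset.sum_neg_distrib]
      refine Finset.sum_congr rfl fun b _ => Finset.sum_congr rfl fun c _ =>
        Finset.sum_congr rfl fun d _ => ?_
      rw [hN c b, ← neg_mul, ← neg_mul, hL', hL', ← Finset.sum_neg_distrib]
      congr 2
      exact Finset.sum_congr rfl fun a _ => by rw [levi_swap a c b d]; ring
    linear_combination (1 / 2 : ℂ) * h1
  have h : ∀ b c d, ctr v (sdOne s) b c d = 1 / 4 * (s * L b c d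
      + (v c * (if b = d then 1 else 0) - v d * (if b = c then 1 else 0))) := by
    intro b c d
    simp only [ctr, sdOne, hL']
    have e : ∀ a, v a * (1 / 4 * (s * levi ℂ a b c d
        + ((if a = c then if b = d then 1 else 0 else 0)
        - (if a = d then if b = c then 1 else 0 else 0)))) =
        1 / 4 * (s * (v a * levi ℂ a b c d) + (v a * (if a = c then if b = d then 1 else 0 else 0)
        - v a * (if a = d then if b = c then 1 else 0 else 0))) := fun a => by ring
    simp only [e, ← Finset.mul_sum, Finset.sum_add_distrib, Finset.sum_sub_distrib]
    simp
  have h2 : ∑ b, ∑ c, ∑ d, v c * (if b = d then (1 : ℂ) else 0) * N b c * x d = 0 := by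
    have : ∀ b c, ∑ d, v c * (if b = d then (1 : ℂ) else 0) * N b c * x d = v c * (N b c * x b) := by
      intro b c; simp; ring
    simp only [this]
    rw [Finset.sum_comm]
    simp [← Finset.mul_sum, hNx]
  have h3 : ∑ b, ∑ c, ∑ d, v d * (if b = c then (1 : ℂ) else 0) * N b c * x d = 0 := by
    have : ∀ b, ∑ c, ∑ d, v d * (if b = c then (1 : ℂ) else 0) * N b c * x d =
        N b b * ∑ d, v d * x d := by
      intro b
      rw [Finset.sum_comm, Finset.mul_sum]
      exact Finset.sum_congr rfl fun d _ => by simp; ring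
    simp only [this, hv, mul_zero, Finset.sum_const_zero]
  have e : pairing N x (ctr v (sdOne s)) =
      1 / 4 * (s * ∑ b, ∑ c, ∑ d, L b c d * N b c * x d
        + (∑ b, ∑ c, ∑ d, v c * (if b = d then (1 : ℂ) else 0) * N b c * x d
          - ∑ b, ∑ c, ∑ d, v d * (if b = c then (1 : ℂ) else 0) * N b c * x d)) := by
    simp only [pairing, h, Finset.mul_sum, ← Finset.sum_add_distrib, ← Finset.sum_sub_distrib]
    exact Finset.sum_congr rfl fun b _ => Finset.sum_congr rfl fun c _ =>
        Finset.sum_congr rfl fun d _ => by ring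
  rw [e, hL, h2, h3]; ring

end Pairing

/-- The self-dual Killing form `F`, the self-dual Weyl tensor `X` and the covariant derivative `dX`
of the latter at a point of a vacuum space-time, in an orthonormal frame. -/
structure IsErnstData (s : ℂ) (F : Fin 4 → Fin 4 → ℂ)
    (X : Fin 4 → Fin 4 → Fin 4 → Fin 4 → ℂ) (dX : Fin 4 → Fin 4 → Fin 4 → Fin 4 → Fin 4 → ℂ) :
    Prop where
  sq : s * s = 1
  dualF : IsSelfDual s F
  dualX : IsSelfDualWeyl s X
  dualDX (e : Fin 4) : IsSelfDualWeyl s (dX e)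
  div (b c d : Fin 4) : ∑ a, dX a a b c d = 0

/-- The Ernst 1-form. -/
def ernst (x : Fin 4 → ℂ) (F : Fin 4 → Fin 4 → ℂ) (a : Fin 4) : ℂ := 2 * ∑ b, F a b * x b

/-- The derivative of the self-dual Killing form. -/
def sdKillingDeriv (x : Fin 4 → ℂ) (X : Fin 4 → Fin 4 → Fin 4 → Fin 4 → ℂ) (e a b : Fin 4) : ℂ :=
  ∑ d, x d * X d e a b

/-- The Mars–Simon tensor. -/
def msTensor (s : ℂ) (F : Fin 4 → Fin 4 → ℂ) (X : Fin 4 → Fin 4 → Fin 4 → Fin 4 → ℂ) (τ : ℂ)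
    (a b c d : Fin 4) : ℂ :=
  X a b c d + 6 * τ * sdSquare s F a b c d

/-- The derivative of the Mars–Simon tensor. -/
def msDeriv (s : ℂ) (x : Fin 4 → ℂ) (F : Fin 4 → Fin 4 → ℂ)
    (X : Fin 4 → Fin 4 → Fin 4 → Fin 4 → ℂ) (dX : Fin 4 → Fin 4 → Fin 4 → Fin 4 → Fin 4 → ℂ)
    (τ : ℂ) (e a b c d : Fin 4) : ℂ :=
  dX e a b c d + 6 * (-(τ * τ * ernst x F e) * sdSquare s F a b c d
    + τ * sdSquareDeriv s F (sdKillingDeriv x X e) a b c d)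

namespace IsErnstData

variable {x : Fin 4 → ℂ} {F : Fin 4 → Fin 4 → ℂ} {X : Fin 4 → Fin 4 → Fin 4 → Fin 4 → ℂ}
  {dX : Fin 4 → Fin 4 → Fin 4 → Fin 4 → Fin 4 → ℂ} (h : IsErnstData s F X dX)
include h

lemma dual_deriv (e : Fin 4) : IsSelfDual s (sdKillingDeriv x X e) :=
  IsSelfDual.sum fun d => (h.dualX.dual d e).smul (x d)

lemma dual_msTensor (τ : ℂ) : IsSelfDualWeyl s (msTensor s F X τ) :=
  h.dualX.add ((isSelfDualWeyl_sdSquare h.sq h.dualF).smul _)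

lemma dual_msDeriv (τ : ℂ) (e : Fin 4) : IsSelfDualWeyl s (msDeriv s x F X dX τ e) :=
  (h.dualDX e).add ((((isSelfDualWeyl_sdSquare h.sq h.dualF).smul _).add
    ((isSelfDualWeyl_sdSquareDeriv h.sq h.dualF (h.dual_deriv e)).smul _)).smul _)

lemma ernst_mul_self : ∑ a, ernst x F a * x a = 0 := by
  have h1 : ∑ a, ernst x F a * x a = - ∑ a, ernst x F a * x a := by
    simp only [ernst, Finset.mul_sum, Finset.sum_mul, ← Finset.sum_neg_distrib]
    conv_lhs => rw [Finset.sum_comm]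
    exact Finset.sum_congr rfl fun a _ => Finset.sum_congr rfl fun b _ => by
      rw [h.dualF.antisymm b a]; ring
  linear_combination (1 / 2 : ℂ) * h1

/-- The square of `F` is a multiple of the identity, so σ_a F_ab is a multiple of `x`. -/
lemma ernst_contract (b : Fin 4) :
    ∑ a, ernst x F a * F a b = (1 / 2 * ∑ k, ∑ l, F k l * F k l) * x b := by
  have e : ∑ a, ernst x F a * F a b = - 2 * ∑ c, x c * ∑ a, F b a * F a c := by
    simp only [ernst, Finset.mul_sum, Finset.sum_mul]
    rw [Finset.sum_comm]
    exact Finset.sum_congr rfl fun a _ => Finset.sum_congr rfl fun c _ => by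
      rw [h.dualF.antisymm c b]; ring
  rw [e]
  simp only [h.dualF.sq h.sq, mul_ite, mul_zero, Finset.sum_ite_eq, Finset.mem_univ, if_true]
  ring

/-- The anticommutator of `F` with the 2-form X_{··cd}, applied to `x`. It trades a term in which
`x` is contracted with `X` for one in which `x` is contracted with `F`, that is, for the Ernst form;
the scalar part of the anticommutator gives the multiple of x_b. -/
lemma deriv_contract (b c d : Fin 4) : ∑ a, F a b * sdKillingDeriv x X a c d =
    1 / 2 * ctr (ernst x F) X b c d - 1 / 2 * (x b * ∑ k, ∑ l, F k l * X k l c d) := by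
  have h1 := fun e => h.dualF.anticomm h.sq (h.dualX.dual_left c d) b e
  have h2 : ∑ e, x e * ∑ a, (F b a * X a e c d + X b a c d * F a e) =
      -(1 / 2) * (x b * ∑ k, ∑ l, F k l * X k l c d) := by
    simp only [h1, mul_ite, mul_zero, Finset.sum_ite_eq, Finset.mem_univ, if_true]
    ring
  have h3 : ∑ a, F a b * sdKillingDeriv x X a c d = ∑ e, x e * ∑ a, F b a * X a e c d := by
    simp only [sdKillingDeriv, Finset.mul_sum]
    rw [Finset.sum_comm]
    exact Finset.sum_congr rfl fun e _ => Finset.sum_congr rfl fun a _ => by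
      rw [h.dualF.antisymm a b, h.dualX.left e a]; ring
  have h4 : ctr (ernst x F) X b c d = - 2 * ∑ e, x e * ∑ a, X b a c d * F a e := by
    simp only [ctr, ernst, Finset.mul_sum, Finset.sum_mul]
    rw [Finset.sum_comm]
    exact Finset.sum_congr rfl fun e _ => Finset.sum_congr rfl fun a _ => by
      rw [h.dualX.left a b]; ring
  simp only [Finset.sum_add_distrib, mul_add] at h2
  rw [h3, h4]
  linear_combination h2

/-- The source-free Maxwell equations for 𝓕, a consequence of the tracelessness of `X`. -/
lemma deriv_div (b : Fin 4) : ∑ a, sdKillingDeriv x X a a b = 0 := by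
  simp only [sdKillingDeriv]
  rw [Finset.sum_comm]
  refine Finset.sum_eq_zero fun d _ => ?_
  rw [← Finset.mul_sum, h.dualX.trace_inner, mul_zero]

/-- The scalar 𝓕² is constant along the Killing field: X_dakl is antisymmetric in `d`, `a`, and both
are contracted with `x`. -/
lemma sq_deriv_mul_self : ∑ a, (∑ k, ∑ l, (sdKillingDeriv x X a k l * F k l
    + F k l * sdKillingDeriv x X a k l)) * x a = 0 := by
  have e : ∑ a, (∑ k, ∑ l, (sdKillingDeriv x X a k l * F k l
      + F k l * sdKillingDeriv x X a k l)) * x a =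
      2 * ∑ k, ∑ l, F k l * ∑ a, sdKillingDeriv x X a k l * x a := by
    simp only [Finset.sum_mul, Finset.mul_sum]
    rw [Finset.sum_comm]
    refine Finset.sum_congr rfl fun _ _ => ?_
    rw [Finset.sum_comm]
    exact Finset.sum_congr rfl fun _ _ => Finset.sum_congr rfl fun _ _ => by ring
  have e2 : ∀ k l, ∑ a, sdKillingDeriv x X a k l * x a = 0 := by
    intro k l
    have h1 : ∑ a, sdKillingDeriv x X a k l * x a = - ∑ a, sdKillingDeriv x X a k l * x a := by
      simp only [sdKillingDeriv, Finset.sum_mul, ← Finset.sum_neg_distrib]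
      conv_lhs => rw [Finset.sum_comm]
      exact Finset.sum_congr rfl fun a _ => Finset.sum_congr rfl fun b _ => by
        rw [h.dualX.left]; ring
    linear_combination (1 / 2 : ℂ) * h1
  rw [e]; simp [e2]

variable {N : Fin 4 → Fin 4 → ℂ} (hN : ∀ a b, N a b = N b a) (hNx : ∀ b, ∑ a, N a b * x a = 0)

include hN hNx in
-- The product term of `sdSquare` becomes a multiple of x_b, and the 𝓘 term drops because the Ernst
-- form annihilates `x`.
lemma pairing_sdSquare : pairing N x (ctr (ernst x F) (sdSquare s F)) = 0 := by
  have e : ctr (ernst x F) (sdSquare s F) = fun b c d =>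
      x b * ((1 / 2 * ∑ k, ∑ l, F k l * F k l) * F c d)
      + -((∑ k, ∑ l, F k l * F k l) / 3) * ctr (ernst x F) (sdOne s) b c d := by
    funext b c d
    have : ctr (ernst x F) (sdSquare s F) b c d = (∑ a, ernst x F a * F a b) * F c d
      - (∑ k, ∑ l, F k l * F k l) / 3 * ctr (ernst x F) (sdOne s) b c d := by
      simp only [ctr, sdSquare, mul_sub, Finset.sum_sub_distrib]
      congr 1
      · rw [Finset.sum_mul]; exact Finset.sum_congr rfl fun _ _ => by ring
      · rw [Finset.mul_sum]; exact Finset.sum_congr rfl fun _ _ => by ring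
    rw [this, h.ernst_contract]; ring
  rw [e, pairing_add, pairing_smul,
    pairing_left hNx fun c d => (1 / 2 * ∑ k, ∑ l, F k l * F k l) * F c d,
    pairing_ctr_sdOne hN hNx h.ernst_mul_self]
  ring

include hN hNx in
/-- The divergence of the Mars–Simon tensor. -/
lemma pairing_div (τ : ℂ) : pairing N x (fun b c d => ∑ a, msDeriv s x F X dX τ a a b c d) =
    3 * τ * pairing N x (ctr (ernst x F) (msTensor s F X τ)) := by
  set q : Fin 4 → ℂ := fun a => ∑ k, ∑ l, (sdKillingDeriv x X a k l * F k l
      + F k l * sdKillingDeriv x X a k l) with hq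
  -- The coefficient 3τ is 6τ times the ½ of `deriv_contract`. The divergences of `X` and of 𝓕 have
  -- dropped out.
  have e1 : (fun b c d => ∑ a, msDeriv s x F X dX τ a a b c d) = fun b c d =>
      3 * τ * ctr (ernst x F) X b c d + (-(6 * τ * τ) * ctr (ernst x F) (sdSquare s F) b c d +
        (x b * (-(3 * τ) * ∑ k, ∑ l, F k l * X k l c d) + -(2 * τ) * ctr q (sdOne s) b c d)) := by
    funext b c d
    have e : ∀ a, msDeriv s x F X dX τ a a b c d = dX a a b c d
        + (-(6 * τ * τ) * (ernst x F a * sdSquare s F a b c d)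
        + (6 * τ * (sdKillingDeriv x X a a b * F c d) + (6 * τ * (F a b * sdKillingDeriv x X a c d)
        + -(2 * τ) * (q a * sdOne s a b c d)))) := fun a => by
      simp only [msDeriv, sdSquareDeriv, hq]; ring
    simp only [e, Finset.sum_add_distrib, ← Finset.mul_sum, h.div, ← Finset.sum_mul, h.deriv_div,
      h.deriv_contract]
    simp only [ctr]
    ring
  have e2 : ctr (ernst x F) (msTensor s F X τ) = fun b c d => ctr (ernst x F) X b c d +
      6 * τ * ctr (ernst x F) (sdSquare s F) b c d := by
    funext b c d
    simp only [ctr, msTensor, Finset.mul_sum, ← Finset.sum_add_distrib]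
    exact Finset.sum_congr rfl fun _ _ => by ring
  rw [e1, e2]
  simp only [pairing_add, pairing_smul]
  -- The two sides carry the `sdSquare` term with the different coefficients -6τ² and 18τ²; they
  -- agree because its pairing vanishes.
  rw [h.pairing_sdSquare hN hNx, pairing_left hNx fun c d => -(3 * τ) * ∑ k, ∑ l, F k l * X k l c d,
    pairing_ctr_sdOne hN hNx h.sq_deriv_mul_self]
  ring

end IsErnstData

end MarsSimonAlgebra

end MarsSimon

/-! ## The conservation law at a point -/

namespace MarsSimon

section Conservation

/-- The contraction `Y_{cmnd} x_c x_d`. -/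
def electric (x : Fin 4 → ℂ) (Y : Fin 4 → Fin 4 → Fin 4 → Fin 4 → ℂ) (m n : Fin 4) : ℂ :=
  ∑ c, ∑ d, Y c m n d * (x c * x d)

variable {s : ℂ} (x : Fin 4 → ℂ)

lemma pairing_sum {ι : Type*} [Fintype ι] (N : Fin 4 → Fin 4 → ℂ) (v : ι → ℂ)
    (B : ι → Fin 4 → Fin 4 → Fin 4 → ℂ) : pairing N x (fun b c d => ∑ a, v a * B a b c d) =
      ∑ a, v a * pairing N x (B a) := by
  simp only [pairing, Finset.sum_mul, Finset.mul_sum]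
  calc _ = ∑ b, ∑ c, ∑ a, ∑ d, v a * B a b c d * N b c * x d :=
        Finset.sum_congr rfl fun _ _ => Finset.sum_congr rfl fun _ _ => Finset.sum_comm
    _ = ∑ b, ∑ a, ∑ c, ∑ d, v a * B a b c d * N b c * x d :=
        Finset.sum_congr rfl fun _ _ => Finset.sum_comm
    _ = ∑ a, ∑ b, ∑ c, ∑ d, v a * B a b c d * N b c * x d := Finset.sum_comm
    _ = _ := Finset.sum_congr rfl fun _ _ => Finset.sum_congr rfl fun _ _ =>
        Finset.sum_congr rfl fun _ _ => Finset.sum_congr rfl fun _ _ => by ring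

lemma pairing_contraction (w : Fin 4 → Fin 4 → ℂ) (A : Fin 4 → Fin 4 → Fin 4 → ℂ)
    (B : Fin 4 → Fin 4 → Fin 4 → Fin 4 → ℂ) :
    pairing (fun m n => ∑ c, ∑ d, B c m n d * w c d) x A =
      ∑ b, ∑ c, ∑ d, x b * w c d * ∑ m, ∑ n, A m n b * B c m n d := by
  simp only [pairing, Finset.sum_mul, Finset.mul_sum]
  calc _ = ∑ m, ∑ b, ∑ n, ∑ c, ∑ d, A m n b * (B c m n d * w c d) * x b :=
        Finset.sum_congr rfl fun _ _ => Finset.sum_comm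
    _ = ∑ b, ∑ m, ∑ n, ∑ c, ∑ d, A m n b * (B c m n d * w c d) * x b := Finset.sum_comm
    _ = ∑ b, ∑ m, ∑ c, ∑ n, ∑ d, A m n b * (B c m n d * w c d) * x b :=
        Finset.sum_congr rfl fun _ _ => Finset.sum_congr rfl fun _ _ => Finset.sum_comm
    _ = ∑ b, ∑ c, ∑ m, ∑ n, ∑ d, A m n b * (B c m n d * w c d) * x b :=
        Finset.sum_congr rfl fun _ _ => Finset.sum_comm
    _ = ∑ b, ∑ c, ∑ m, ∑ d, ∑ n, A m n b * (B c m n d * w c d) * x b :=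
        Finset.sum_congr rfl fun _ _ => Finset.sum_congr rfl fun _ _ =>
          Finset.sum_congr rfl fun _ _ => Finset.sum_comm
    _ = ∑ b, ∑ c, ∑ d, ∑ m, ∑ n, A m n b * (B c m n d * w c d) * x b :=
        Finset.sum_congr rfl fun _ _ => Finset.sum_congr rfl fun _ _ => Finset.sum_comm
    _ = _ := Finset.sum_congr rfl fun _ _ => Finset.sum_congr rfl fun _ _ =>
        Finset.sum_congr rfl fun _ _ => Finset.sum_congr rfl fun _ _ =>
          Finset.sum_congr rfl fun _ _ => by ring

variable {x}

lemma sum_antisymm_symm {A V : Fin 4 → Fin 4 → ℂ} (hA : ∀ a b, A a b = - A b a)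
    (hV : ∀ a b, V a b = V b a) : ∑ a, ∑ b, A a b * V a b = 0 := by
  have h1 : ∑ a, ∑ b, A a b * V a b = - ∑ a, ∑ b, A a b * V a b := by
    simp only [← Finset.sum_neg_distrib]
    conv_lhs => rw [Finset.sum_comm]
    exact Finset.sum_congr rfl fun a _ => Finset.sum_congr rfl fun b _ => by
      rw [hA b a, hV b a]; ring
  linear_combination (1 / 2 : ℂ) * h1

variable {X Y : Fin 4 → Fin 4 → Fin 4 → Fin 4 → ℂ}

lemma IsSelfDualWeyl.electric_symm (hX : IsSelfDualWeyl s X) (a b : Fin 4) :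
    electric x X a b = electric x X b a := by
  simp only [electric]
  rw [Finset.sum_comm]
  exact Finset.sum_congr rfl fun _ _ => Finset.sum_congr rfl fun _ _ => by rw [hX.reverse]; ring

/-- An antisymmetric index pair is contracted with x_a x_c. With `electric_symm` this supplies the
two properties of N that `pairing_div` needs. -/
lemma IsSelfDualWeyl.electric_mul_self (hX : IsSelfDualWeyl s X) (b : Fin 4) :
    ∑ a, electric x X a b * x a = 0 := by
  have e : ∑ a, electric x X a b * x a = ∑ d, x d * ∑ a, ∑ c, X c a b d * (x a * x c) := by
    simp only [electric, Finset.sum_mul, Finset.mul_sum]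
    calc _ = ∑ a, ∑ d, ∑ c, X c a b d * (x c * x d) * x a :=
          Finset.sum_congr rfl fun _ _ => Finset.sum_comm
      _ = ∑ d, ∑ a, ∑ c, X c a b d * (x c * x d) * x a := Finset.sum_comm
      _ = _ := Finset.sum_congr rfl fun _ _ => Finset.sum_congr rfl fun _ _ =>
          Finset.sum_congr rfl fun _ _ => by ring
  rw [e]
  refine Finset.sum_eq_zero fun d _ => ?_
  rw [sum_antisymm_symm (A := fun a c => X c a b d) (V := fun a c => x a * x c)
    (fun a c => hX.left c a b d) (fun a c => mul_comm _ _), mul_zero]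

/-- The superenergy current does not depend on which of the two Weyl tensors carries the free
index. -/
lemma IsSelfDualWeyl.pairing_electric (hs : s * s = 1) (hX : IsSelfDualWeyl s X)
    (hY : IsSelfDualWeyl (-s) Y) (a : Fin 4) :
    pairing (electric x Y) x (X a) = pairing (electric x X) x (Y a) := by
  have h1 := pairing_contraction x (fun c d => x c * x d) (X a) Y
  have h2 := pairing_contraction x (fun c d => x c * x d) (Y a) X
  refine (h1.trans ?_).trans h2.symm
  calc _ = ∑ b, ∑ c, ∑ d, x b * (x c * x d) * ∑ m, ∑ n, X c m n b * Y a m n d :=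
        Finset.sum_congr rfl fun _ _ => Finset.sum_congr rfl fun _ _ =>
          Finset.sum_congr rfl fun _ _ => by rw [hX.superenergy_symm hs hY]
    _ = ∑ b, ∑ d, ∑ c, x b * (x c * x d) * ∑ m, ∑ n, X c m n b * Y a m n d :=
        Finset.sum_congr rfl fun _ _ => Finset.sum_comm
    _ = ∑ d, ∑ b, ∑ c, x b * (x c * x d) * ∑ m, ∑ n, X c m n b * Y a m n d := Finset.sum_comm
    _ = ∑ d, ∑ c, ∑ b, x b * (x c * x d) * ∑ m, ∑ n, X c m n b * Y a m n d :=
        Finset.sum_congr rfl fun _ _ => Finset.sum_comm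
    _ = _ := Finset.sum_congr rfl fun _ _ => Finset.sum_congr rfl fun _ _ =>
        Finset.sum_congr rfl fun _ _ => by
          rw [Finset.mul_sum, Finset.mul_sum]
          refine Finset.sum_congr rfl fun _ _ => ?_
          rw [Finset.mul_sum, Finset.mul_sum]
          exact Finset.sum_congr rfl fun _ _ => by ring

/-- The derivative of `electric`. -/
def electricDeriv (x : Fin 4 → ℂ) (A : Fin 4 → Fin 4 → ℂ)
    (Y : Fin 4 → Fin 4 → Fin 4 → Fin 4 → ℂ) (dY : Fin 4 → Fin 4 → Fin 4 → Fin 4 → Fin 4 → ℂ)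
    (e m n : Fin 4) : ℂ :=
  ∑ c, ∑ d, (dY e c m n d * (x c * x d) + Y c m n d * (A e c * x d + x c * A e d))

/-- The pointwise form of the conservation law. -/
theorem conservation {A F F' : Fin 4 → Fin 4 → ℂ} {X' : Fin 4 → Fin 4 → Fin 4 → Fin 4 → ℂ}
    {dX dX' : Fin 4 → Fin 4 → Fin 4 → Fin 4 → Fin 4 → ℂ} {τ τ' : ℂ}
    (hA : ∀ a b, A a b = - A b a) (h : IsErnstData s F X dX) (h' : IsErnstData (-s) F' X' dX') :
    ∑ a, (-3 * (τ * ernst x F a + τ' * ernst x F' a)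
        * pairing (electric x (msTensor (-s) F' X' τ')) x (msTensor s F X τ a)
      + ∑ b, A a b * ∑ m, ∑ n, electric x (msTensor (-s) F' X' τ') m n * msTensor s F X τ a m n b
      + pairing (electricDeriv x A (msTensor (-s) F' X' τ') (msDeriv (-s) x F' X' dX' τ') a) x
          (msTensor s F X τ a)
      + pairing (electric x (msTensor (-s) F' X' τ')) x (msDeriv s x F X dX τ a a)) = 0 := by
  have hS := h.dual_msTensor τ
  have hY := h'.dual_msTensor τ'
  have hdY := h'.dual_msDeriv (x := x) τ'
  have hC := h.pairing_div (x := x) (fun a b => hY.electric_symm a b)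
    (fun b => hY.electric_mul_self b) τ
  have hD := h'.pairing_div (x := x) (fun a b => hS.electric_symm a b)
    (fun b => hS.electric_mul_self b) τ'
  have hswap := fun a => hS.pairing_electric h.sq hY (x := x) a
  have hswap' := fun a => hS.pairing_electric h.sq (hdY a) (x := x) a
  set S := msTensor s F X τ
  set Y := msTensor (-s) F' X' τ'
  set dS := msDeriv s x F X dX τ
  set dY := msDeriv (-s) x F' X' dX' τ'
  have one : ∀ (N : Fin 4 → Fin 4 → ℂ) (dT : Fin 4 → Fin 4 → Fin 4 → Fin 4 → Fin 4 → ℂ),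
      pairing N x (fun b c d => ∑ a, dT a a b c d) = ∑ a, pairing N x (dT a a) := by
    intro N dT
    have := pairing_sum x N (fun _ => (1 : ℂ)) (fun a => dT a a)
    simpa using this
  rw [one] at hC hD
  have hC' : pairing (electric x Y) x (ctr (ernst x F) S) =
    ∑ a, ernst x F a * pairing (electric x Y) x (S a) := pairing_sum x _ _ _
  have hD' : pairing (electric x S) x (ctr (ernst x F') Y) =
    ∑ a, ernst x F' a * pairing (electric x S) x (Y a) := pairing_sum x _ _ _
  -- The derivative of the ξ outside N: the tensor N_mn S_amnb is symmetric in `a`, `b`, because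
  -- reversing the indices of `S` is compensated by the symmetry of N.
  have hB : ∑ a, ∑ b, A a b * ∑ m, ∑ n, electric x Y m n * S a m n b = 0 := by
    refine sum_antisymm_symm hA fun a b => ?_
    rw [Finset.sum_comm]
    exact Finset.sum_congr rfl fun m _ => Finset.sum_congr rfl fun n _ => by
      rw [hY.electric_symm, hS.reverse]
  -- The derivatives of the two ξ inside N drop out as well, so only the derivative of `Y` survives.
  have hE : ∑ a, pairing (electricDeriv x A Y dY a) x (S a) = ∑ a, pairing (electric x (dY a)) x (S a)
      := by
    have e : ∀ a, pairing (electricDeriv x A Y dY a) x (S a) = pairing (electric x (dY a)) x (S a)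
        + (∑ c, A a c * ∑ b, ∑ d, x b * x d * ∑ m, ∑ n, S a m n b * Y c m n d
        + ∑ d, A a d * ∑ b, ∑ c, x b * x c * ∑ m, ∑ n, S a m n b * Y c m n d) := by
      intro a
      have e1 : pairing (electricDeriv x A Y dY a) x (S a) = pairing (electric x (dY a)) x (S a)
          + (pairing (fun m n => ∑ c, ∑ d, Y c m n d * (A a c * x d)) x (S a)
          + pairing (fun m n => ∑ c, ∑ d, Y c m n d * (x c * A a d)) x (S a)) := by
        simp only [pairing, ← Finset.sum_add_distrib]
        refine Finset.sum_congr rfl fun _ _ => Finset.sum_congr rfl fun _ _ =>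
          Finset.sum_congr rfl fun _ _ => ?_
        simp only [electricDeriv, electric, mul_add, add_mul, Finset.sum_add_distrib]
      rw [e1, pairing_contraction x (fun c d => A a c * x d),
        pairing_contraction x (fun c d => x c * A a d)]
      congr 2
      · rw [Finset.sum_comm]
        simp only [Finset.mul_sum (Finset.univ : Finset (Fin 4)) _ (A a _)]
        exact Finset.sum_congr rfl fun _ _ => Finset.sum_congr rfl fun _ _ =>
          Finset.sum_congr rfl fun _ _ => by ring
      · calc _ = ∑ b, ∑ d, ∑ c, x b * (x c * A a d) * ∑ m, ∑ n, S a m n b * Y c m n d :=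
              Finset.sum_congr rfl fun _ _ => Finset.sum_comm
          _ = ∑ d, ∑ b, ∑ c, x b * (x c * A a d) * ∑ m, ∑ n, S a m n b * Y c m n d :=
              Finset.sum_comm
          _ = _ := by
              simp only [Finset.mul_sum (Finset.univ : Finset (Fin 4)) _ (A a _)]
              exact Finset.sum_congr rfl fun _ _ => Finset.sum_congr rfl fun _ _ =>
                Finset.sum_congr rfl fun _ _ => by ring
    have v1 : ∑ a, ∑ c, A a c * ∑ b, ∑ d, x b * x d * ∑ m, ∑ n, S a m n b * Y c m n d = 0 :=
      sum_antisymm_symm hA fun a c => by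
        refine Finset.sum_congr rfl fun _ _ => Finset.sum_congr rfl fun _ _ => ?_
        rw [hS.superenergy_symm h.sq hY]
    -- The indices to be exchanged, `a` and `d`, lie on different factors. The superenergy symmetry
    -- first brings both onto `Y`, where index reversal applies.
    have v2 : ∑ a, ∑ d, A a d * ∑ b, ∑ c, x b * x c * ∑ m, ∑ n, S a m n b * Y c m n d = 0 := by
      have e2 : ∀ a d, ∑ b, ∑ c, x b * x c * ∑ m, ∑ n, S a m n b * Y c m n d =
          ∑ m, ∑ n, electric x S m n * Y a m n d := by
        intro a d
        calc _ = ∑ b, ∑ c, x b * x c * ∑ m, ∑ n, S c m n b * Y a m n d :=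
              Finset.sum_congr rfl fun _ _ => Finset.sum_congr rfl fun _ _ => by
                rw [hS.superenergy_symm h.sq hY]
          _ = ∑ b, ∑ m, ∑ c, ∑ n, x b * x c * (S c m n b * Y a m n d) := by
              simp only [Finset.mul_sum]
              exact Finset.sum_congr rfl fun _ _ => Finset.sum_comm
          _ = ∑ m, ∑ b, ∑ c, ∑ n, x b * x c * (S c m n b * Y a m n d) := Finset.sum_comm
          _ = ∑ m, ∑ b, ∑ n, ∑ c, x b * x c * (S c m n b * Y a m n d) :=
              Finset.sum_congr rfl fun _ _ => Finset.sum_congr rfl fun _ _ => Finset.sum_comm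
          _ = ∑ m, ∑ n, ∑ b, ∑ c, x b * x c * (S c m n b * Y a m n d) :=
              Finset.sum_congr rfl fun _ _ => Finset.sum_comm
          _ = _ := by
              refine Finset.sum_congr rfl fun m _ => Finset.sum_congr rfl fun n _ => ?_
              rw [electric, Finset.sum_mul, Finset.sum_comm]
              refine Finset.sum_congr rfl fun _ _ => ?_
              rw [Finset.sum_mul]
              exact Finset.sum_congr rfl fun _ _ => by ring
      simp only [e2]
      refine sum_antisymm_symm (V := fun a d => ∑ m, ∑ n, electric x S m n * Y a m n d)
        hA fun a b => ?_
      rw [Finset.sum_comm]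
      exact Finset.sum_congr rfl fun m _ => Finset.sum_congr rfl fun n _ => by
        rw [hS.electric_symm, hY.reverse]
    simp only [e, Finset.sum_add_distrib, v1, v2, add_zero]
  simp only [Finset.sum_add_distrib, hB, hE, mul_add, add_mul]
  -- `hswap'` moves the free index from `S` to the derivative of `Y`, turning that term into a
  -- divergence. The factors 3τ and 3τ' then cancel against the gradient of the weight.
  simp only [hswap', hC, hD, hC', hD', hswap, Finset.mul_sum]
  simp only [add_zero, ← Finset.sum_add_distrib]
  refine Finset.sum_eq_zero fun a _ => ?_
  ring

end Conservation

end MarsSimon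

/-! ## Frame components of tensors with symmetries -/

namespace MarsSimon

section HatSymmetries

variable (e : Fin 4 → Fin 4 → E4 → ℂ)

lemma hat₄_eq (T : Fin 4 → Fin 4 → Fin 4 → Fin 4 → E4 → ℂ) (i j k l : Fin 4) (y : E4) :
    hat₄ e T i j k l y =
      ∑ a, ∑ b, ∑ c, ∑ d, e i a y * e j b y * e k c y * e l d y * T a b c d y := by
  simp only [hat₄, hat₂, Finset.mul_sum]
  exact Finset.sum_congr rfl fun _ _ => Finset.sum_congr rfl fun _ _ =>
    Finset.sum_congr rfl fun _ _ => Finset.sum_congr rfl fun _ _ => by ring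

lemma hat₂_neg_swap {T : Fin 4 → Fin 4 → E4 → ℂ} {y : E4} (h : ∀ a b, T a b y = - T b a y)
    (i j : Fin 4) : hat₂ e T i j y = - hat₂ e T j i y := by
  simp only [hat₂, ← Finset.sum_neg_distrib]
  rw [Finset.sum_comm]
  exact Finset.sum_congr rfl fun a _ => Finset.sum_congr rfl fun b _ => by rw [h b a]; ring

/-- A cyclic identity is preserved by taking components. -/
lemma sum_cyclic {Φ : Fin 4 → Fin 4 → Fin 4 → ℂ} (h : ∀ a b c, Φ a b c + Φ b c a + Φ c a b = 0)
    (u v w : Fin 4 → ℂ) : ∑ a, ∑ b, ∑ c, u a * v b * w c * Φ a b c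
      + ∑ a, ∑ b, ∑ c, v a * w b * u c * Φ a b c + ∑ a, ∑ b, ∑ c, w a * u b * v c * Φ a b c = 0 := by
  have h1 : ∑ a, ∑ b, ∑ c, v a * w b * u c * Φ a b c =
      ∑ a, ∑ b, ∑ c, u a * v b * w c * Φ b c a := by
    calc _ = ∑ a, ∑ c, ∑ b, v a * w b * u c * Φ a b c :=
          Finset.sum_congr rfl fun _ _ => Finset.sum_comm
      _ = ∑ c, ∑ a, ∑ b, v a * w b * u c * Φ a b c := Finset.sum_comm
      _ = _ := Finset.sum_congr rfl fun _ _ => Finset.sum_congr rfl fun _ _ =>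
          Finset.sum_congr rfl fun _ _ => by ring
  have h2 : ∑ a, ∑ b, ∑ c, w a * u b * v c * Φ a b c =
      ∑ a, ∑ b, ∑ c, u a * v b * w c * Φ c a b := by
    calc _ = ∑ b, ∑ a, ∑ c, w a * u b * v c * Φ a b c := Finset.sum_comm
      _ = ∑ b, ∑ c, ∑ a, w a * u b * v c * Φ a b c :=
          Finset.sum_congr rfl fun _ _ => Finset.sum_comm
      _ = _ := Finset.sum_congr rfl fun _ _ => Finset.sum_congr rfl fun _ _ =>
          Finset.sum_congr rfl fun _ _ => by ring
  rw [h1, h2]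
  simp only [← Finset.sum_add_distrib, ← mul_add, h, mul_zero, Finset.sum_const_zero]

variable {T : Fin 4 → Fin 4 → Fin 4 → Fin 4 → E4 → ℂ} {y : E4}

lemma hat₄_left (h : ∀ a b c d, T a b c d y = - T b a c d y) (i j k l : Fin 4) :
    hat₄ e T i j k l y = - hat₄ e T j i k l y := by
  refine hat₂_neg_swap e (fun a b => ?_) i j
  simp only [hat₂, ← Finset.sum_neg_distrib]
  exact Finset.sum_congr rfl fun _ _ => Finset.sum_congr rfl fun _ _ => by rw [h a b]; ring

lemma hat₄_right (h : ∀ a b c d, T a b c d y = - T a b d c y) (i j k l : Fin 4) :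
    hat₄ e T i j k l y = - hat₄ e T i j l k y := by
  simp only [hat₄]
  rw [hat₂, hat₂, ← Finset.sum_neg_distrib]
  refine Finset.sum_congr rfl fun a _ => ?_
  rw [← Finset.sum_neg_distrib]
  refine Finset.sum_congr rfl fun b _ => ?_
  rw [hat₂_neg_swap e (h a b) k l]; ring

lemma hat₄_pair (h : ∀ a b c d, T a b c d y = T c d a b y) (i j k l : Fin 4) :
    hat₄ e T i j k l y = hat₄ e T k l i j y := by
  rw [← hat₂_hat₂_comm, hat₄]
  simp only [hat₂]
  exact Finset.sum_congr rfl fun _ _ => Finset.sum_congr rfl fun _ _ => by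
    congr 1
    exact Finset.sum_congr rfl fun _ _ => Finset.sum_congr rfl fun _ _ => by rw [h]

lemma hat₄_bianchi (h : ∀ a b c d, T a b c d y + T a c d b y + T a d b c y = 0) (i j k l : Fin 4) :
    hat₄ e T i j k l y + hat₄ e T i k l j y + hat₄ e T i l j k y = 0 := by
  have h1 : ∀ j k l, hat₄ e T i j k l y =
      ∑ a, e i a y * ∑ b, ∑ c, ∑ d, e j b y * e k c y * e l d y * T a b c d y := by
    intro j k l
    simp only [hat₄_eq, Finset.mul_sum]
    exact Finset.sum_congr rfl fun _ _ => Finset.sum_congr rfl fun _ _ =>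
      Finset.sum_congr rfl fun _ _ => Finset.sum_congr rfl fun _ _ => by ring
  rw [h1, h1, h1, ← Finset.sum_add_distrib, ← Finset.sum_add_distrib]
  refine Finset.sum_eq_zero fun a _ => ?_
  rw [← mul_add, ← mul_add, sum_cyclic fun b c d => h a b c d, mul_zero]

/-- Grouping the outer and the inner indices of a 4-tensor. -/
lemma hat₂_hat₂_outer (T : Fin 4 → Fin 4 → Fin 4 → Fin 4 → E4 → ℂ) (i j k l : Fin 4) (y : E4) :
    hat₂ e (fun a d => hat₂ e (fun b c => T a b c d) j k) i l y = hat₄ e T i j k l y := by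
  rw [hat₄_eq]
  simp only [hat₂, Finset.mul_sum]
  calc _ = ∑ a, ∑ b, ∑ d, ∑ c, e i a y * e l d y * (e j b y * e k c y * T a b c d y) :=
        Finset.sum_congr rfl fun _ _ => Finset.sum_comm
    _ = ∑ a, ∑ b, ∑ c, ∑ d, e i a y * e l d y * (e j b y * e k c y * T a b c d y) :=
        Finset.sum_congr rfl fun _ _ => Finset.sum_congr rfl fun _ _ => Finset.sum_comm
    _ = _ := Finset.sum_congr rfl fun _ _ => Finset.sum_congr rfl fun _ _ =>
        Finset.sum_congr rfl fun _ _ => Finset.sum_congr rfl fun _ _ => by ring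

/-- Grouping the odd and the even indices of a 4-tensor. -/
lemma hat₂_hat₂_odd (T : Fin 4 → Fin 4 → Fin 4 → Fin 4 → E4 → ℂ) (i j k l : Fin 4) (y : E4) :
    hat₂ e (fun a c => hat₂ e (fun b d => T a b c d) j l) i k y = hat₄ e T i j k l y := by
  rw [hat₄_eq]
  simp only [hat₂, Finset.mul_sum]
  calc _ = ∑ a, ∑ b, ∑ c, ∑ d, e i a y * e k c y * (e j b y * e l d y * T a b c d y) :=
        Finset.sum_congr rfl fun _ _ => Finset.sum_comm
    _ = _ := Finset.sum_congr rfl fun _ _ => Finset.sum_congr rfl fun _ _ =>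
        Finset.sum_congr rfl fun _ _ => Finset.sum_congr rfl fun _ _ => by ring

lemma hat₂_trK (K : Fin 4 → Fin 4 → E4 → ℂ) (T : Fin 4 → Fin 4 → Fin 4 → Fin 4 → E4 → ℂ)
    (j l : Fin 4) (y : E4) : hat₂ e (fun b d => trK K (fun a c => T a b c d)) j l y =
      trK K (fun a c => hat₂ e (fun b d => T a b c d) j l) y := by
  simp only [hat₂, trK, Finset.mul_sum]
  calc _ = ∑ b, ∑ a, ∑ d, ∑ c, e j b y * e l d y * (K a c y * T a b c d y) :=
        Finset.sum_congr rfl fun _ _ => Finset.sum_comm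
    _ = ∑ a, ∑ b, ∑ d, ∑ c, e j b y * e l d y * (K a c y * T a b c d y) := Finset.sum_comm
    _ = ∑ a, ∑ b, ∑ c, ∑ d, e j b y * e l d y * (K a c y * T a b c d y) :=
        Finset.sum_congr rfl fun _ _ => Finset.sum_congr rfl fun _ _ => Finset.sum_comm
    _ = ∑ a, ∑ c, ∑ b, ∑ d, e j b y * e l d y * (K a c y * T a b c d y) :=
        Finset.sum_congr rfl fun _ _ => Finset.sum_comm
    _ = _ := Finset.sum_congr rfl fun _ _ => Finset.sum_congr rfl fun _ _ =>
        Finset.sum_congr rfl fun _ _ => Finset.sum_congr rfl fun _ _ => by ring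

/-- Both sides are the determinant of the rows i, j, k, l of `M`: the Levi-Civita symbol is the
determinant of unit vectors, and determinants are multiplicative. -/
lemma sum_det_levi (M : Fin 4 → Fin 4 → ℂ) (i j k l : Fin 4) :
    ∑ a, ∑ b, ∑ c, ∑ d, M i a * M j b * M k c * M l d * levi ℂ a b c d =
      (Matrix.of M).det * levi ℂ i j k l := by
  have h1 : ∑ a, ∑ b, ∑ c, ∑ d, M i a * M j b * M k c * M l d * levi ℂ a b c d =
      ∑ a, ∑ b, M i a * M j b * ∑ c, ∑ d, levi ℂ a b c d * (M k c * M l d) := by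
    simp only [Finset.mul_sum]
    exact Finset.sum_congr rfl fun _ _ => Finset.sum_congr rfl fun _ _ =>
        Finset.sum_congr rfl fun _ _ => Finset.sum_congr rfl fun _ _ => by ring
  rw [h1]
  simp only [sum_levi_mul]
  rw [← det_eq_sum_hodge (M i) (M j) (M k) (M l), ← det_single_eq_levi]
  have h3 : Matrix.of ![M i, M j, M k, M l] =
      Matrix.of ![Pi.single i 1, Pi.single j 1, Pi.single k 1, Pi.single l (1 : ℂ)] * Matrix.of M := by
    ext r c
    fin_cases r <;> simp [Matrix.mul_apply, Pi.single_apply]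
  rw [h3, Matrix.det_mul, mul_comm]

end HatSymmetries

/-! ### Determinants of matrices that are constant to first order -/

section JetLemmas

variable {E : Fin 4 → Fin 4 → ℂ} {p : E4}

lemma Jet.prod_const {ι : Type*} (t : Finset ι) {f : ι → E4 → ℂ} {v : ι → ℂ}
    (h : ∀ i, Jet E p (f i) (v i) (fun _ => 0)) :
    Jet E p (fun y => ∏ i ∈ t, f i y) (∏ i ∈ t, v i) (fun _ => 0) := by
  classical
  induction t using Finset.induction_on with
  | empty => simpa using Jet.const 1
  | insert a t ha ih =>
    simp only [Finset.prod_insert ha]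
    exact ((h a).mul ih).congr rfl fun k => by ring

/-- The determinant of a matrix that is constant to first order is constant to first order. -/
lemma Jet.det_const {f : Fin 4 → Fin 4 → E4 → ℂ} {v : Fin 4 → Fin 4 → ℂ}
    (h : ∀ i j, Jet E p (f i j) (v i j) (fun _ => 0)) :
    Jet E p (fun y => (Matrix.of fun i j => f i j y).det) (Matrix.of v).det (fun _ => 0) := by
  simp only [Matrix.det_apply', Matrix.of_apply]
  have h1 := Jet.sum fun σ : Equiv.Perm (Fin 4) =>
    (Jet.prod_const Finset.univ fun i => h (σ i) i).const_mul (((Equiv.Perm.sign σ : ℤ) : ℂ))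
  exact h1.congr rfl fun k => by simp

end JetLemmas

end MarsSimon

/-! ## Jets of the metric and of the volume form -/

namespace MarsSimon

/-- The components of the geometry of a vacuum space-time with a Killing vector field, in
coordinates around `p`, together with their first-order jets in a frame that is orthonormal and
parallel at `p`. -/
structure IsVacuumJet (Γ : Fin 4 → Fin 4 → Fin 4 → ℂ) (E : Fin 4 → Fin 4 → ℂ) (p : E4)
    (K G : Fin 4 → Fin 4 → E4 → ℂ) (H : Fin 4 → Fin 4 → Fin 4 → Fin 4 → E4 → ℂ)
    (F : Fin 4 → Fin 4 → E4 → ℂ) (W : Fin 4 → Fin 4 → Fin 4 → Fin 4 → E4 → ℂ)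
    (x ξ : Fin 4 → E4 → ℂ) (κ : ℂ) (F₀ : Fin 4 → Fin 4 → ℂ) (x₀ : Fin 4 → ℂ)
    (W₀ : Fin 4 → Fin 4 → Fin 4 → Fin 4 → ℂ)
    (dW₀ : Fin 4 → Fin 4 → Fin 4 → Fin 4 → Fin 4 → ℂ) : Prop where
  trace : IsFrameTrace Γ E p K
  symm (a b : Fin 4) (y : E4) : K a b y = K b a y
  diffG (a b : Fin 4) : DifferentiableAt ℝ (G a b) p
  diffH (a b c d : Fin 4) : DifferentiableAt ℝ (H a b c d) p
  diffF (a b : Fin 4) : DifferentiableAt ℝ (F a b) p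
  diffW (a b c d : Fin 4) : DifferentiableAt ℝ (W a b c d) p
  diffx (a : Fin 4) : DifferentiableAt ℝ (x a) p
  jetG (i j : Fin 4) : Jet E p (hat₂ (frame Γ E p) G i j) (if i = j then 1 else 0) (fun _ => 0)
  jetH (i j k l : Fin 4) :
    Jet E p (hat₄ (frame Γ E p) H i j k l) (κ * levi ℂ i j k l) (fun _ => 0)
  jetF (i j : Fin 4) :
    Jet E p (hat₂ (frame Γ E p) F i j) (F₀ i j) (fun k => ∑ d, x₀ d * W₀ d k i j)
  jetW (i j k l : Fin 4) :
    Jet E p (hat₄ (frame Γ E p) W i j k l) (W₀ i j k l) (fun m => dW₀ m i j k l)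
  jetx (i : Fin 4) : Jet E p (hat₁ (frame Γ E p) x i) (x₀ i) (fun k => F₀ k i)
  raise : ∀ᶠ y in nhds p, ∀ b, ξ b y = ∑ c, K b c y * x c y
  sq : κ * κ = -1
  antisymm (i j : Fin 4) : F₀ i j = - F₀ j i
  weyl : IsWeyl W₀
  weylDeriv (k : Fin 4) : IsWeyl (dW₀ k)
  div (b c d : Fin 4) : ∑ a, dW₀ a a b c d = 0

namespace IsMetricOn

variable {g : Fin 4 → Fin 4 → E4 → ℝ} {O : Set E4} (hg : IsMetricOn g O) {p : E4} (hp : p ∈ O)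
  {E : Fin 4 → Fin 4 → ℂ}
include hg

lemma trace_riemannLow {y : E4} (hy : y ∈ O) (b d : Fin 4) :
    ∑ a, ∑ c, ginv g a c y * riemannLow g a b c d y = ricci g b d y := by
  have h : ∀ c, ∑ a, ginv g a c y * riemannLow g a b c d y = riemann g c b c d y := by
    intro c
    have h1 : (gMat g y)⁻¹ * (gMat g y * riemannMat g c d y) = riemannMat g c d y := by
      rw [← Matrix.mul_assoc, hg.inv_mul_gMat hy, Matrix.one_mul]
    have h2 := congrFun (congrFun h1 c) b
    simp only [Matrix.mul_apply, Matrix.of_apply] at h2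
    rw [← h2]
    exact Finset.sum_congr rfl fun a _ => by rw [hg.ginv_symm a c]; rfl
  rw [Finset.sum_comm, ricci]
  exact Finset.sum_congr rfl fun c _ => h c

omit hg in
lemma weyl_eq_riemannLow {y : E4} (hvac : ∀ a b, ricci g a b y = 0) (a b c d : Fin 4) :
    weyl g a b c d y = riemannLow g a b c d y := by
  simp [weyl, scalarCurvature, hvac]

include hp

/-- The connection coefficients at `p`. -/
abbrev _root_.MarsSimon.connection (g : Fin 4 → Fin 4 → E4 → ℝ) (p : E4) :
    Fin 4 → Fin 4 → Fin 4 → ℂ :=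
  fun a b c => ((christoffel g a b c p : ℝ) : ℂ)

/-- Completeness of the frame: E g Eᵀ = 1 gives g⁻¹ = Eᵀ E. The condition on derivatives says that
g⁻¹ is parallel. -/
lemma isFrameTrace (hE : ∀ i j, ∑ a, ∑ b, E i a * E j b * ((g a b p : ℝ) : ℂ) = if i = j then 1 else 0) :
    IsFrameTrace (connection g p) E p (fun a b y => ((ginv g a b y : ℝ) : ℂ)) where
  diff a b := differentiableAt_ofReal (differentiableAt_of_smooth (hg.smooth_ginv a b) hg.isOpen hp)
  val a b := by
    have h1 : Matrix.of E * ((gMat g p).map Complex.ofReal * (Matrix.of E).transpose) = 1 := by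
      ext i j
      rw [Matrix.one_apply, ← hE i j]
      simp only [Matrix.mul_apply, Matrix.of_apply, Matrix.transpose_apply, Matrix.map_apply,
        Finset.mul_sum]
      exact Finset.sum_congr rfl fun _ _ => Finset.sum_congr rfl fun _ _ => by ring
    have h2 : (gMat g p).map Complex.ofReal * ((Matrix.of E).transpose * Matrix.of E) = 1 := by
      rw [← Matrix.mul_assoc]; exact mul_eq_one_comm.1 h1
    have h3 : ((gMat g p)⁻¹).map Complex.ofReal * (gMat g p).map Complex.ofReal = 1 := by
      have := congrArg (fun M : Matrix (Fin 4) (Fin 4) ℝ => M.map Complex.ofRealHom)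
        (hg.inv_mul_gMat hp)
      simp only [Matrix.map_mul] at this
      exact this.trans (Matrix.map_one _ (map_zero _) (map_one _))
    have h4 : ((gMat g p)⁻¹).map Complex.ofReal = (Matrix.of E).transpose * Matrix.of E :=
      left_inv_eq_right_inv h3 h2
    exact congrFun (congrFun h4 a) b
  deriv c a b := by
    rw [pd_ofReal c (differentiableAt_of_smooth (hg.smooth_ginv a b) hg.isOpen hp),
      hg.pd_ginv hp]
    push_cast
    rfl

omit hg hp in
lemma jet_hat₂_ofReal {T : Fin 4 → Fin 4 → E4 → ℝ} (hT : ∀ a b, DifferentiableAt ℝ (T a b) p)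
    (i j : Fin 4) : Jet E p (hat₂ (frame (connection g p) E p) (fun a b y => ((T a b y : ℝ) : ℂ)) i j)
      (∑ a, ∑ b, E i a * E j b * ((T a b p : ℝ) : ℂ))
      (fun k => ∑ c, E k c * ∑ a, ∑ b, E i a * E j b * ((covD₂ g T c a b p : ℝ) : ℂ)) := by
  refine ⟨differentiableAt_hat₂ (fun a b => differentiableAt_ofReal (hT a b)) i j,
    hat₂_self _ i j, fun k => Finset.sum_congr rfl fun c _ => ?_⟩
  rw [pd_hat₂ fun a b => differentiableAt_ofReal (hT a b)]
  simp only [pd_ofReal c (hT _ _), covD₂]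
  push_cast
  rfl

omit hg hp in
lemma jet_hat₄_ofReal {T : Fin 4 → Fin 4 → Fin 4 → Fin 4 → E4 → ℝ}
    (hT : ∀ a b c d, DifferentiableAt ℝ (T a b c d) p) (i j k l : Fin 4) :
    Jet E p (hat₄ (frame (connection g p) E p) (fun a b c d y => ((T a b c d y : ℝ) : ℂ)) i j k l)
      (∑ a, ∑ b, ∑ c, ∑ d, E i a * E j b * E k c * E l d * ((T a b c d p : ℝ) : ℂ))
      (fun m => ∑ e, E m e * ∑ a, ∑ b, ∑ c, ∑ d, E i a * E j b * E k c * E l d *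
        ((covD₄ g T e a b c d p : ℝ) : ℂ)) := by
  have hd : ∀ a b, DifferentiableAt ℝ (hat₂ (frame (connection g p) E p)
      (fun c d y => ((T a b c d y : ℝ) : ℂ)) k l) p := fun a b =>
    differentiableAt_hat₂ (fun c d => differentiableAt_ofReal (hT a b c d)) k l
  refine ⟨differentiableAt_hat₂ hd i j, ?_, fun m => Finset.sum_congr rfl fun e _ => ?_⟩
  · rw [hat₄_eq]; simp only [frame_self]
  · unfold hat₄
    rw [pd_hat₂ hd]
    congr 1
    refine Finset.sum_congr rfl fun a _ => Finset.sum_congr rfl fun b _ => ?_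
    rw [pd_hat₂ fun c d => differentiableAt_ofReal (hT a b c d)]
    simp only [pd_ofReal e (hT _ _ _ _), covD₄, hat₂_self]
    have h1 : ∀ q : Fin 4 → Fin 4 → Fin 4 → ℂ, ∀ r : Fin 4 → ℂ,
        ∑ m, r m * ∑ c, ∑ d, E k c * E l d * q m c d =
        ∑ c, ∑ d, E k c * E l d * ∑ m, r m * q m c d := by
      intro q r
      simp only [Finset.mul_sum]
      calc _ = ∑ c, ∑ m, ∑ d, r m * (E k c * E l d * q m c d) := Finset.sum_comm
        _ = ∑ c, ∑ d, ∑ m, r m * (E k c * E l d * q m c d) :=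
            Finset.sum_congr rfl fun _ _ => Finset.sum_comm
        _ = _ := Finset.sum_congr rfl fun _ _ => Finset.sum_congr rfl fun _ _ =>
            Finset.sum_congr rfl fun _ _ => by ring
    have h2 : ∀ q : Fin 4 → Fin 4 → ℂ, ∑ c, ∑ d, E i a * E j b * E k c * E l d * q c d =
        E i a * E j b * ∑ c, ∑ d, E k c * E l d * q c d := by
      intro q
      simp only [Finset.mul_sum]
      exact Finset.sum_congr rfl fun _ _ => Finset.sum_congr rfl fun _ _ => by ring
    rw [h2]
    congr 1
    simp only [Finset.sum_add_distrib, h1]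
    simp only [← Finset.sum_sub_distrib, ← Finset.sum_add_distrib, ← mul_sub, ← mul_add]
    refine Finset.sum_congr rfl fun c _ => Finset.sum_congr rfl fun d _ => ?_
    push_cast
    simp only [Finset.sum_add_distrib]
    ring

/-- The metric has constant components to first order. -/
lemma jet_metric (hE : ∀ i j, ∑ a, ∑ b, E i a * E j b * ((g a b p : ℝ) : ℂ) = if i = j then 1 else 0)
    (i j : Fin 4) : Jet E p
      (hat₂ (frame (connection g p) E p) (fun a b y => ((g a b y : ℝ) : ℂ)) i j)
      (if i = j then 1 else 0) (fun _ => 0) := by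
  refine (jet_hat₂_ofReal (fun a b => hg.differentiableAt hp a b) i j).congr (hE i j) fun k => ?_
  have : ∀ c a b, covD₂ g g c a b p = 0 := fun c a b => by
    rw [covD₂, hg.pd_metric hp, sub_self]
  simp [this]

/-- The volume form has constant components to first order. -/
lemma jet_volume (hE : ∀ i j, ∑ a, ∑ b, E i a * E j b * ((g a b p : ℝ) : ℂ) = if i = j then 1 else 0)
    {η : Fin 4 → Fin 4 → Fin 4 → Fin 4 → E4 → ℝ}
    (hη : ∀ a b c d y, η a b c d y = η 0 1 2 3 y * levi ℝ a b c d)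
    (hd : DifferentiableAt ℝ (η 0 1 2 3) p) (hsq : ∀ y ∈ O, (η 0 1 2 3 y) ^ 2 = - (gMat g y).det) :
    ∃ κ : ℂ, κ * κ = -1 ∧ ∀ i j k l,
      Jet E p (hat₄ (frame (connection g p) E p) (fun a b c d y => ((η a b c d y : ℝ) : ℂ)) i j k l)
        (κ * levi ℂ i j k l) (fun _ => 0) := by
  set e := frame (connection g p) E p with he
  set h : E4 → ℂ := fun y => ((η 0 1 2 3 y : ℝ) : ℂ) * (Matrix.of fun i j => e i j y).det with hh
  have h4 : ∀ i j k l, hat₄ e (fun a b c d y => ((η a b c d y : ℝ) : ℂ)) i j k l =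
      fun y => levi ℂ i j k l * h y := by
    intro i j k l
    funext y
    rw [hat₄_eq]
    have := sum_det_levi (fun i j => e i j y) i j k l
    calc _ = ((η 0 1 2 3 y : ℝ) : ℂ) * ∑ a, ∑ b, ∑ c, ∑ d,
          e i a y * e j b y * e k c y * e l d y * levi ℂ a b c d := by
          simp only [Finset.mul_sum]
          refine Finset.sum_congr rfl fun _ _ => Finset.sum_congr rfl fun _ _ =>
            Finset.sum_congr rfl fun _ _ => Finset.sum_congr rfl fun _ _ => ?_
          rw [hη, levi_map Complex.ofRealHom]
          push_cast
          simp only [Complex.ofRealHom_eq_coe]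
          ring
      _ = _ := by rw [this, hh]; ring
  -- Minus h² is the Gram determinant of the frame, which equals 1 to first order. Hence h(p)² = -1
  -- and 2h dh = 0 at `p`, so the derivative of `h` vanishes in all frame directions.
  have hsq' : ∀ᶠ y in nhds p, h y * h y =
      (-1) * (Matrix.of fun i j => hat₂ e (fun a b y => ((g a b y : ℝ) : ℂ)) i j y).det := by
    filter_upwards [hg.isOpen.mem_nhds hp] with y hy
    have e1 : (Matrix.of fun i j => hat₂ e (fun a b y => ((g a b y : ℝ) : ℂ)) i j y) =
        (Matrix.of fun i j => e i j y) * ((gMat g y).map Complex.ofRealHom *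
          (Matrix.of fun i j => e i j y).transpose) := by
      ext i j
      simp only [hat₂, Matrix.mul_apply, Matrix.of_apply, Matrix.transpose_apply, Matrix.map_apply,
        Finset.mul_sum, Complex.ofRealHom_eq_coe]
      exact Finset.sum_congr rfl fun _ _ => Finset.sum_congr rfl fun _ _ => by ring
    have e2 : ((η 0 1 2 3 y : ℝ) : ℂ) ^ 2 = - (((gMat g y).det : ℝ) : ℂ) := by
      rw [← Complex.ofReal_pow, hsq y hy]; push_cast; rfl
    have e3 : ((gMat g y).map Complex.ofRealHom).det = (((gMat g y).det : ℝ) : ℂ) :=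
      (RingHom.map_det Complex.ofRealHom (gMat g y)).symm
    rw [e1, Matrix.det_mul, Matrix.det_mul, Matrix.det_transpose, hh, e3]
    linear_combination (Matrix.of fun i j => e i j y).det ^ 2 * e2
  have hdet := (Jet.det_const fun i j => hg.jet_metric hp hE i j).const_mul (-1)
  have h1 : (Matrix.of fun i j : Fin 4 => if i = j then (1 : ℂ) else 0).det = 1 := by
    have : (Matrix.of fun i j : Fin 4 => if i = j then (1 : ℂ) else 0) = 1 := by
      ext i j; rw [Matrix.one_apply]; rfl
    rw [this, Matrix.det_one]
  rw [h1] at hdet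
  have hjet := hdet.congr_fun hsq'
  have hdh : DifferentiableAt ℝ h p := by
    have hde : ∀ i j, DifferentiableAt ℝ (e i j) p := fun i j => differentiableAt_frame i j
    refine (differentiableAt_ofReal hd).fun_mul ?_
    simp only [Matrix.det_apply', Matrix.of_apply]
    exact DifferentiableAt.fun_sum fun σ _ => (differentiableAt_const _).fun_mul
      (HasFDerivAt.finsetProd fun i _ => (hde (σ i) i).hasFDerivAt).differentiableAt
  have hJ := Jet.of_differentiableAt (E := E) hdh
  have hv : h p * h p = -1 := by rw [hjet.val]; ring
  have hne : h p ≠ 0 := by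
    intro h0; rw [h0] at hv; norm_num at hv
  refine ⟨h p, hv, fun i j k l => ?_⟩
  rw [h4]
  refine (hJ.const_mul (levi ℂ i j k l)).congr (mul_comm _ _) fun m => ?_
  have h2 := (hJ.mul hJ).deriv_unique hjet m
  have h3 : ∑ a, E m a * pd a h p = 0 := by
    have : (2 * h p) * ∑ a, E m a * pd a h p = 0 := by linear_combination h2
    exact (mul_eq_zero.1 this).resolve_left (mul_ne_zero two_ne_zero hne)
  rw [h3, mul_zero]

end IsMetricOn

end MarsSimon

/-! ## Jets of a vacuum metric with a Killing field -/

namespace MarsSimon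

namespace IsMetricOn

variable {g : Fin 4 → Fin 4 → E4 → ℝ} {O : Set E4} (hg : IsMetricOn g O) {p : E4} (hp : p ∈ O)
  {E : Fin 4 → Fin 4 → ℂ}
  (hE : ∀ i j, ∑ a, ∑ b, E i a * E j b * ((g a b p : ℝ) : ℂ) = if i = j then 1 else 0)
include hg hp

/-- The Riemann tensor at `p`, in the frame `E`. -/
abbrev _root_.MarsSimon.curv (g : Fin 4 → Fin 4 → E4 → ℝ) (p : E4) (E : Fin 4 → Fin 4 → ℂ)
    (i j k l : Fin 4) : ℂ :=
  ∑ a, ∑ b, ∑ c, ∑ d, E i a * E j b * E k c * E l d * ((riemannLow g a b c d p : ℝ) : ℂ)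

/-- The covariant derivative of the Riemann tensor at `p`, in the frame `E`. -/
abbrev _root_.MarsSimon.curvDeriv (g : Fin 4 → Fin 4 → E4 → ℝ) (p : E4) (E : Fin 4 → Fin 4 → ℂ)
    (m i j k l : Fin 4) : ℂ :=
  ∑ e, E m e * ∑ a, ∑ b, ∑ c, ∑ d, E i a * E j b * E k c * E l d *
    ((covD₄ g (riemannLow g) e a b c d p : ℝ) : ℂ)

lemma jet_curv (i j k l : Fin 4) : Jet E p
    (hat₄ (frame (connection g p) E p) (fun a b c d y => ((riemannLow g a b c d y : ℝ) : ℂ)) i j k l)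
    (curv g p E i j k l) (fun m => curvDeriv g p E m i j k l) :=
  jet_hat₄_ofReal (fun a b c d => differentiableAt_of_smooth (hg.smooth_riemannLow a b c d)
    hg.isOpen hp) i j k l

include hE in
-- Ricci-flatness holds in a neighbourhood, so the trace of the curvature vanishes there as a
-- function, and its derivative vanishes with it.
lemma trace_curv (hvac : ∀ y ∈ O, ∀ a b, ricci g a b y = 0) (j l : Fin 4) :
    ∑ i, curv g p E i j i l = 0 ∧ ∀ m, ∑ i, curvDeriv g p E m i j i l = 0 := by
  have hK := hg.isFrameTrace hp hE
  set e := frame (connection g p) E p with he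
  set R : Fin 4 → Fin 4 → Fin 4 → Fin 4 → E4 → ℂ :=
    fun a b c d y => ((riemannLow g a b c d y : ℝ) : ℂ) with hR
  set K : Fin 4 → Fin 4 → E4 → ℂ := fun a b y => ((ginv g a b y : ℝ) : ℂ) with hKdef
  have hd : ∀ a b c d, DifferentiableAt ℝ (R a b c d) p := fun a b c d =>
    differentiableAt_ofReal (differentiableAt_of_smooth (hg.smooth_riemannLow a b c d) hg.isOpen hp)
  have h1 := jet_trK hK (T := fun a c => hat₂ e (fun b d => R a b c d) j l)
    (fun a c => differentiableAt_hat₂ (fun b d => hd a b c d) j l)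
    (v := fun i => curv g p E i j i l) (d := fun i m => curvDeriv g p E m i j i l) (fun i => by
      have : hat₂ e (fun a c => hat₂ e (fun b d => R a b c d) j l) i i = hat₄ e R i j i l := by
        funext y; exact hat₂_hat₂_odd e R i j i l y
      rw [this]; exact hg.jet_curv hp i j i l)
  have h0 : trK K (fun a c => hat₂ e (fun b d => R a b c d) j l) =ᶠ[nhds p] fun _ => 0 := by
    filter_upwards [hg.isOpen.mem_nhds hp] with y hy
    rw [← hat₂_trK e K R]
    have : ∀ b d, trK K (fun a c => R a b c d) y = 0 := by
      intro b d
      have := hg.trace_riemannLow hy b d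
      rw [hvac y hy] at this
      simp only [trK, hKdef, hR]
      exact_mod_cast this
    simp only [hat₂, this, mul_zero, Finset.sum_const_zero]
  have h2 := (Jet.const (E := E) (p := p) 0).congr_fun h0
  exact ⟨h1.val.symm.trans h2.val, fun m => h1.deriv_unique h2 m⟩

include hE in
-- The algebraic identities of the curvature hold on all of `O`; comparing values and derivatives at
-- `p` gives them for R and ∇R together.
lemma isWeyl_curv (hvac : ∀ y ∈ O, ∀ a b, ricci g a b y = 0) :
    IsWeyl (curv g p E) ∧ ∀ m, IsWeyl (curvDeriv g p E m) := by
  have J := fun i j k l => hg.jet_curv hp (E := E) i j k l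
  set e := frame (connection g p) E p with he
  set R : Fin 4 → Fin 4 → Fin 4 → Fin 4 → E4 → ℂ :=
    fun a b c d y => ((riemannLow g a b c d y : ℝ) : ℂ) with hR
  have hO := hg.isOpen.mem_nhds hp
  have L := fun i j k l => ((J j i k l).const_mul (-1)).congr_fun (f' := hat₄ e R i j k l) (by
    filter_upwards [hO] with y hy
    rw [hat₄_left e (fun a b c d => by
      simp only [hR]; rw [hg.riemannLow_antisymm_left hy a b]; push_cast; rfl)]
    ring)
  have Rt := fun i j k l => ((J i j l k).const_mul (-1)).congr_fun (f' := hat₄ e R i j k l) (by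
    filter_upwards [hO] with y hy
    rw [hat₄_right e (fun a b c d => by
      simp only [hR]; rw [riemannLow_antisymm_right g a b c]; push_cast; rfl)]
    ring)
  have P := fun i j k l => (J k l i j).congr_fun (f' := hat₄ e R i j k l) (by
    filter_upwards [hO] with y hy
    exact hat₄_pair e (fun a b c d => by
      simp only [hR]; rw [hg.riemannLow_pair_symm hy a b]) i j k l)
  have B := fun i j k l => (((J i j k l).add (J i k l j)).add (J i l j k)).congr_fun
    (f' := fun _ => 0) (by
    filter_upwards [hO] with y hy
    exact (hat₄_bianchi e (fun a b c d => by
      simp only [hR]; exact_mod_cast hg.riemannLow_bianchi a b c d y) i j k l).symm)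
  have T := fun j l => hg.trace_curv hp hE hvac j l
  refine ⟨⟨fun i j k l => ?_, fun i j k l => ?_, fun i j k l => ?_, fun i j k l => ?_,
    fun j l => (T j l).1⟩, fun m => ⟨fun i j k l => ?_, fun i j k l => ?_, fun i j k l => ?_,
    fun i j k l => ?_, fun j l => (T j l).2 m⟩⟩
  · rw [← (J i j k l).val, (L i j k l).val]; ring
  · rw [← (J i j k l).val, (Rt i j k l).val]; ring
  · rw [← (J i j k l).val, (P i j k l).val]
  · exact (B i j k l).val.symm
  · rw [(J i j k l).deriv_unique (L i j k l) m]; ring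
  · rw [(J i j k l).deriv_unique (Rt i j k l) m]; ring
  · exact (J i j k l).deriv_unique (P i j k l) m
  · exact (B i j k l).deriv_unique (Jet.const 0) m

lemma curvDeriv_bianchi (m i j k l : Fin 4) : curvDeriv g p E m i j k l
    + curvDeriv g p E k i j l m + curvDeriv g p E l i j m k = 0 := by
  have h1 : ∀ m k l, curvDeriv g p E m i j k l = ∑ a, ∑ b, E i a * E j b *
      ∑ e, ∑ c, ∑ d, E m e * E k c * E l d * ((covD₄ g (riemannLow g) e a b c d p : ℝ) : ℂ) := by
    intro m k l
    simp only [curvDeriv, Finset.mul_sum]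
    calc _ = ∑ a, ∑ e, ∑ b, ∑ c, ∑ d, E m e * (E i a * E j b * E k c * E l d *
            ((covD₄ g (riemannLow g) e a b c d p : ℝ) : ℂ)) := Finset.sum_comm
      _ = ∑ a, ∑ b, ∑ e, ∑ c, ∑ d, E m e * (E i a * E j b * E k c * E l d *
            ((covD₄ g (riemannLow g) e a b c d p : ℝ) : ℂ)) :=
          Finset.sum_congr rfl fun _ _ => Finset.sum_comm
      _ = _ := Finset.sum_congr rfl fun _ _ => Finset.sum_congr rfl fun _ _ =>
          Finset.sum_congr rfl fun _ _ => Finset.sum_congr rfl fun _ _ =>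
            Finset.sum_congr rfl fun _ _ => by ring
  rw [h1, h1, h1]
  simp only [← Finset.sum_add_distrib, ← mul_add]
  refine Finset.sum_eq_zero fun a _ => Finset.sum_eq_zero fun b _ => ?_
  simp only [Finset.sum_add_distrib]
  rw [sum_cyclic (Φ := fun e c d => ((covD₄ g (riemannLow g) e a b c d p : ℝ) : ℂ)), mul_zero]
  intro e c d
  exact_mod_cast hg.covD₄_riemannLow_bianchi hp e a b c d

include hE in
/-- The contracted Bianchi identity. -/
lemma div_curv (hvac : ∀ y ∈ O, ∀ a b, ricci g a b y = 0) (b c d : Fin 4) :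
    ∑ a, curvDeriv g p E a a b c d = 0 := by
  have hW := (hg.isWeyl_curv hp hE hvac).2
  -- The second Bianchi identity solved for the divergence; after summation over `a` both terms on
  -- the right are traces of ∇R.
  have h1 : ∀ a, curvDeriv g p E a a b c d =
      curvDeriv g p E c a b a d - curvDeriv g p E d a b a c := by
    intro a
    linear_combination hg.curvDeriv_bianchi hp a a b c d - (hW c).right a b d a
  simp only [h1, Finset.sum_sub_distrib, (hW _).trace, sub_zero]

include hE in
-- Collects everything the pointwise argument takes from the geometry. The Weyl tensor agrees with
-- the Riemann tensor on all of `O`, so its covariant derivative is that of the curvature.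
theorem isVacuumJet (hvac : ∀ y ∈ O, ∀ a b, ricci g a b y = 0)
    {ξ : Fin 4 → E4 → ℝ} (hξ : ∀ a, ContDiffOn ℝ ∞ (ξ a) O)
    (hk : ∀ z ∈ O, ∀ a b, killingForm g ξ a b z + killingForm g ξ b a z = 0)
    {η : Fin 4 → Fin 4 → Fin 4 → Fin 4 → E4 → ℝ}
    (hη : ∀ a b c d y, η a b c d y = η 0 1 2 3 y * levi ℝ a b c d)
    (hd : DifferentiableAt ℝ (η 0 1 2 3) p) (hsq : ∀ y ∈ O, (η 0 1 2 3 y) ^ 2 = - (gMat g y).det) :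
    ∃ κ F₀ x₀ W₀ dW₀, IsVacuumJet (connection g p) E p (fun a b y => ((ginv g a b y : ℝ) : ℂ))
      (fun a b y => ((g a b y : ℝ) : ℂ)) (fun a b c d y => ((η a b c d y : ℝ) : ℂ))
      (fun a b y => ((killingForm g ξ a b y : ℝ) : ℂ))
      (fun a b c d y => ((weyl g a b c d y : ℝ) : ℂ))
      (fun a y => ((lower g ξ a y : ℝ) : ℂ)) (fun a y => ((ξ a y : ℝ) : ℂ)) κ F₀ x₀ W₀ dW₀ := by
  obtain ⟨κ, hκ, hjet⟩ := hg.jet_volume hp hE hη hd hsq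
  have hxs : ∀ a, ContDiffOn ℝ ∞ (lower g ξ a) O := fun a => by
    unfold lower; exact ContDiffOn.sum fun b _ => (hg.smooth a b).mul (hξ b)
  have hxd := fun a => differentiableAt_of_smooth (hxs a) hg.isOpen hp
  have hFs : ∀ a b, ContDiffOn ℝ ∞ (killingForm g ξ a b) O := fun a b => by
    unfold killingForm
    exact (smooth_pd (hxs b) hg.isOpen a).sub
      (ContDiffOn.sum fun l _ => (hg.smooth_christoffel l a b).mul (hxs l))
  have hFd := fun a b => differentiableAt_of_smooth (hFs a b) hg.isOpen hp
  have hW := hg.isWeyl_curv hp hE hvac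
  have hO := hg.isOpen.mem_nhds hp
  have hweyl : ∀ y ∈ O, ∀ a b c d, weyl g a b c d y = riemannLow g a b c d y :=
    fun y hy => weyl_eq_riemannLow (hvac y hy)
  have hraise : ∀ y ∈ O, ∀ b, ξ b y = ∑ c, ginv g b c y * lower g ξ c y := by
    intro y hy b
    have h1 : (gMat g y)⁻¹.mulVec ((gMat g y).mulVec fun d => ξ d y) = fun d => ξ d y := by
      rw [Matrix.mulVec_mulVec, hg.inv_mul_gMat hy, Matrix.one_mulVec]
    exact (congrFun h1 b).symm
  have hη' : ∀ a b c d, η a b c d = fun y => η 0 1 2 3 y * levi ℝ a b c d := fun a b c d => by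
    funext y; exact hη a b c d y
  have hK := hg.isFrameTrace hp hE
  refine ⟨κ, fun i j => ∑ a, ∑ b, E i a * E j b * ((killingForm g ξ a b p : ℝ) : ℂ),
    fun i => ∑ a, E i a * ((lower g ξ a p : ℝ) : ℂ), curv g p E, curvDeriv g p E,
    { trace := hK
      symm := fun a b y => by rw [hg.ginv_symm]
      diffG := fun a b => differentiableAt_ofReal (hg.differentiableAt hp a b)
      diffH := fun a b c d => differentiableAt_ofReal (by
        rw [hη']; exact hd.mul_const _)
      diffF := fun a b => differentiableAt_ofReal (hFd a b)
      diffW := fun a b c d => differentiableAt_ofReal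
        ((differentiableAt_of_smooth (hg.smooth_riemannLow a b c d) hg.isOpen hp).congr_of_eventuallyEq
          (by filter_upwards [hO] with y hy using hweyl y hy a b c d))
      diffx := fun a => differentiableAt_ofReal (hxd a)
      jetG := hg.jet_metric hp hE
      jetH := hjet
      jetF := fun i j => ?_
      jetW := fun i j k l => (hg.jet_curv hp i j k l).congr_fun (by
        filter_upwards [hO] with y hy
        simp only [hat₄_eq, hweyl y hy])
      jetx := fun i => ?_
      raise := by
        filter_upwards [hO] with y hy b
        exact_mod_cast hraise y hy b
      sq := hκ
      antisymm := fun i j => ?_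
      weyl := hW.1
      weylDeriv := hW.2
      div := hg.div_curv hp hE hvac }⟩
  · refine (jet_hat₂_ofReal hFd i j).congr rfl fun k => ?_
    simp only [hg.covD₂_killingForm hp hξ hk]
    set V : Fin 4 → ℂ := fun q => ∑ c, E k c * ∑ a, ∑ b, E i a * E j b *
      ((riemannLow g q c a b p : ℝ) : ℂ) with hV
    have e1 : ∑ c, E k c * ∑ a, ∑ b, E i a * E j b *
        ((∑ q, ξ q p * riemannLow g q c a b p : ℝ) : ℂ) = ∑ q, ((ξ q p : ℝ) : ℂ) * V q := by
      simp only [hV]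
      push_cast
      simp only [Finset.mul_sum]
      calc _ = ∑ c, ∑ a, ∑ q, ∑ b, E k c * (E i a * E j b * (((ξ q p : ℝ) : ℂ) *
              ((riemannLow g q c a b p : ℝ) : ℂ))) := Finset.sum_congr rfl fun _ _ =>
              Finset.sum_congr rfl fun _ _ => Finset.sum_comm
        _ = ∑ c, ∑ q, ∑ a, ∑ b, E k c * (E i a * E j b * (((ξ q p : ℝ) : ℂ) *
              ((riemannLow g q c a b p : ℝ) : ℂ))) := Finset.sum_congr rfl fun _ _ =>
              Finset.sum_comm
        _ = ∑ q, ∑ c, ∑ a, ∑ b, E k c * (E i a * E j b * (((ξ q p : ℝ) : ℂ) *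
              ((riemannLow g q c a b p : ℝ) : ℂ))) := Finset.sum_comm
        _ = _ := Finset.sum_congr rfl fun _ _ => Finset.sum_congr rfl fun _ _ =>
            Finset.sum_congr rfl fun _ _ => Finset.sum_congr rfl fun _ _ => by ring
    -- Raising the index of ξ and writing g⁻¹ as the sum of E_d ⊗ E_d turns the contraction of ξ
    -- with the curvature into a contraction of frame components.
    have e2 : ∀ q, ((ξ q p : ℝ) : ℂ) = ∑ r, ((ginv g q r p : ℝ) : ℂ) * ((lower g ξ r p : ℝ) : ℂ) := by
      intro q
      rw [hraise p hp q]; push_cast; rfl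
    have e3 : ∀ d, curv g p E d k i j = ∑ q, E d q * V q := by
      intro d
      simp only [hV, curv, Finset.mul_sum]
      exact Finset.sum_congr rfl fun _ _ => Finset.sum_congr rfl fun _ _ =>
        Finset.sum_congr rfl fun _ _ => Finset.sum_congr rfl fun _ _ => by ring
    rw [e1]
    calc _ = ∑ q, ∑ r, ((ginv g q r p : ℝ) : ℂ) * (((lower g ξ r p : ℝ) : ℂ) * V q) := by
          refine Finset.sum_congr rfl fun q _ => ?_
          rw [e2, Finset.sum_mul]
          exact Finset.sum_congr rfl fun _ _ => by ring
      _ = ∑ d, ∑ q, ∑ r, E d q * E d r * (((lower g ξ r p : ℝ) : ℂ) * V q) :=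
          hK.sum_eq fun q r => ((lower g ξ r p : ℝ) : ℂ) * V q
      _ = _ := by
          refine Finset.sum_congr rfl fun d _ => ?_
          rw [e3, Finset.sum_mul_sum, Finset.sum_comm]
          exact Finset.sum_congr rfl fun _ _ => Finset.sum_congr rfl fun _ _ => by ring
  · refine ⟨differentiableAt_hat₁ (fun a => differentiableAt_ofReal (hxd a)) i, hat₁_self _ i,
      fun k => ?_⟩
    simp only [pd_hat₁ fun a => differentiableAt_ofReal (hxd a), Finset.mul_sum]
    refine Finset.sum_congr rfl fun c _ => Finset.sum_congr rfl fun a _ => ?_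
    rw [pd_ofReal c (hxd a), killingForm]
    push_cast
    ring
  · rw [← Finset.sum_neg_distrib, Finset.sum_comm]
    refine Finset.sum_congr rfl fun a _ => ?_
    rw [← Finset.sum_neg_distrib]
    refine Finset.sum_congr rfl fun b _ => ?_
    have : killingForm g ξ b a p = - killingForm g ξ a b p := by linarith [hk p hp a b]
    rw [this]; push_cast; ring

end IsMetricOn

end MarsSimon

/-! ## Jets of the Mars–Simon tensor -/

namespace MarsSimon

section Fields

variable (K G : Fin 4 → Fin 4 → E4 → ℂ) (H : Fin 4 → Fin 4 → Fin 4 → Fin 4 → E4 → ℂ)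
  (F : Fin 4 → Fin 4 → E4 → ℂ) (W : Fin 4 → Fin 4 → Fin 4 → Fin 4 → E4 → ℂ) (x : Fin 4 → E4 → ℂ)

/-- The (anti-)self-dual part of a 2-form. -/
def sdForm (j : ℂ) (a b : Fin 4) (y : E4) : ℂ := F a b y + j / 2 * contr₂ K F (H a b) y

/-- The (anti-)self-dual part of a Weyl tensor. -/
def sdCurv (j : ℂ) (a b c d : Fin 4) (y : E4) : ℂ :=
  W a b c d y + j / 2 * contr₂ K (W a b) (H c d) y

/-- The metric on (anti-)self-dual 2-forms. -/
def sdMet (j : ℂ) (a b c d : Fin 4) (y : E4) : ℂ :=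
  1 / 4 * (j * H a b c d y + (G a c y * G b d y - G a d y * G c b y))

/-- The Mars–Simon tensor, for the reciprocal `t` of the Ernst potential. -/
def msField (j : ℂ) (t : E4 → ℂ) (a b c d : Fin 4) (y : E4) : ℂ :=
  sdCurv K H W j a b c d y + 6 * t y * (sdForm K H F j a b y * sdForm K H F j c d y
    - contr₂ K (sdForm K H F j) (sdForm K H F j) y / 3 * sdMet G H j a b c d y)

/-- The contraction of the outer indices of `Y` with `x`. -/
def electricField (Y : Fin 4 → Fin 4 → Fin 4 → Fin 4 → E4 → ℂ) (m n : Fin 4) (y : E4) : ℂ :=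
  contr₂ K (fun c d y => x c y * x d y) (fun c d => Y c m n d) y

/-- The 1-form obtained by contracting the superenergy tensor of `S` and `Y` with `x`. -/
def superCurrent (S Y : Fin 4 → Fin 4 → Fin 4 → Fin 4 → E4 → ℂ) (a : Fin 4) (y : E4) : ℂ :=
  trK K (fun b c y => contr₂ K (electricField K x Y) (fun k l => S a k l b) y * x c y) y

end Fields

/-! ### Frame components of products, and contractions with the Levi-Civita symbol -/

section HatProducts

variable (e : Fin 4 → Fin 4 → E4 → ℂ)

lemma hat₂_transpose (T : Fin 4 → Fin 4 → E4 → ℂ) (i j : Fin 4) (y : E4) :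
    hat₂ e (fun a b => T b a) i j y = hat₂ e T j i y := by
  simp only [hat₂]
  rw [Finset.sum_comm]
  exact Finset.sum_congr rfl fun _ _ => Finset.sum_congr rfl fun _ _ => by ring

lemma hat₄_mul (S T : Fin 4 → Fin 4 → E4 → ℂ) (i j k l : Fin 4) (y : E4) :
    hat₄ e (fun a b c d y => S a b y * T c d y) i j k l y = hat₂ e S i j y * hat₂ e T k l y := by
  have h1 : ∀ a b, hat₂ e (fun c d y => S a b y * T c d y) k l =
      fun y => hat₂ e T k l y * S a b y := by
    intro a b; funext y; rw [hat₂_smul, mul_comm]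
  simp only [hat₄, h1]
  rw [hat₂_smul e (fun y => hat₂ e T k l y) S, mul_comm]

lemma hat₄_mul_odd (S T : Fin 4 → Fin 4 → E4 → ℂ) (i j k l : Fin 4) (y : E4) :
    hat₄ e (fun a b c d y => S a c y * T b d y) i j k l y = hat₂ e S i k y * hat₂ e T j l y := by
  rw [← hat₂_hat₂_odd]
  have h1 : ∀ a c, hat₂ e (fun b d y => S a c y * T b d y) j l =
      fun y => hat₂ e T j l y * S a c y := by
    intro a b; funext y; rw [hat₂_smul, mul_comm]
  simp only [h1]
  rw [hat₂_smul e (fun y => hat₂ e T j l y) S, mul_comm]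

lemma hat₄_mul_outer (S T : Fin 4 → Fin 4 → E4 → ℂ) (i j k l : Fin 4) (y : E4) :
    hat₄ e (fun a b c d y => S a d y * T c b y) i j k l y = hat₂ e S i l y * hat₂ e T k j y := by
  rw [← hat₂_hat₂_outer]
  have h1 : ∀ a d, hat₂ e (fun b c y => S a d y * T c b y) j k =
      fun y => hat₂ e T k j y * S a d y := by
    intro a d; funext y
    rw [hat₂_smul e (S a d) (fun b c => T c b), hat₂_transpose, mul_comm]
  simp only [h1]
  rw [hat₂_smul e (fun y => hat₂ e T k j y) S, mul_comm]

lemma contr₂_comm {K : Fin 4 → Fin 4 → E4 → ℂ} (hK : ∀ a b y, K a b y = K b a y)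
    (A B : Fin 4 → Fin 4 → E4 → ℂ) : contr₂ K A B = contr₂ K B A := by
  funext y
  simp only [contr₂]
  calc _ = ∑ a, ∑ c, ∑ b, ∑ d, K a c y * K b d y * A a b y * B c d y :=
        Finset.sum_congr rfl fun _ _ => Finset.sum_comm
    _ = ∑ c, ∑ a, ∑ b, ∑ d, K a c y * K b d y * A a b y * B c d y := Finset.sum_comm
    _ = ∑ c, ∑ a, ∑ d, ∑ b, K a c y * K b d y * A a b y * B c d y :=
        Finset.sum_congr rfl fun _ _ => Finset.sum_congr rfl fun _ _ => Finset.sum_comm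
    _ = ∑ c, ∑ d, ∑ a, ∑ b, K a c y * K b d y * A a b y * B c d y :=
        Finset.sum_congr rfl fun _ _ => Finset.sum_comm
    _ = _ := Finset.sum_congr rfl fun c _ => Finset.sum_congr rfl fun d _ =>
        Finset.sum_congr rfl fun a _ => Finset.sum_congr rfl fun b _ => by
          rw [hK a c, hK b d]; ring

/-- The factor 2 cancels the ½ in the definition of the dual. -/
lemma sum_mul_levi {A : Fin 4 → Fin 4 → ℂ} (hA : ∀ a b, A a b = - A b a) (κ : ℂ) (i j : Fin 4) :
    ∑ k, ∑ l, A k l * (κ * levi ℂ i j k l) = κ * (2 * hodge A i j) := by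
  have h1 : ∑ k, ∑ l, A k l * (κ * levi ℂ i j k l) = κ * ∑ k, ∑ l, levi ℂ i j k l * A k l := by
    simp only [Finset.mul_sum]
    exact Finset.sum_congr rfl fun _ _ => Finset.sum_congr rfl fun _ _ => by ring
  have h2 : (fun k l => A k l - A l k) = fun k l => 2 * A k l := by
    funext k l; rw [hA l k]; ring
  rw [h1, sum_levi_mul, h2, hodge_smul]

end HatProducts

namespace IsVacuumJet

variable {Γ : Fin 4 → Fin 4 → Fin 4 → ℂ} {E : Fin 4 → Fin 4 → ℂ} {p : E4}
    {K G : Fin 4 → Fin 4 → E4 → ℂ} {H : Fin 4 → Fin 4 → Fin 4 → Fin 4 → E4 → ℂ}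
    {F : Fin 4 → Fin 4 → E4 → ℂ} {W : Fin 4 → Fin 4 → Fin 4 → Fin 4 → E4 → ℂ}
    {x ξ : Fin 4 → E4 → ℂ} {κ : ℂ} {F₀ : Fin 4 → Fin 4 → ℂ} {x₀ : Fin 4 → ℂ}
    {W₀ : Fin 4 → Fin 4 → Fin 4 → Fin 4 → ℂ}
    {dW₀ : Fin 4 → Fin 4 → Fin 4 → Fin 4 → Fin 4 → ℂ}
    (h : IsVacuumJet Γ E p K G H F W x ξ κ F₀ x₀ W₀ dW₀)

/-- The self-dual part of a 2-form in an orthonormal frame. -/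
abbrev _root_.MarsSimon.sdPart (s : ℂ) (A : Fin 4 → Fin 4 → ℂ) (a b : Fin 4) : ℂ :=
  A a b + s * hodge A a b

/-- The self-dual part of a Weyl tensor in an orthonormal frame. -/
abbrev _root_.MarsSimon.sdWeylPart (s : ℂ) (A : Fin 4 → Fin 4 → Fin 4 → Fin 4 → ℂ)
    (a b c d : Fin 4) : ℂ :=
  A a b c d + s * hodge (A a b) c d

include h

/-- Duality acts on the last index pair and commutes with the contraction of the first index, so the
dual part is divergence-free too. -/
lemma isErnstData {s : ℂ} (hs : s * s = 1) :
    IsErnstData s (sdPart s F₀) (sdWeylPart s W₀) (fun e => sdWeylPart s (dW₀ e)) where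
  sq := hs
  dualF := isSelfDual_add_hodge hs h.antisymm
  dualX := h.weyl.isSelfDualWeyl hs
  dualDX e := (h.weylDeriv e).isSelfDualWeyl hs
  div b c d := by
    have h0 : (fun k l => ∑ a, dW₀ a a b k l) = fun _ _ => 0 := by
      funext k l; exact h.div b k l
    rw [Finset.sum_add_distrib, h.div, ← Finset.mul_sum, ← hodge_sum, h0, zero_add]
    rcases hodge_apply (R := ℂ) c d with h | ⟨_, _, h⟩ <;> simp [h]

lemma diff_sdForm (j : ℂ) (a b : Fin 4) : DifferentiableAt ℝ (sdForm K H F j a b) p :=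
  (h.diffF a b).fun_add
    ((differentiableAt_contr₂ h.trace h.diffF (h.diffH a b)).const_mul (j / 2))

lemma diff_sdCurv (j : ℂ) (a b c d : Fin 4) : DifferentiableAt ℝ (sdCurv K H W j a b c d) p :=
  (h.diffW a b c d).fun_add
    ((differentiableAt_contr₂ h.trace (h.diffW a b) (h.diffH c d)).const_mul (j / 2))

lemma diff_sdMet (j : ℂ) (a b c d : Fin 4) : DifferentiableAt ℝ (sdMet G H j a b c d) p :=
  (((h.diffH a b c d).const_mul j).fun_add (((h.diffG a c).fun_mul (h.diffG b d)).fun_sub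
    ((h.diffG a d).fun_mul (h.diffG c b)))).const_mul (1 / 4)

/-- In the frame the dual is κ times `hodge`, which explains the eigenvalue jκ. The volume form is
constant to first order, so differentiation commutes with taking the dual. -/
lemma jet_sdForm (j : ℂ) (a b : Fin 4) : Jet E p (hat₂ (frame Γ E p) (sdForm K H F j) a b)
    (sdPart (j * κ) F₀ a b) (fun e => sdKillingDeriv x₀ (sdWeylPart (j * κ) W₀) e a b) := by
  set f := frame Γ E p
  have h1 : hat₂ f (sdForm K H F j) a b = fun y => hat₂ f F a b y
      + j / 2 * contr₂ K F (fun c d => hat₂ f (fun a b => H a b c d) a b) y := by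
    funext y
    rw [← hat₂_contr₂ f K F H, ← hat₂_smul f (fun _ => j / 2), ← hat₂_add]
    rfl
  rw [h1]
  have h2 := jet_contr₂ h.trace h.diffF
    (B := fun c d => hat₂ f (fun a b => H a b c d) a b)
    (fun c d => differentiableAt_hat₂ (fun a b => h.diffH a b c d) a b) h.jetF
    (w := fun k l => κ * levi ℂ a b k l) (d' := fun _ _ _ => 0) (fun k l => by
      have : hat₂ f (fun c d => hat₂ f (fun a b => H a b c d) a b) k l = hat₄ f H a b k l := by
        funext y; exact hat₂_hat₂_comm f H a b k l y
      rw [this]; exact h.jetH a b k l)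
  refine ((h.jetF a b).add (h2.const_mul (j / 2))).congr ?_ fun e => ?_
  · rw [sum_mul_levi h.antisymm]; ring
  · have ha : ∀ i k, ∑ d, x₀ d * W₀ d e i k = - ∑ d, x₀ d * W₀ d e k i := fun i k => by
      rw [← Finset.sum_neg_distrib]
      exact Finset.sum_congr rfl fun d _ => by rw [h.weyl.right d e i k]; ring
    simp only [mul_zero, add_zero]
    rw [sum_mul_levi ha, hodge_sum]
    simp only [hodge_smul, sdKillingDeriv, mul_add, Finset.sum_add_distrib, Finset.mul_sum]
    congr 1
    exact Finset.sum_congr rfl fun d _ => by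
      have : hodge (fun k l => W₀ d e k l) a b = hodge (W₀ d e) a b := rfl
      rw [this]; ring

lemma jet_sdCurv (j : ℂ) (a b c d : Fin 4) : Jet E p (hat₄ (frame Γ E p) (sdCurv K H W j) a b c d)
    (sdWeylPart (j * κ) W₀ a b c d) (fun e => sdWeylPart (j * κ) (dW₀ e) a b c d) := by
  set f := frame Γ E p
  set B : Fin 4 → Fin 4 → E4 → ℂ := fun k l => hat₂ f (fun c d => H c d k l) c d with hB
  set A : Fin 4 → Fin 4 → E4 → ℂ := fun k l => hat₂ f (fun a b => W a b k l) a b with hA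
  have h1 : hat₄ f (sdCurv K H W j) a b c d = fun y => hat₄ f W a b c d y
      + j / 2 * contr₂ K B A y := by
    -- Spectator indices are extracted from the second factor of a contraction only. The factors are
    -- interchanged so that the indices of `H` and then those of `W` can be extracted.
    have e1 : ∀ a b, hat₂ f (sdCurv K H W j a b) c d = fun y => hat₂ f (W a b) c d y
        + j / 2 * contr₂ K B (W a b) y := by
      intro a b
      funext y
      rw [contr₂_comm h.symm, hB, ← hat₂_contr₂ f K (W a b) H, ← hat₂_smul f (fun _ => j / 2),
        ← hat₂_add]
      rfl
    funext y
    simp only [hat₄, e1]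
    rw [hat₂_add, hat₂_smul f (fun _ => j / 2) (fun a b => contr₂ K B (W a b)), hat₂_contr₂]
  rw [h1]
  have h2 := jet_contr₂ h.trace (A := B) (B := A)
    (fun k l => differentiableAt_hat₂ (fun c d => h.diffH c d k l) c d)
    (fun k l => differentiableAt_hat₂ (fun a b => h.diffW a b k l) a b)
    (v := fun k l => κ * levi ℂ c d k l) (d := fun _ _ _ => 0)
    (w := W₀ a b) (d' := fun k l e => dW₀ e a b k l) (fun k l => by
      have : hat₂ f B k l = hat₄ f H c d k l := by
        funext y; exact hat₂_hat₂_comm f H c d k l y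
      rw [this]; exact h.jetH c d k l)
    (fun k l => by
      have : hat₂ f A k l = hat₄ f W a b k l := by
        funext y; exact hat₂_hat₂_comm f W a b k l y
      rw [this]; exact h.jetW a b k l)
  refine ((h.jetW a b c d).add (h2.const_mul (j / 2))).congr ?_ fun e => ?_
  · simp only [mul_comm (κ * levi ℂ _ _ _ _)]
    rw [sum_mul_levi fun k l => h.weyl.right a b k l]; ring
  · simp only [zero_mul, zero_add, mul_comm (κ * levi ℂ _ _ _ _)]
    rw [sum_mul_levi fun k l => (h.weylDeriv e).right a b k l]; ring

lemma jet_sdMet (j : ℂ) (a b c d : Fin 4) : Jet E p (hat₄ (frame Γ E p) (sdMet G H j) a b c d)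
    (sdOne (j * κ) a b c d) (fun _ => 0) := by
  set f := frame Γ E p
  have h1 : hat₄ f (sdMet G H j) a b c d = fun y => 1 / 4 * (j * hat₄ f H a b c d y +
      (hat₂ f G a c y * hat₂ f G b d y - hat₂ f G a d y * hat₂ f G c b y)) := by
    funext y
    rw [← hat₄_mul_odd, ← hat₄_mul_outer]
    simp only [hat₄_eq, sdMet, Finset.mul_sum, ← Finset.sum_add_distrib, ← Finset.sum_sub_distrib]
    exact Finset.sum_congr rfl fun _ _ => Finset.sum_congr rfl fun _ _ =>
      Finset.sum_congr rfl fun _ _ => Finset.sum_congr rfl fun _ _ => by ring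
  rw [h1]
  refine ((((h.jetH a b c d).const_mul j).add (((h.jetG a c).mul (h.jetG b d)).sub
    ((h.jetG a d).mul (h.jetG c b)))).const_mul (1 / 4)).congr ?_ fun e => by ring
  simp only [sdOne, eq_comm (a := c) (b := b)]
  simp only [mul_assoc, ite_mul, one_mul, zero_mul]

variable {j : ℂ} {t : E4 → ℂ} {τ : ℂ}
  (ht : Jet E p t τ (fun e => -(τ * τ * ernst x₀ (sdPart (j * κ) F₀) e)))
include ht

lemma diff_msField (a b c d : Fin 4) : DifferentiableAt ℝ (msField K G H F W j t a b c d) p :=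
  (h.diff_sdCurv j a b c d).fun_add ((ht.diff.const_mul 6).fun_mul
    (((h.diff_sdForm j a b).fun_mul (h.diff_sdForm j c d)).fun_sub
      (((differentiableAt_contr₂ h.trace (h.diff_sdForm j) (h.diff_sdForm j)).mul_const 3⁻¹).fun_mul
        (h.diff_sdMet j a b c d))))

/-- `ht` is the Ernst equation for the reciprocal of σ, namely ∇(1/σ) = -σ⁻² ∇σ. Since 𝓘 is constant
to first order, the product rule yields `msDeriv`. -/
lemma jet_msField (a b c d : Fin 4) : Jet E p (hat₄ (frame Γ E p) (msField K G H F W j t) a b c d)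
    (msTensor (j * κ) (sdPart (j * κ) F₀) (sdWeylPart (j * κ) W₀) τ a b c d)
    (fun e => msDeriv (j * κ) x₀ (sdPart (j * κ) F₀) (sdWeylPart (j * κ) W₀)
      (fun e => sdWeylPart (j * κ) (dW₀ e)) τ e a b c d) := by
  set f := frame Γ E p
  set B := sdForm K H F j
  have h1 : hat₄ f (msField K G H F W j t) a b c d = fun y => hat₄ f (sdCurv K H W j) a b c d y
      + 6 * t y * (hat₂ f B a b y * hat₂ f B c d y
        - 1 / 3 * contr₂ K B B y * hat₄ f (sdMet G H j) a b c d y) := by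
    funext y
    rw [← hat₄_mul]
    simp only [hat₄_eq, msField, Finset.mul_sum, ← Finset.sum_add_distrib,
      ← Finset.sum_sub_distrib]
    exact Finset.sum_congr rfl fun _ _ => Finset.sum_congr rfl fun _ _ =>
      Finset.sum_congr rfl fun _ _ => Finset.sum_congr rfl fun _ _ => by ring
  rw [h1]
  have hsq := jet_contr₂ h.trace (h.diff_sdForm j) (h.diff_sdForm j) (h.jet_sdForm j)
    (h.jet_sdForm j)
  refine ((h.jet_sdCurv j a b c d).add ((ht.const_mul 6).mul
    (((h.jet_sdForm j a b).mul (h.jet_sdForm j c d)).sub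
      ((hsq.const_mul (1 / 3)).mul (h.jet_sdMet j a b c d))))).congr ?_ fun e => ?_
  · simp only [msTensor, sdSquare]; ring
  · simp only [msDeriv, sdSquare, sdSquareDeriv]; ring

end IsVacuumJet

end MarsSimon

/-! ## Jets of the current -/

namespace MarsSimon

/-- The covariant divergence, at `p`, of the vector field with covariant components `V`. -/
lemma divergence_raise {Γ : Fin 4 → Fin 4 → Fin 4 → ℂ} {E : Fin 4 → Fin 4 → ℂ} {p : E4}
    {K : Fin 4 → Fin 4 → E4 → ℂ} (hK : IsFrameTrace Γ E p K) {V : Fin 4 → E4 → ℂ}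
    (hV : ∀ a, DifferentiableAt ℝ (V a) p) :
    ∑ e, (pd e (fun y => ∑ a, K e a y * V a y) p + ∑ b, Γ e e b * ∑ a, K b a p * V a p) =
      ∑ i, ∑ e, E i e * pd e (hat₁ (frame Γ E p) V i) p := by
  have h1 : ∑ i, ∑ e, E i e * pd e (hat₁ (frame Γ E p) V i) p =
      ∑ e, ∑ a, K e a p * (pd e (V a) p - ∑ l, Γ l e a * V l p) := by
    rw [hK.sum_eq]
    simp only [pd_hat₁ hV, Finset.mul_sum, mul_assoc]
  rw [h1]
  refine Finset.sum_congr rfl fun e _ => ?_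
  rw [pd_sum _ fun a => (hK.diff e a).fun_mul (hV a)]
  simp only [pd_mul _ (hK.diff _ _) (hV _), hK.deriv, Finset.sum_add_distrib, mul_sub, neg_mul,
    Finset.sum_neg_distrib, Finset.sum_sub_distrib, Finset.sum_mul, Finset.mul_sum, add_mul]
  have e1 : ∑ b, ∑ a, Γ e e b * (K b a p * V a p) = ∑ a, ∑ l, Γ e e l * K l a p * V a p := by
    rw [Finset.sum_comm]
    simp only [mul_assoc]
  have e2 : ∑ a, ∑ l, K e a p * (Γ l e a * V l p) = ∑ a, ∑ l, Γ a e l * K e l p * V a p := by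
    rw [Finset.sum_comm]
    exact Finset.sum_congr rfl fun _ _ => Finset.sum_congr rfl fun _ _ => by ring
  rw [e1, e2]; ring

lemma hat₁_hat₁ (e : Fin 4 → Fin 4 → E4 → ℂ) (T : Fin 4 → Fin 4 → E4 → ℂ) (i j : Fin 4) (y : E4) :
    hat₁ e (fun b => hat₁ e (fun a => T a b) i) j y = hat₂ e T i j y := by
  simp only [hat₁, hat₂, Finset.mul_sum]
  rw [Finset.sum_comm]
  exact Finset.sum_congr rfl fun _ _ => Finset.sum_congr rfl fun _ _ => by ring

lemma sum_eq_pairing (N : Fin 4 → Fin 4 → ℂ) (x : Fin 4 → ℂ) (B : Fin 4 → Fin 4 → Fin 4 → ℂ) :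
    ∑ j, (∑ m, ∑ n, N m n * B m n j) * x j = pairing N x B := by
  simp only [pairing, Finset.sum_mul]
  rw [Finset.sum_comm]
  refine Finset.sum_congr rfl fun _ _ => ?_
  rw [Finset.sum_comm]
  exact Finset.sum_congr rfl fun _ _ => Finset.sum_congr rfl fun _ _ => by ring

namespace IsVacuumJet

variable {Γ : Fin 4 → Fin 4 → Fin 4 → ℂ} {E : Fin 4 → Fin 4 → ℂ} {p : E4}
    {K G : Fin 4 → Fin 4 → E4 → ℂ} {H : Fin 4 → Fin 4 → Fin 4 → Fin 4 → E4 → ℂ}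
    {F : Fin 4 → Fin 4 → E4 → ℂ} {W : Fin 4 → Fin 4 → Fin 4 → Fin 4 → E4 → ℂ}
    {x ξ : Fin 4 → E4 → ℂ} {κ : ℂ} {F₀ : Fin 4 → Fin 4 → ℂ} {x₀ : Fin 4 → ℂ}
    {W₀ : Fin 4 → Fin 4 → Fin 4 → Fin 4 → ℂ}
    {dW₀ : Fin 4 → Fin 4 → Fin 4 → Fin 4 → Fin 4 → ℂ}
    (h : IsVacuumJet Γ E p K G H F W x ξ κ F₀ x₀ W₀ dW₀)

section SuperCurrent

variable {S Y : Fin 4 → Fin 4 → Fin 4 → Fin 4 → E4 → ℂ}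
  {S₀ Y₀ : Fin 4 → Fin 4 → Fin 4 → Fin 4 → ℂ}
  {dS dY : Fin 4 → Fin 4 → Fin 4 → Fin 4 → Fin 4 → ℂ}
  (diffS : ∀ a b c d, DifferentiableAt ℝ (S a b c d) p)
  (diffY : ∀ a b c d, DifferentiableAt ℝ (Y a b c d) p)
  (jetS : ∀ a b c d, Jet E p (hat₄ (frame Γ E p) S a b c d) (S₀ a b c d) (fun e => dS e a b c d))
  (jetY : ∀ a b c d, Jet E p (hat₄ (frame Γ E p) Y a b c d) (Y₀ a b c d) (fun e => dY e a b c d))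

include h diffY

lemma diff_electricField (m n : Fin 4) : DifferentiableAt ℝ (electricField K x Y m n) p :=
  differentiableAt_contr₂ h.trace (fun c d => (h.diffx c).fun_mul (h.diffx d))
    (fun c d => diffY c m n d)

include jetY in
lemma jet_electricField (k l : Fin 4) : Jet E p (hat₂ (frame Γ E p) (electricField K x Y) k l)
    (electric x₀ Y₀ k l) (fun e => electricDeriv x₀ F₀ Y₀ dY e k l) := by
  set f := frame Γ E p
  have h1 : hat₂ f (electricField K x Y) k l = contr₂ K (fun c d y => x c y * x d y)
      (fun c d => hat₂ f (fun m n => Y c m n d) k l) := by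
    funext y
    exact hat₂_contr₂ f K _ (fun m n c d => Y c m n d) k l y
  rw [h1]
  refine (jet_contr₂ h.trace (fun c d => (h.diffx c).fun_mul (h.diffx d))
    (fun c d => differentiableAt_hat₂ (fun m n => diffY c m n d) k l)
    (v := fun i j => x₀ i * x₀ j) (d := fun i j e => F₀ e i * x₀ j + x₀ i * F₀ e j)
    (w := fun i j => Y₀ i k l j) (d' := fun i j e => dY e i k l j)
    (fun i j => ?_) (fun i j => ?_)).congr ?_ fun e => ?_
  · have : hat₂ f (fun c d y => x c y * x d y) i j = fun y => hat₁ f x i y * hat₁ f x j y := by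
      funext y; exact hat₂_mul f x x i j y
    rw [this]; exact (h.jetx i).mul (h.jetx j)
  · have : hat₂ f (fun c d => hat₂ f (fun m n => Y c m n d) k l) i j = hat₄ f Y i k l j := by
      funext y; exact hat₂_hat₂_outer f Y i k l j y
    rw [this]; exact jetY i k l j
  · exact Finset.sum_congr rfl fun _ _ => Finset.sum_congr rfl fun _ _ => by ring
  · exact Finset.sum_congr rfl fun _ _ => Finset.sum_congr rfl fun _ _ => by ring

include diffS

lemma diff_superCurrent (a : Fin 4) : DifferentiableAt ℝ (superCurrent K x S Y a) p := by
  unfold superCurrent trK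
  exact DifferentiableAt.fun_sum fun b _ => DifferentiableAt.fun_sum fun c _ =>
    (h.trace.diff b c).fun_mul ((differentiableAt_contr₂ h.trace (h.diff_electricField diffY)
      fun k l => diffS a k l b).fun_mul (h.diffx c))

include jetS jetY

/-- The three terms of the derivative come from the outer ξ, from N and from `S`, in this order;
they are the last three terms of `conservation`. -/
lemma jet_superCurrent (i : Fin 4) : Jet E p (hat₁ (frame Γ E p) (superCurrent K x S Y) i)
    (pairing (electric x₀ Y₀) x₀ (S₀ i))
    (fun e => ∑ b, F₀ e b * ∑ m, ∑ n, electric x₀ Y₀ m n * S₀ i m n b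
      + pairing (electricDeriv x₀ F₀ Y₀ dY e) x₀ (S₀ i)
      + pairing (electric x₀ Y₀) x₀ (dS e i)) := by
  set f := frame Γ E p
  set N := electricField K x Y
  have dN := h.diff_electricField diffY
  have dU : ∀ a b, DifferentiableAt ℝ (contr₂ K N (fun k l => S a k l b)) p := fun a b =>
    differentiableAt_contr₂ h.trace dN fun k l => diffS a k l b
  have jU : ∀ j, Jet E p (hat₂ f (fun a b => contr₂ K N (fun k l => S a k l b)) i j)
      (∑ m, ∑ n, electric x₀ Y₀ m n * S₀ i m n j)
      (fun e => ∑ m, ∑ n, (electricDeriv x₀ F₀ Y₀ dY e m n * S₀ i m n j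
        + electric x₀ Y₀ m n * dS e i m n j)) := by
    intro j
    have h1 : hat₂ f (fun a b => contr₂ K N (fun k l => S a k l b)) i j =
        contr₂ K N (fun k l => hat₂ f (fun a b => S a k l b) i j) := by
      funext y; exact hat₂_contr₂ f K N (fun a b k l => S a k l b) i j y
    rw [h1]
    refine jet_contr₂ h.trace dN
      (fun k l => differentiableAt_hat₂ (fun a b => diffS a k l b) i j)
      (h.jet_electricField diffY jetY) (w := fun k l => S₀ i k l j)
      (d' := fun k l e => dS e i k l j) fun k l => ?_
    have : hat₂ f (fun k l => hat₂ f (fun a b => S a k l b) i j) k l = hat₄ f S i k l j := by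
      funext y
      rw [hat₂_hat₂_comm f (fun a b k l => S a k l b), hat₄]
      exact hat₂_hat₂_outer f S i k l j y
    rw [this]; exact jetS i k l j
  have h2 : hat₁ f (superCurrent K x S Y) i = trK K (fun b c y =>
      hat₁ f (fun a => contr₂ K N (fun k l => S a k l b)) i y * x c y) := by
    funext y
    simp only [hat₁, superCurrent, trK, Finset.mul_sum, Finset.sum_mul]
    rw [Finset.sum_comm]
    refine Finset.sum_congr rfl fun _ _ => ?_
    rw [Finset.sum_comm]
    exact Finset.sum_congr rfl fun _ _ => Finset.sum_congr rfl fun _ _ => by ring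
  rw [h2]
  refine (jet_trK h.trace (fun b c => (differentiableAt_hat₁ (fun a => dU a b) i).fun_mul (h.diffx c))
    fun j => ?_).congr
    (v := ∑ j, (∑ m, ∑ n, electric x₀ Y₀ m n * S₀ i m n j) * x₀ j)
    (d := fun e => ∑ j, ((∑ m, ∑ n, (electricDeriv x₀ F₀ Y₀ dY e m n * S₀ i m n j
        + electric x₀ Y₀ m n * dS e i m n j)) * x₀ j
        + (∑ m, ∑ n, electric x₀ Y₀ m n * S₀ i m n j) * F₀ e j)) ?_ fun e => ?_
  · have : hat₂ f (fun b c y => hat₁ f (fun a => contr₂ K N (fun k l => S a k l b)) i y * x c y) j j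
        = fun y => hat₂ f (fun a b => contr₂ K N (fun k l => S a k l b)) i j y * hat₁ f x j y := by
      funext y
      rw [hat₂_mul f (fun b => hat₁ f (fun a => contr₂ K N (fun k l => S a k l b)) i) x,
        hat₁_hat₁ f (fun a b => contr₂ K N (fun k l => S a k l b))]
    rw [this]; exact (jU j).mul (h.jetx j)
  · exact sum_eq_pairing _ _ _
  · simp only [Finset.sum_add_distrib, add_mul, ← sum_eq_pairing]
    simp only [mul_comm (F₀ e _)]
    ring

end SuperCurrent

end IsVacuumJet

end MarsSimon

/-! ## Conservation of the weighted current -/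

namespace MarsSimon

/-- The current built from two 4-tensors `S` and `Y`, with the weight `r`. -/
def weightedCurrent (K : Fin 4 → Fin 4 → E4 → ℂ) (x : Fin 4 → E4 → ℂ) (r : E4 → ℂ)
    (S Y : Fin 4 → Fin 4 → Fin 4 → Fin 4 → E4 → ℂ) (e : Fin 4) (y : E4) : ℂ :=
  ∑ a, K e a y * (r y * superCurrent K x S Y a y)

namespace IsVacuumJet

variable {Γ : Fin 4 → Fin 4 → Fin 4 → ℂ} {E : Fin 4 → Fin 4 → ℂ} {p : E4}
    {K G : Fin 4 → Fin 4 → E4 → ℂ} {H : Fin 4 → Fin 4 → Fin 4 → Fin 4 → E4 → ℂ}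
    {F : Fin 4 → Fin 4 → E4 → ℂ} {W : Fin 4 → Fin 4 → Fin 4 → Fin 4 → E4 → ℂ}
    {x ξ : Fin 4 → E4 → ℂ} {κ : ℂ} {F₀ : Fin 4 → Fin 4 → ℂ} {x₀ : Fin 4 → ℂ}
    {W₀ : Fin 4 → Fin 4 → Fin 4 → Fin 4 → ℂ}
    {dW₀ : Fin 4 → Fin 4 → Fin 4 → Fin 4 → Fin 4 → ℂ}
    (h : IsVacuumJet Γ E p K G H F W x ξ κ F₀ x₀ W₀ dW₀)
include h

/-- A solution of the Ernst equation at `p`, in terms of the frame. -/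
lemma jet_ernst {s : E4 → ℂ} (hs : DifferentiableAt ℝ s p) {j : ℂ}
    (hd : ∀ a, pd a s p = 2 * ∑ b, sdForm K H F j a b p * ξ b p) :
    Jet E p s (s p) (ernst x₀ (sdPart (j * κ) F₀)) := by
  refine (Jet.of_differentiableAt hs).congr rfl fun k => ?_
  have h1 : ∀ a, ∑ b, sdForm K H F j a b p * ξ b p =
      ∑ i, ∑ b, ∑ c, E i b * E i c * (sdForm K H F j a b p * x c p) := by
    intro a
    rw [← h.trace.sum_eq]
    refine Finset.sum_congr rfl fun b _ => ?_
    rw [h.raise.self_of_nhds b, Finset.mul_sum]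
    exact Finset.sum_congr rfl fun _ _ => by ring
  have h2 := fun i => (h.jet_sdForm j k i).val
  have h3 := fun i => (h.jetx i).val
  simp only [hat₂_self] at h2
  simp only [hat₁_self] at h3
  simp only [hd, h1, ernst, ← h2, ← h3]
  simp only [Finset.mul_sum, Finset.sum_mul]
  rw [Finset.sum_comm]
  refine Finset.sum_congr rfl fun i _ => ?_
  calc _ = ∑ a, ∑ c, ∑ b, E k a * (2 * (E i b * E i c * (sdForm K H F j a b p * x c p))) :=
        Finset.sum_congr rfl fun _ _ => Finset.sum_comm
    _ = ∑ c, ∑ a, ∑ b, E k a * (2 * (E i b * E i c * (sdForm K H F j a b p * x c p))) :=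
        Finset.sum_comm
    _ = _ := Finset.sum_congr rfl fun _ _ => Finset.sum_congr rfl fun _ _ =>
        Finset.sum_congr rfl fun _ _ => by ring

lemma jet_ernst_inv {s : E4 → ℂ} (hs : DifferentiableAt ℝ s p) (h0 : s p ≠ 0) {j : ℂ}
    (hd : ∀ a, pd a s p = 2 * ∑ b, sdForm K H F j a b p * ξ b p) :
    Jet E p (fun y => (s y)⁻¹) (s p)⁻¹
      (fun e => -((s p)⁻¹ * (s p)⁻¹ * ernst x₀ (sdPart (j * κ) F₀) e)) :=
  (h.jet_ernst hs hd).inv h0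

variable {j j' : ℂ} {t t' : E4 → ℂ} {τ τ' : ℂ} (hj : j * j = -1) (hj' : j' = -j)
  (ht : Jet E p t τ (fun e => -(τ * τ * ernst x₀ (sdPart (j * κ) F₀) e)))
  (ht' : Jet E p t' τ' (fun e => -(τ' * τ' * ernst x₀ (sdPart (j' * κ) F₀) e)))
include ht ht'

lemma diff_weightedCurrent {r : E4 → ℂ} (hr : DifferentiableAt ℝ r p) (e : Fin 4) :
    DifferentiableAt ℝ (weightedCurrent K x r (msField K G H F W j t) (msField K G H F W j' t') e)
      p :=
  DifferentiableAt.fun_sum fun a _ => (h.trace.diff e a).fun_mul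
    (hr.fun_mul (h.diff_superCurrent (h.diff_msField ht) (h.diff_msField ht') a))

include hj hj'

/-- The current does not depend on the order of the two Mars–Simon tensors. -/
lemma weightedCurrent_comm (r : E4 → ℂ) (e : Fin 4) :
    weightedCurrent K x r (msField K G H F W j t) (msField K G H F W j' t') e p =
      weightedCurrent K x r (msField K G H F W j' t') (msField K G H F W j t) e p := by
  have hs : (j * κ) * (j * κ) = 1 := by linear_combination κ * κ * hj - h.sq
  have hs' : j' * κ = -(j * κ) := by rw [hj']; ring
  have e1 : ∀ (S Y : Fin 4 → Fin 4 → Fin 4 → Fin 4 → E4 → ℂ), weightedCurrent K x r S Y e p =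
      ∑ i, E i e * (r p * hat₁ (frame Γ E p) (superCurrent K x S Y) i p) := by
    intro S Y
    simp only [weightedCurrent, h.trace.val, hat₁_self, Finset.mul_sum, Finset.sum_mul]
    rw [Finset.sum_comm]
    exact Finset.sum_congr rfl fun _ _ => Finset.sum_congr rfl fun _ _ => by ring
  have dS := h.diff_msField (G := G) ht
  have dY := h.diff_msField (G := G) ht'
  have jS := h.jet_msField (G := G) ht
  have jY := h.jet_msField (G := G) ht'
  rw [e1, e1]
  refine Finset.sum_congr rfl fun i _ => ?_
  rw [(h.jet_superCurrent dS dY jS jY i).val, (h.jet_superCurrent dY dS jY jS i).val,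
    hs', ((h.isErnstData hs).dual_msTensor τ).pairing_electric hs
      ((h.isErnstData (s := -(j * κ)) (by linear_combination hs)).dual_msTensor τ')]

/-- Conservation of the current, for a vacuum metric in coordinates. -/
theorem divergence_weightedCurrent :
    ∑ e, (pd e (weightedCurrent K x (fun y => (t y * t' y) ^ 3) (msField K G H F W j t)
        (msField K G H F W j' t') e) p
      + ∑ b, Γ e e b * weightedCurrent K x (fun y => (t y * t' y) ^ 3) (msField K G H F W j t)
        (msField K G H F W j' t') b p) = 0 := by
  have hs : (j * κ) * (j * κ) = 1 := by linear_combination κ * κ * hj - h.sq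
  have hs' : j' * κ = -(j * κ) := by rw [hj']; ring
  have dS := h.diff_msField (G := G) ht
  have dY := h.diff_msField (G := G) ht'
  have jS := h.jet_msField (G := G) ht
  have jY := h.jet_msField (G := G) ht'
  set S := msField K G H F W j t
  set Y := msField K G H F W j' t'
  -- The cube is differentiated as a threefold product; its logarithmic derivative is -3(τ σ_a + τ'
  -- σ'_a).
  have hr := ((ht.mul ht').mul ((ht.mul ht').mul (ht.mul ht'))).congr_fun
    (f' := fun y => (t y * t' y) ^ 3) (Filter.Eventually.of_forall fun y => by ring)
  have dV := fun a => hr.diff.fun_mul (h.diff_superCurrent dS dY a)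
  have jV : ∀ i, Jet E p (hat₁ (frame Γ E p) (fun a y => (t y * t' y) ^ 3 * superCurrent K x S Y a y) i)
      _ _ := fun i => (hr.mul (h.jet_superCurrent dS dY jS jY i)).congr_fun
        (Filter.Eventually.of_forall fun y => hat₁_smul _ _ _ _ _)
  refine (divergence_raise h.trace dV).trans ?_
  simp only [(jV _).deriv]
  rw [hs'] at *
  have hc := conservation (τ := τ) (τ' := τ') (x := x₀) h.antisymm (h.isErnstData hs)
    (h.isErnstData (s := -(j * κ)) (by linear_combination hs))
  rw [← mul_zero ((τ * τ') ^ 3), ← hc, Finset.mul_sum]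
  refine Finset.sum_congr rfl fun i _ => ?_
  ring

end IsVacuumJet

end MarsSimon

/-! ## The theorem in coordinates -/

namespace MarsSimon

/-- A tensor of the second rank with complexified components. -/
abbrev cast₂ (T : Fin 4 → Fin 4 → E4 → ℝ) : Fin 4 → Fin 4 → E4 → ℂ :=
  fun a b y => ((T a b y : ℝ) : ℂ)

/-- A tensor of the fourth rank with complexified components. -/
abbrev cast₄ (T : Fin 4 → Fin 4 → Fin 4 → Fin 4 → E4 → ℝ) : Fin 4 → Fin 4 → Fin 4 → Fin 4 → E4 → ℂ :=
  fun a b c d y => ((T a b c d y : ℝ) : ℂ)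

/-! ### Complex conjugation of the fields -/

section Conj

variable {K G : Fin 4 → Fin 4 → E4 → ℝ} {H : Fin 4 → Fin 4 → Fin 4 → Fin 4 → E4 → ℝ}
  {F : Fin 4 → Fin 4 → E4 → ℝ} {W : Fin 4 → Fin 4 → Fin 4 → Fin 4 → E4 → ℝ} {x : Fin 4 → E4 → ℝ}

lemma conj_sdForm (j : ℂ) (a b : Fin 4) (y : E4) :
    starRingEnd ℂ (sdForm (cast₂ K) (cast₄ H) (cast₂ F) j a b y) =
      sdForm (cast₂ K) (cast₄ H) (cast₂ F) (starRingEnd ℂ j) a b y := by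
  simp only [sdForm, contr₂, map_add, map_mul, map_div₀, map_ofNat, map_sum, Complex.conj_ofReal]

/-- All tensors entering have real components, so conjugation affects only `j` and `t`. -/
lemma conj_msField (j : ℂ) (t : E4 → ℂ) (a b c d : Fin 4) (y : E4) :
    starRingEnd ℂ (msField (cast₂ K) (cast₂ G) (cast₄ H) (cast₂ F) (cast₄ W) j t a b c d y) =
      msField (cast₂ K) (cast₂ G) (cast₄ H) (cast₂ F) (cast₄ W) (starRingEnd ℂ j)
        (fun y => starRingEnd ℂ (t y)) a b c d y := by
  have h1 : starRingEnd ℂ (sdCurv (cast₂ K) (cast₄ H) (cast₄ W) j a b c d y) =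
      sdCurv (cast₂ K) (cast₄ H) (cast₄ W) (starRingEnd ℂ j) a b c d y := by
    simp only [sdCurv, contr₂, map_add, map_mul, map_div₀, map_ofNat, map_sum, Complex.conj_ofReal]
  have h2 : starRingEnd ℂ (sdMet (cast₂ G) (cast₄ H) j a b c d y) =
      sdMet (cast₂ G) (cast₄ H) (starRingEnd ℂ j) a b c d y := by
    simp only [sdMet, map_add, map_sub, map_mul, map_div₀, map_ofNat, map_one, Complex.conj_ofReal]
  have h3 : starRingEnd ℂ (contr₂ (cast₂ K) (sdForm (cast₂ K) (cast₄ H) (cast₂ F) j)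
      (sdForm (cast₂ K) (cast₄ H) (cast₂ F) j) y) =
      contr₂ (cast₂ K) (sdForm (cast₂ K) (cast₄ H) (cast₂ F) (starRingEnd ℂ j))
        (sdForm (cast₂ K) (cast₄ H) (cast₂ F) (starRingEnd ℂ j)) y := by
    simp only [contr₂, map_mul, map_sum, conj_sdForm, Complex.conj_ofReal]
  simp only [msField, map_add, map_sub, map_mul, map_div₀, map_ofNat, h1, h2, h3, conj_sdForm]

lemma conj_weightedCurrent {r : E4 → ℂ} {S Y S' Y' : Fin 4 → Fin 4 → Fin 4 → Fin 4 → E4 → ℂ}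
    {y : E4} (hr : starRingEnd ℂ (r y) = r y)
    (hS : ∀ a b c d, starRingEnd ℂ (S a b c d y) = S' a b c d y)
    (hY : ∀ a b c d, starRingEnd ℂ (Y a b c d y) = Y' a b c d y) (e : Fin 4) :
    starRingEnd ℂ (weightedCurrent (cast₂ K) (fun a y => ((x a y : ℝ) : ℂ)) r S Y e y) =
      weightedCurrent (cast₂ K) (fun a y => ((x a y : ℝ) : ℂ)) r S' Y' e y := by
  simp only [weightedCurrent, superCurrent, trK, electricField, contr₂, map_mul, map_sum,
    Complex.conj_ofReal, hr, hS, hY]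

end Conj

/-! ### Translation of the definitions into contractions -/

section Definitions

variable (g : Fin 4 → Fin 4 → E4 → ℝ) (ξ : Fin 4 → E4 → ℝ)
  (η : Fin 4 → Fin 4 → Fin 4 → Fin 4 → E4 → ℝ)

lemma sdKilling_eq (a b : Fin 4) (y : E4) : sdKilling g ξ η a b y =
    sdForm (cast₂ (ginv g)) (cast₄ η) (cast₂ (killingForm g ξ)) Complex.I a b y := by
  simp only [sdKilling, sdForm, contr₂, etaMixed, Finset.sum_mul]
  push_cast
  simp only [Finset.mul_sum]
  congr 1
  exact Finset.sum_congr rfl fun _ _ => Finset.sum_congr rfl fun _ _ =>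
    Finset.sum_congr rfl fun _ _ => Finset.sum_congr rfl fun _ _ => by ring

lemma sdWeyl_eq (a b c d : Fin 4) (y : E4) : sdWeyl g η a b c d y =
    sdCurv (cast₂ (ginv g)) (cast₄ η) (cast₄ (weyl g)) Complex.I a b c d y := by
  simp only [sdWeyl, sdCurv, contr₂, etaMixed, Finset.sum_mul]
  push_cast
  simp only [Finset.mul_sum]
  congr 1
  exact Finset.sum_congr rfl fun _ _ => Finset.sum_congr rfl fun _ _ =>
    Finset.sum_congr rfl fun _ _ => Finset.sum_congr rfl fun _ _ => by ring

lemma marsSimon_eq (σ : E4 → ℂ) (a b c d : Fin 4) (y : E4) : marsSimon g ξ η σ a b c d y =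
    msField (cast₂ (ginv g)) (cast₂ g) (cast₄ η) (cast₂ (killingForm g ξ)) (cast₄ (weyl g))
      Complex.I (fun y => (σ y)⁻¹) a b c d y := by
  have h1 : sdKillingSq g ξ η y = contr₂ (cast₂ (ginv g))
      (sdForm (cast₂ (ginv g)) (cast₄ η) (cast₂ (killingForm g ξ)) Complex.I)
      (sdForm (cast₂ (ginv g)) (cast₄ η) (cast₂ (killingForm g ξ)) Complex.I) y := by
    simp only [sdKillingSq, contr₂, sdKilling_eq]
  have h2 : sdMetric g η a b c d y = sdMet (cast₂ g) (cast₄ η) Complex.I a b c d y := by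
    simp only [sdMetric, sdMet]; push_cast; rfl
  rw [marsSimon, msField, h1, h2, sdWeyl_eq, sdKilling_eq, sdKilling_eq, div_eq_mul_inv]

variable {g ξ}

lemma electricField_eq {K : Fin 4 → Fin 4 → E4 → ℂ} {x v : Fin 4 → E4 → ℂ} {y : E4}
    (hK : ∀ a b y, K a b y = K b a y) (hv : ∀ b, v b y = ∑ c, K b c y * x c y)
    (Y : Fin 4 → Fin 4 → Fin 4 → Fin 4 → E4 → ℂ) (m n : Fin 4) :
    electricField K x Y m n y = ∑ c, ∑ d, v c y * v d y * Y c m n d y := by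
  have h1 : ∀ c d, v c y * v d y * Y c m n d y =
      ∑ a, ∑ b, K a c y * K b d y * (x a y * x b y) * Y c m n d y := by
    intro c d
    rw [hv, hv, Finset.sum_mul_sum, Finset.sum_mul]
    refine Finset.sum_congr rfl fun a _ => ?_
    rw [Finset.sum_mul]
    exact Finset.sum_congr rfl fun b _ => by rw [hK a c, hK b d]; ring
  simp only [h1, electricField, contr₂]
  calc _ = ∑ a, ∑ c, ∑ b, ∑ d, K a c y * K b d y * (x a y * x b y) * Y c m n d y :=
        Finset.sum_congr rfl fun _ _ => Finset.sum_comm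
    _ = ∑ c, ∑ a, ∑ b, ∑ d, K a c y * K b d y * (x a y * x b y) * Y c m n d y := Finset.sum_comm
    _ = ∑ c, ∑ a, ∑ d, ∑ b, K a c y * K b d y * (x a y * x b y) * Y c m n d y :=
        Finset.sum_congr rfl fun _ _ => Finset.sum_congr rfl fun _ _ => Finset.sum_comm
    _ = ∑ c, ∑ d, ∑ a, ∑ b, K a c y * K b d y * (x a y * x b y) * Y c m n d y :=
        Finset.sum_congr rfl fun _ _ => Finset.sum_comm

lemma superCurrent_eq {K : Fin 4 → Fin 4 → E4 → ℂ} {x v : Fin 4 → E4 → ℂ} {y : E4}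
    (hK : ∀ a b y, K a b y = K b a y) (hv : ∀ b, v b y = ∑ c, K b c y * x c y)
    (S Y : Fin 4 → Fin 4 → Fin 4 → Fin 4 → E4 → ℂ) (a : Fin 4) :
    superCurrent K x S Y a y = ∑ b, ∑ c, ∑ d, (∑ m, ∑ n, ∑ k, ∑ l,
      K m k y * K n l y * S a k l b y * Y c m n d y) * v b y * v c y * v d y := by
  have h1 : superCurrent K x S Y a y =
      ∑ b, v b y * contr₂ K (electricField K x Y) (fun k l => S a k l b) y := by
    simp only [superCurrent, trK, hv, Finset.sum_mul]
    exact Finset.sum_congr rfl fun _ _ => Finset.sum_congr rfl fun _ _ => by ring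
  rw [h1]
  refine Finset.sum_congr rfl fun b _ => ?_
  simp only [contr₂, electricField_eq hK hv]
  have h2 : ∀ q : Fin 4 → Fin 4 → Fin 4 → Fin 4 → ℂ, ∀ w : Fin 4 → Fin 4 → ℂ,
      ∑ m, ∑ n, ∑ k, ∑ l, q m n k l * ∑ c, ∑ d, w c d * Y c m n d y =
      ∑ c, ∑ d, w c d * ∑ m, ∑ n, ∑ k, ∑ l, q m n k l * Y c m n d y := by
    intro q w
    have h3 : ∀ f : Fin 4 → Fin 4 → Fin 4 → ℂ, ∑ c, ∑ d, ∑ n, f c d n = ∑ n, ∑ c, ∑ d, f c d n := by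
      intro f
      calc _ = ∑ c, ∑ n, ∑ d, f c d n := Finset.sum_congr rfl fun _ _ => Finset.sum_comm
        _ = _ := Finset.sum_comm
    simp only [Finset.mul_sum]
    symm
    rw [h3]
    refine Finset.sum_congr rfl fun m _ => ?_
    rw [h3]
    refine Finset.sum_congr rfl fun n _ => ?_
    rw [h3]
    refine Finset.sum_congr rfl fun k _ => ?_
    rw [h3]
    exact Finset.sum_congr rfl fun l _ => Finset.sum_congr rfl fun c _ =>
      Finset.sum_congr rfl fun d _ => by ring
  have h4 := h2 (fun m n k l => K m k y * K n l y * S a k l b y) (fun c d => v c y * v d y)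
  have h5 : ∀ m n k l, K m k y * K n l y * (∑ c, ∑ d, v c y * v d y * Y c m n d y) * S a k l b y =
      K m k y * K n l y * S a k l b y * ∑ c, ∑ d, v c y * v d y * Y c m n d y :=
    fun m n k l => by ring
  simp only [h5]
  rw [h4, Finset.mul_sum]
  refine Finset.sum_congr rfl fun c _ => ?_
  rw [Finset.mul_sum]
  exact Finset.sum_congr rfl fun d _ => by ring

variable (g)

/-- The weight is (σ⁻¹ σ̄⁻¹)³, and the conjugate Mars–Simon tensor is the same construction with -i
and the reciprocal of σ̄. In this form neither the modulus nor the conjugation needs to be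
differentiated further. -/
lemma current_eq {y : E4} (hK : ∀ a b y, cast₂ (ginv g) a b y = cast₂ (ginv g) b a y)
    (hξ : ∀ b, ((ξ b y : ℝ) : ℂ) = ∑ c, cast₂ (ginv g) b c y * ((lower g ξ c y : ℝ) : ℂ))
    (σ : E4 → ℂ) (e : Fin 4) : current g ξ η σ e y =
      weightedCurrent (cast₂ (ginv g)) (fun a y => ((lower g ξ a y : ℝ) : ℂ))
        (fun y => ((σ y)⁻¹ * (starRingEnd ℂ (σ y))⁻¹) ^ 3)
        (msField (cast₂ (ginv g)) (cast₂ g) (cast₄ η) (cast₂ (killingForm g ξ)) (cast₄ (weyl g))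
          Complex.I (fun y => (σ y)⁻¹))
        (msField (cast₂ (ginv g)) (cast₂ g) (cast₄ η) (cast₂ (killingForm g ξ)) (cast₄ (weyl g))
          (-Complex.I) (fun y => (starRingEnd ℂ (σ y))⁻¹)) e y := by
  have hr : (1 : ℂ) / ((‖σ y‖ ^ 6 : ℝ) : ℂ) = ((σ y)⁻¹ * (starRingEnd ℂ (σ y))⁻¹) ^ 3 := by
    rw [← mul_inv, Complex.mul_conj', one_div, ← inv_pow]
    push_cast
    ring
  have hY : ∀ a b c d, starRingEnd ℂ (msField (cast₂ (ginv g)) (cast₂ g) (cast₄ η)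
      (cast₂ (killingForm g ξ)) (cast₄ (weyl g)) Complex.I (fun y => (σ y)⁻¹) a b c d y) =
      msField (cast₂ (ginv g)) (cast₂ g) (cast₄ η) (cast₂ (killingForm g ξ)) (cast₄ (weyl g))
          (-Complex.I) (fun y => (starRingEnd ℂ (σ y))⁻¹) a b c d y := fun a b c d => by
    rw [conj_msField]; simp only [Complex.conj_I, map_inv₀]
  rw [current, hr, weightedCurrent, Finset.mul_sum]
  refine Finset.sum_congr rfl fun a _ => ?_
  rw [superCurrent_eq hK (v := fun b y => ((ξ b y : ℝ) : ℂ)) hξ]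
  simp only [superenergy, marsSimon_eq, hY]
  simp only [mul_assoc (cast₂ (ginv g) e a y), ← Finset.mul_sum]
  ring

end Definitions

namespace IsMetricOn

variable {g : Fin 4 → Fin 4 → E4 → ℝ} {O : Set E4} (hg : IsMetricOn g O) {p : E4} (hp : p ∈ O)
  {E : Fin 4 → Fin 4 → ℂ}
  (hE : ∀ i j, ∑ a, ∑ b, E i a * E j b * ((g a b p : ℝ) : ℂ) = if i = j then 1 else 0)
include hg hp hE

/-- The current of an Ernst potential is real, differentiable and conserved: the theorem in
coordinates. -/
theorem current_conserved (hvac : ∀ y ∈ O, ∀ a b, ricci g a b y = 0) {ξ : Fin 4 → E4 → ℝ}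
    (hξ : ∀ a, ContDiffOn ℝ ∞ (ξ a) O)
    (hk : ∀ y ∈ O, ∀ a b, killingForm g ξ a b y + killingForm g ξ b a y = 0)
    {η : Fin 4 → Fin 4 → Fin 4 → Fin 4 → E4 → ℝ}
    (hη : ∀ a b c d y, η a b c d y = η 0 1 2 3 y * levi ℝ a b c d)
    (hd : DifferentiableAt ℝ (η 0 1 2 3) p) (hsq : ∀ y ∈ O, (η 0 1 2 3 y) ^ 2 = - (gMat g y).det)
    {σ : E4 → ℂ} (hσ : DifferentiableAt ℝ σ p) (hσd : ∀ a, pd a σ p = ernstForm g ξ η a p)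
    (h0 : σ p ≠ 0) :
    (∀ e, (current g ξ η σ e p).im = 0) ∧ (∀ e, DifferentiableAt ℝ (current g ξ η σ e) p) ∧
      divergence g (current g ξ η σ) p = 0 := by
  obtain ⟨κ, F₀, x₀, W₀, dW₀, h⟩ := hg.isVacuumJet hp hE hvac hξ hk hη hd hsq
  have hcd : DifferentiableAt ℝ (fun y => starRingEnd ℂ (σ y)) p :=
    Complex.conjCLE.differentiableAt.comp p hσ
  have hpdc : ∀ a, pd a (fun y => starRingEnd ℂ (σ y)) p = starRingEnd ℂ (pd a σ p) := by
    intro a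
    have := (Complex.conjCLE.hasFDerivAt.comp p hσ.hasFDerivAt).fderiv
    simp only [pd]
    change fderiv ℝ (Complex.conjCLE ∘ σ) p _ = _
    rw [this]; simp
  have ht := h.jet_ernst_inv hσ h0 (j := Complex.I) fun a => by
    rw [hσd, ernstForm]; simp only [sdKilling_eq]
  -- The conjugate of the Ernst equation: ξ is real, so σ̄ is a potential for the anti-self-dual
  -- Killing form.
  have ht' := h.jet_ernst_inv hcd ((map_ne_zero _).2 h0) (j := -Complex.I) fun a => by
    rw [hpdc, hσd, ernstForm]
    simp only [sdKilling_eq, map_mul, map_sum, conj_sdForm, Complex.conj_I, Complex.conj_ofReal,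
      map_ofNat]
  have hcur : ∀ e, current g ξ η σ e =ᶠ[nhds p] _ := fun e => by
    filter_upwards [h.raise] with y hy using current_eq g η h.symm hy σ e
  refine ⟨fun e => ?_, fun e => ?_, ?_⟩
  -- Conjugation interchanges the two Mars–Simon tensors, and the current is symmetric in them.
  · rw [← Complex.conj_eq_iff_im, (hcur e).self_of_nhds]
    refine (conj_weightedCurrent ?_ (fun a b c d => conj_msField _ _ a b c d p)
      (fun a b c d => conj_msField _ _ a b c d p) e).trans ?_
    · simp only [map_pow, map_mul, map_inv₀, Complex.conj_conj]
      ring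
    · simp only [map_inv₀, Complex.conj_conj, map_neg, Complex.conj_I, neg_neg]
      exact (h.weightedCurrent_comm Complex.I_mul_I rfl ht ht' _ e).symm
  · refine DifferentiableAt.congr_of_eventuallyEq ?_ (hcur e)
    exact h.diff_weightedCurrent ht ht' ((ht.mul ht').diff.fun_pow 3) e
  · have hdiv := h.divergence_weightedCurrent Complex.I_mul_I rfl ht ht'
    rw [← hdiv, divergence]
    refine Finset.sum_congr rfl fun e _ => ?_
    rw [pd_congr _ (hcur e)]
    congr 1
    exact Finset.sum_congr rfl fun b _ => by rw [(hcur b).self_of_nhds]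

end IsMetricOn

end MarsSimon

/-! ## Charts of a Lorentzian manifold -/

namespace MarsSimon

section Charts

variable {M : Type*} [TopologicalSpace M] [ChartedSpace E4 M] [IsManifold 𝓘(ℝ, E4) ∞ M]
  {φ : OpenPartialHomeomorph M E4}

namespace IsChart

variable (hφ : IsChart φ)
include hφ

omit [IsManifold 𝓘(ℝ, E4) ∞ M] in
lemma contMDiffOn_symm : ContMDiffOn 𝓘(ℝ, E4) 𝓘(ℝ, E4) ∞ φ.symm φ.target :=
  contMDiffOn_symm_of_mem_maximalAtlas hφ

omit [IsManifold 𝓘(ℝ, E4) ∞ M] in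
lemma contMDiffOn : ContMDiffOn 𝓘(ℝ, E4) 𝓘(ℝ, E4) ∞ φ φ.source :=
  contMDiffOn_of_mem_maximalAtlas hφ

omit [IsManifold 𝓘(ℝ, E4) ∞ M] in
lemma mdifferentiable : φ.MDifferentiable 𝓘(ℝ, E4) 𝓘(ℝ, E4) :=
  ⟨hφ.contMDiffOn.mdifferentiableOn (by simp), hφ.contMDiffOn_symm.mdifferentiableOn (by simp)⟩

/-- A coordinate field is the image of a constant section under the tangent map of the inverse
chart. -/
lemma contMDiffOn_coordVec (i : Fin 4) :
    ContMDiffOn 𝓘(ℝ, E4) (𝓘(ℝ, E4).prod 𝓘(ℝ, E4)) ∞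
      (fun y => (⟨φ.symm y, coordVec φ y i⟩ : TangentBundle 𝓘(ℝ, E4) M)) φ.target := by
  have h1 := hφ.contMDiffOn_symm.contMDiffOn_tangentMapWithin (m := ∞) (by simp)
    φ.open_target.uniqueMDiffOn
  have h2 : ContMDiffOn 𝓘(ℝ, E4) (𝓘(ℝ, E4).prod 𝓘(ℝ, E4)) ∞
      (fun y : E4 => (⟨y, (EuclideanSpace.single i (1 : ℝ) : E4)⟩ : TangentBundle 𝓘(ℝ, E4) E4))
      φ.target :=
    contMDiffOn_vectorSpace_iff_contDiffOn.2 contDiffOn_const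
  refine (h1.comp h2 fun y hy => hy).congr fun y hy => ?_
  simp only [Function.comp_def, tangentMapWithin]
  rw [mfderivWithin_of_isOpen φ.open_target hy]
  rfl

lemma contDiffOn_comp (g : LorentzMetric M) (a b : Fin 4) :
    ContDiffOn ℝ ∞ (g.comp φ a b) φ.target := by
  rw [← contMDiffOn_iff_contDiffOn]
  have h1 : ContMDiffOn 𝓘(ℝ, E4) (𝓘(ℝ, E4).prod 𝓘(ℝ)) ∞
      (fun y ↦ Bundle.TotalSpace.mk' ℝ (E := Bundle.Trivial M ℝ) (φ.symm y) (g.comp φ a b y))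
      φ.target := by
    apply ContMDiffOn.clm_bundle_apply₂ (F₁ := E4) (F₂ := E4)
      (E₁ := fun x : M => TangentSpace 𝓘(ℝ, E4) x) (E₂ := fun x : M => TangentSpace 𝓘(ℝ, E4) x)
    · exact g.contMDiff.comp_contMDiffOn hφ.contMDiffOn_symm
    · exact hφ.contMDiffOn_coordVec a
    · exact hφ.contMDiffOn_coordVec b
  intro y hy
  have h2 := h1 y hy
  simp only [Bundle.contMDiffWithinAt_totalSpace] at h2
  exact h2.2

lemma contDiffOn_vecComp {ξ : ∀ x : M, TangentSpace 𝓘(ℝ, E4) x}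
    (hξ : ContMDiff 𝓘(ℝ, E4) (𝓘(ℝ, E4).prod 𝓘(ℝ, E4)) ∞
      (fun x ↦ (⟨x, ξ x⟩ : TangentBundle 𝓘(ℝ, E4) M))) (a : Fin 4) :
    ContDiffOn ℝ ∞ (vecComp φ ξ a) φ.target := by
  have h1 := hφ.contMDiffOn.contMDiffOn_tangentMapWithin (m := ∞) (by simp)
    φ.open_source.uniqueMDiffOn
  have h2 := h1.comp (hξ.comp_contMDiffOn hφ.contMDiffOn_symm) fun y hy => φ.map_target hy
  have h3 := ((contMDiff_snd_tangentBundle_modelSpace E4 𝓘(ℝ, E4)).comp_contMDiffOn h2).contDiffOn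
  have h4 := (EuclideanSpace.proj a : E4 →L[ℝ] ℝ).contDiff.comp_contDiffOn h3
  refine h4.congr fun y hy => ?_
  have h5 := mfderivWithin_of_isOpen (I := 𝓘(ℝ, E4)) (I' := 𝓘(ℝ, E4)) (f := φ) φ.open_source
    (φ.map_target hy)
  exact congrArg (fun L : TangentSpace 𝓘(ℝ, E4) (φ.symm y) →L[ℝ] E4 => L (ξ (φ.symm y)) a) h5.symm

/-- The components of a tangent vector. -/
abbrev _root_.MarsSimon.comps (φ : OpenPartialHomeomorph M E4) (y : E4)
    (v : TangentSpace 𝓘(ℝ, E4) (φ.symm y)) (a : Fin 4) : ℝ :=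
  (show E4 from mfderiv 𝓘(ℝ, E4) 𝓘(ℝ, E4) φ (φ.symm y) v) a

omit [IsManifold 𝓘(ℝ, E4) ∞ M] in
/-- A tangent vector is the combination of the coordinate vectors with its components. -/
lemma eq_sum_coordVec {y : E4} (hy : y ∈ φ.target) (v : TangentSpace 𝓘(ℝ, E4) (φ.symm y)) :
    v = ∑ a, comps φ y v a • coordVec φ y a := by
  have h2 := congrArg (fun L => L v) (hφ.mdifferentiable.symm_comp_deriv (φ.map_target hy))
  rw [φ.right_inv hy] at h2
  have h4 : ∀ (L : E4 →L[ℝ] TangentSpace 𝓘(ℝ, E4) (φ.symm y)) (w : E4),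
      L w = ∑ a, w a • L (EuclideanSpace.single a (1 : ℝ)) := by
    intro L w
    have h3 : w = ∑ a, w a • (EuclideanSpace.single a (1 : ℝ) : E4) := by
      ext i; simp [Finset.sum_apply, Pi.single_apply]
    conv_lhs => rw [h3, map_sum]
    simp only [map_smul]
  exact h2.symm.trans (h4 (mfderiv 𝓘(ℝ, E4) 𝓘(ℝ, E4) φ.symm y) _)

/-- A complex orthonormal frame of the metric components. -/
lemma exists_frame (g : LorentzMetric M) {y : E4} (hy : y ∈ φ.target) :
    ∃ E : Fin 4 → Fin 4 → ℂ, ∀ i j,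
      ∑ a, ∑ b, E i a * E j b * ((g.comp φ a b y : ℝ) : ℂ) = if i = j then 1 else 0 := by
  obtain ⟨e, he⟩ := g.signature (φ.symm y)
  have h1 : ∀ i j, ∑ a, ∑ b, comps φ y (e i) a * comps φ y (e j) b * g.comp φ a b y =
      Matrix.diagonal ![1, -1, -1, -1] i j := by
    intro i j
    rw [← he i j]
    conv_rhs => rw [hφ.eq_sum_coordVec hy (e i), hφ.eq_sum_coordVec hy (e j)]
    simp only [map_sum, map_smul, _root_.sum_apply, _root_.smul_apply,
      smul_eq_mul, Finset.mul_sum]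
    rw [Finset.sum_comm]
    exact Finset.sum_congr rfl fun a _ => Finset.sum_congr rfl fun b _ => by
      rw [LorentzMetric.comp]; ring
  -- The factors i square to -1 and turn the signature (+,-,-,-) into δ_ij.
  set c : Fin 4 → ℂ := ![1, Complex.I, Complex.I, Complex.I] with hc
  refine ⟨fun i a => c i * comps φ y (e i) a, fun i j => ?_⟩
  have h2 : ∑ a, ∑ b, (c i * comps φ y (e i) a) * (c j * comps φ y (e j) b)
      * ((g.comp φ a b y : ℝ) : ℂ) = c i * c j * ((Matrix.diagonal ![1, -1, -1, -1] i j : ℝ) : ℂ) := by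
    rw [← h1]
    push_cast
    simp only [Finset.mul_sum]
    exact Finset.sum_congr rfl fun a _ => Finset.sum_congr rfl fun b _ => by ring
  rw [h2, Matrix.diagonal_apply]
  split_ifs with hij
  · subst hij
    fin_cases i <;> simp [hc]
  · simp

lemma isMetricOn (g : LorentzMetric M) {O : Set E4} (hO : IsOpen O) (hOφ : O ⊆ φ.target) :
    IsMetricOn (g.comp φ) O where
  isOpen := hO
  smooth a b := (hφ.contDiffOn_comp g a b).mono hOφ
  symm a b y := g.symm _ _ _
  det_ne y hy h0 := by
    -- Taking determinants in E g Eᵀ = 1 excludes det g = 0.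
    obtain ⟨E, hE⟩ := hφ.exists_frame g (hOφ hy)
    have h1 : Matrix.of E * ((Matrix.of fun i j => g.comp φ i j y).map Complex.ofRealHom *
        (Matrix.of E).transpose) = 1 := by
      ext i j
      rw [Matrix.one_apply, ← hE i j]
      simp only [Matrix.mul_apply, Matrix.of_apply, Matrix.transpose_apply, Matrix.map_apply,
        Finset.mul_sum]
      exact Finset.sum_congr rfl fun _ _ => Finset.sum_congr rfl fun _ _ => by
        simp only [Complex.ofRealHom_eq_coe]; ring
    have h2 := congrArg Matrix.det h1
    rw [Matrix.det_mul, Matrix.det_mul, ← RingHom.mapMatrix_apply, ← RingHom.map_det, h0] at h2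
    simp at h2

end IsChart

omit [IsManifold 𝓘(ℝ, E4) ∞ M] in
/-- A 4-form is determined by one of its components. -/
lemma formComp_eq (η : ∀ x : M, (TangentSpace 𝓘(ℝ, E4) x) [⋀^Fin 4]→ₗ[ℝ] ℝ) (a b c d : Fin 4)
    (y : E4) : formComp φ η a b c d y = formComp φ η 0 1 2 3 y * levi ℝ a b c d := by
  set L : (Fin 4 → ℝ) →ₗ[ℝ] TangentSpace 𝓘(ℝ, E4) (φ.symm y) :=
    Fintype.linearCombination ℝ (coordVec φ y) with hL
  -- Pulled back to ℝ⁴ along the coordinate vectors, a form of top degree is a multiple of the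
  -- determinant.
  have h1 := AlternatingMap.eq_smul_basis_det (Pi.basisFun ℝ (Fin 4))
    ((η (φ.symm y)).compLinearMap L)
  have h2 : ∀ a, L (Pi.single a 1) = coordVec φ y a := fun a => by
    rw [hL, Fintype.linearCombination_apply_single, one_smul]
  have h3 : ∀ a b c d : Fin 4, formComp φ η a b c d y = ((η (φ.symm y)).compLinearMap L)
      ![Pi.single a 1, Pi.single b 1, Pi.single c 1, Pi.single d 1] := by
    intro a b c d
    rw [AlternatingMap.compLinearMap_apply, formComp]
    congr 1
    funext i
    fin_cases i <;> simp [h2]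
  have h4 : (Pi.basisFun ℝ (Fin 4) : Fin 4 → Fin 4 → ℝ) =
      ![Pi.single 0 1, Pi.single 1 1, Pi.single 2 1, Pi.single 3 1] := by
    funext i
    fin_cases i <;> simp
  calc formComp φ η a b c d y = ((η (φ.symm y)).compLinearMap L (Pi.basisFun ℝ (Fin 4)) •
        (Pi.basisFun ℝ (Fin 4)).det)
          ![Pi.single a 1, Pi.single b 1, Pi.single c 1, Pi.single d 1] := by rw [h3, ← h1]
    _ = formComp φ η 0 1 2 3 y * levi ℝ a b c d := by
        rw [h3 0 1 2 3, ← h4, AlternatingMap.smul_apply, Pi.basisFun_det_apply, smul_eq_mul,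
          ← det_single_eq_levi]

end Charts

end MarsSimon

/-! ## Ernst potentials on a manifold -/

namespace MarsSimon

namespace LorentzMetric

variable {M : Type*} [TopologicalSpace M] [ChartedSpace E4 M] [IsManifold 𝓘(ℝ, E4) ∞ M]
  {g : LorentzMetric M} {ξ : ∀ x : M, TangentSpace 𝓘(ℝ, E4) x} {U : Set M}
  {η : ∀ x : M, (TangentSpace 𝓘(ℝ, E4) x) [⋀^Fin 4]→ₗ[ℝ] ℝ} {σ : M → ℂ}

omit [IsManifold 𝓘(ℝ, E4) ∞ M] in
/-- The coordinate expression of a differentiable function is differentiable. -/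
lemma differentiableAt_comp_symm {φ : OpenPartialHomeomorph M E4} (hφ : IsChart φ) {y : E4}
    (hy : y ∈ φ.target) (hσ : MDifferentiableAt 𝓘(ℝ, E4) 𝓘(ℝ, ℂ) σ (φ.symm y)) :
    DifferentiableAt ℝ (σ ∘ φ.symm) y := by
  rw [← mdifferentiableAt_iff_differentiableAt]
  exact hσ.comp y (hφ.mdifferentiable.mdifferentiableAt_symm hy)

/-- The current of an Ernst potential is real, differentiable and conserved where the potential
does not vanish. -/
theorem IsErnstPotential.isRealConservedCurrentOn (hvac : g.IsVacuum) (hξ : g.IsKilling ξ)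
    (hU : IsOpen U) (hη : g.IsVolumeFormOn η U) (hσ : g.IsErnstPotential ξ η U σ) {V : Set M}
    (hV : V ⊆ U) (h0 : ∀ x ∈ V, σ x ≠ 0) : g.IsRealConservedCurrentOn ξ η σ V := by
  intro φ hφ y hy hyV
  have hO := φ.isOpen_inter_preimage_symm hU
  have hyO : y ∈ φ.target ∩ φ.symm ⁻¹' U := ⟨hy, hV hyV⟩
  obtain ⟨E, hE⟩ := hφ.exists_frame g hy
  exact (hφ.isMetricOn g hO Set.inter_subset_left).current_conserved hyO hE
    (fun z hz => hvac φ hφ z hz.1) (fun a => (hφ.contDiffOn_vecComp hξ.contMDiff a).mono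
      Set.inter_subset_left) (fun z hz => hξ.killing φ hφ z hz.1)
    (fun a b c d z => formComp_eq η a b c d z)
    (differentiableAt_of_smooth (hη.smooth φ hφ 0 1 2 3) hO hyO)
    (fun z hz => by
      -- The Gram matrix of the coordinate vectors is the matrix of metric components.
      have h1 := hη.sq_eq (φ.symm z) hz.2 (coordVec φ z)
      have h2 : coordVec φ z = ![coordVec φ z 0, coordVec φ z 1, coordVec φ z 2, coordVec φ z 3] := by
        funext i; fin_cases i <;> rfl
      have h3 : formComp φ η 0 1 2 3 z = η (φ.symm z) (coordVec φ z) := by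
        rw [formComp, ← h2]
      rw [h3, h1]; rfl)
    (differentiableAt_comp_symm hφ hy (hσ.mdifferentiableAt _ (hV hyV)))
    (hσ.deriv_eq φ hφ y hy (hV hyV)) (h0 _ hyV)

lemma IsErnstPotential.add_const (hσ : g.IsErnstPotential ξ η U σ) (k : ℂ) :
    g.IsErnstPotential ξ η U (fun x => σ x + k) where
  mdifferentiableAt x hx := (hσ.mdifferentiableAt x hx).add mdifferentiableAt_const
  deriv_eq φ hφ y hy hyU a := by
    rw [← hσ.deriv_eq φ hφ y hy hyU a]
    change pd a (fun z => (σ ∘ φ.symm) z + k) y = _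
    rw [pd_add a (differentiableAt_comp_symm hφ hy (hσ.mdifferentiableAt _ hyU))
      (differentiableAt_const k), pd_const, add_zero]

lemma fderiv_eq_zero_of_pd {V : Type*} [NormedAddCommGroup V] [NormedSpace ℝ V] {f : E4 → V}
    {y : E4} (h : ∀ a, pd a f y = 0) : fderiv ℝ f y = 0 := by
  refine (ContinuousLinearMap.coe_injective ?_)
  refine (EuclideanSpace.basisFun (Fin 4) ℝ).toBasis.ext fun a => ?_
  simpa [pd] using h a

/-- Ernst potentials on a connected open set are unique up to a constant. -/
theorem IsErnstPotential.exists_eq_add_const (hU : IsOpen U) (hc : IsPreconnected U)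
    {σ' : M → ℂ} (hσ : g.IsErnstPotential ξ η U σ) (hσ' : g.IsErnstPotential ξ η U σ') :
    ∃ k : ℂ, ∀ x ∈ U, σ' x = σ x + k := by
  have key : ∀ x ∈ U, ∀ᶠ z in nhds x, σ' z - σ z = σ' x - σ x := by
    intro x hx
    set φ := chartAt E4 x with hφdef
    have hφ : IsChart φ := IsManifold.chart_mem_maximalAtlas x
    have hO := φ.isOpen_inter_preimage_symm hU
    have hd : ∀ y ∈ φ.target ∩ φ.symm ⁻¹' U, DifferentiableAt ℝ (σ' ∘ φ.symm) y ∧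
        DifferentiableAt ℝ (σ ∘ φ.symm) y := fun y hy =>
      ⟨differentiableAt_comp_symm hφ hy.1 (hσ'.mdifferentiableAt _ hy.2),
        differentiableAt_comp_symm hφ hy.1 (hσ.mdifferentiableAt _ hy.2)⟩
    -- A function with zero derivative on an open set is locally constant, so the level set through
    -- the point is open, without any connectedness of the chart domain.
    have h1 := hO.isOpen_inter_preimage_of_fderiv_eq_zero (𝕜 := ℝ)
      (f := fun y => (σ' ∘ φ.symm) y - (σ ∘ φ.symm) y)
      (fun y hy => ((hd y hy).1.fun_sub (hd y hy).2).differentiableWithinAt)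
      (fun y hy => fderiv_eq_zero_of_pd fun a => by
        rw [pd_sub a (hd y hy).1 (hd y hy).2, hσ.deriv_eq φ hφ y hy.1 hy.2,
          hσ'.deriv_eq φ hφ y hy.1 hy.2, sub_self]) {σ' x - σ x}
    have hxs : x ∈ φ.source := mem_chart_source E4 x
    have h2 : φ x ∈ (φ.target ∩ φ.symm ⁻¹' U) ∩
        (fun y => (σ' ∘ φ.symm) y - (σ ∘ φ.symm) y) ⁻¹' {σ' x - σ x} := by
      refine ⟨⟨φ.map_source hxs, ?_⟩, ?_⟩ <;> simp [φ.left_inv hxs, hx]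
    filter_upwards [(φ.continuousAt hxs).preimage_mem_nhds (h1.mem_nhds h2),
      φ.open_source.mem_nhds hxs] with z hz hzs
    simpa [φ.left_inv hzs] using hz.2
  rcases U.eq_empty_or_nonempty with rfl | ⟨x₀, hx₀⟩
  · exact ⟨0, by simp⟩
  · refine ⟨σ' x₀ - σ x₀, fun x hx => ?_⟩
    -- Having equal values of the difference is an equivalence relation that holds locally, hence on
    -- all of the preconnected set.
    have := hc.induction₂ (fun x z => σ' z - σ z = σ' x - σ x)
      (fun x hx => (key x hx).filter_mono nhdsWithin_le_nhds)
      (fun x y z _ _ _ h1 h2 => h2.trans h1) (fun x y _ _ h => h.symm) hx₀ hx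
    linear_combination this

end LorentzMetric

end MarsSimon

end

theorem mainTheorem1 {M : Type*} [TopologicalSpace M] [ChartedSpace MarsSimon.E4 M]
    [IsManifold 𝓘(ℝ, MarsSimon.E4) ∞ M]
    (g : MarsSimon.LorentzMetric M) (hvac : g.IsVacuum)
    (ξ : ∀ x : M, TangentSpace 𝓘(ℝ, MarsSimon.E4) x) (hξ : g.IsKilling ξ)
    (U : Set M) (hU : IsOpen U)
    (η : ∀ x : M, (TangentSpace 𝓘(ℝ, MarsSimon.E4) x) [⋀^Fin 4]→ₗ[ℝ] ℝ)
    (hη : g.IsVolumeFormOn η U)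
    (σ : M → ℂ) (hσ : g.IsErnstPotential ξ η U σ) (hσ0 : ∀ x ∈ U, σ x ≠ 0) :
    g.IsRealConservedCurrentOn ξ η σ U ∧
    (∀ k : ℂ, g.IsErnstPotential ξ η U (fun x => σ x + k) ∧
      g.IsRealConservedCurrentOn ξ η (fun x => σ x + k) {x ∈ U | σ x + k ≠ 0}) ∧
    (IsPreconnected U → ∀ σ' : M → ℂ, g.IsErnstPotential ξ η U σ' →
      ∃ k : ℂ, ∀ x ∈ U, σ' x = σ x + k) :=
  ⟨hσ.isRealConservedCurrentOn hvac hξ hU hη subset_rfl hσ0,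
    fun k => ⟨hσ.add_const k, (hσ.add_const k).isRealConservedCurrentOn hvac hξ hU hη
      (fun _ hx => hx.1) fun _ hx => hx.2⟩,
    fun hc _ hσ' => hσ.exists_eq_add_const hU hc hσ'⟩
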